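/- Let $M$ be a manifold of dimension $n$ (smooth, real analytic or complex analytic), $\mathscr{O}$ its sheaf of $\mathbb{C}$-valued smooth, real analytic or holomorphic functions, and $\mathscr{T}$ its (complexified) tangent sheaf, equipped with an associative $\mathscr{O}$-bilinear multiplication with unit vector field $e$ and with a nondegenerate symmetric $\mathscr{O}$-bilinear metric $g$ such that $g(XY,Z)=g(X,YZ)$ (for instance, let $M$ be a Frobenius manifold); put $\theta(X)=g(e,X)$. An open set $U\subseteq M$ is *semisimple* if $\mathscr{T}|_U\cong\mathscr{O}_U^n$ as sheaves of algebras, i.e. if $\mathscr{T}|_U$ has an $\mathscr{O}_U$-basis $e_1,\dots,e_n$ of orthogonal idempotents. Locally free modules are understood to have locally finite rank. A *Cardy category of labels* over an open set $U$ consists of a category of labels enriched in sheaves of $\mathscr{O}_U$-modules $\Gamma_{ab}$ (with $\mathscr{O}_U$-bilinear composition) such that all $\Gamma_{ab}$ are locally free, together with $\mathscr{O}_U$-linear traces $\theta_a:\Gamma_{aa}\to\mathscr{O}_U$ satisfying $\theta_a(\tau\sigma)=\theta_b(\sigma\tau)$ for $\sigma\in\Gamma_{ab}$, $\tau\in\Gamma_{ba}$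 and inducing perfect pairings $\Gamma_{ab}\otimes\Gamma_{ba}\to\mathscr{O}_U$, and with homomorphisms of algebras $\iota_a:\mathscr{T}_U\to\Gamma_{aa}$ and $\mathscr{O}_U$-linear maps $\iota^a:\Gamma_{aa}\to\mathscr{T}_U$ such that (centrality) $\sigma\iota_a(X)=\iota_b(X)\sigma$ for $\sigma\in\Gamma_{ab}$; (adjunction) $\theta(\iota^a(\sigma)X)=\theta_a(\sigma\iota_a(X))$; (Cardy condition) for each local basis $(\sigma_i)$ of $\Gamma_{ab}$ with dual basis $(\sigma^i)$ of $\Gamma_{ba}$ and each local section $\sigma$ of $\Gamma_{aa}$, $\sum_i\sigma_i\,\sigma\,\sigma^i=\iota_b(\iota^a(\sigma))$. It is *maximal* if it cannot be enlarged: whenever it is embedded in a Cardy category of labels over $U$ (fully faithfully on the sheaves of morphisms and preserving all the structure), each label of the latter is isomorphic to a label of the former. A *Cardy fibration* $\mathscr{B}$ over $M$ is a stack of $\mathscr{O}$-linear categories on $M$ whose sheaves of morphisms $\Gamma_{ab}$ ($a,b\in\mathscr{B}(U)$) are locally free, with traces $\theta_a$ as above compatible with restriction, together with a cover $\mathfrak{C}$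 of $M$ by semisimple open sets and, for each $U\in\mathfrak{C}$, with maps $\iota_a,\iota^a$, compatible with restriction, that make $\mathscr{B}(U)$ a Cardy category of labels over $U$. It is *trivializable* if each open subset of a member of $\mathfrak{C}$ belongs to $\mathfrak{C}$, and *maximal* if for each $U\in\mathfrak{C}$ the Cardy category of labels $\mathscr{B}(U)$ over $U$ is maximal. For an open set $U$ let $\mathsf{LF}_{\mathscr{O}_U}$ be the category of locally free $\mathscr{O}_U$-modules, and let $\mathsf{LF}_{\mathscr{T}_U}$ be the category of $\mathscr{T}_U$-modules that are locally free over the spectral cover $\pi:S\to M$ (where $\pi_*\mathscr{O}_S=\mathscr{T}$), i.e. that are locally, in terms of a basis $e_1,\dots,e_n$ of orthogonal idempotents, isomorphic to $\bigoplus_i(e_i\mathscr{T})^{d_i}$ with finite $d_i\ge 0$. For a locally free $\mathscr{O}_U$-module $\mathscr{M}$ and a label $a\in\mathscr{B}(U)$, the label $\mathscr{M}\otimes a$ is characterized by isomorphisms of sheaves $\Gamma_{(\mathscr{M}\otimes a)b}\cong\mathscr{M}^*\otimes\Gamma_{ab}$, natural in $b$. **Theorem.** Let $\mathscr{B}$ be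 a maximal trivializable Cardy fibration over $M$. Then there is a cover $\mathfrak{U}$ of $M$ by semisimple open sets (belonging to $\mathfrak{C}$) such that for each $U\in\mathfrak{U}$ there are a basis $e_1,\dots,e_n$ of orthogonal idempotents of $\mathscr{T}|_U$ and labels $\xi_1,\dots,\xi_n\in\mathscr{B}(U)$ with $\iota_{\xi_i}(e_i)=1_{\xi_i}$ and $\Gamma_{\xi_i\xi_i}\cong\mathscr{O}_U$ for which the functor $$F:\mathscr{B}(U)\to\mathsf{LF}^n_{\mathscr{O}_U},\qquad a\mapsto(\Gamma_{\xi_1a},\dots,\Gamma_{\xi_na}),\qquad \sigma\mapsto\sigma\circ(-),$$ is an equivalence of categories; the functor $$G:\mathsf{LF}^n_{\mathscr{O}_U}\to\mathscr{B}(U),\qquad (\mathscr{M}_1,\dots,\mathscr{M}_n)\mapsto\bigoplus_i\mathscr{M}_i\otimes\xi_i,$$ is defined (the direct sums and products exist in $\mathscr{B}(U)$), there are natural isomorphisms $GF\cong\mathrm{id}$ and $FG\cong\mathrm{id}$, the latter being given by the canonical morphisms $\mathscr{M}_i\to\Gamma_{\xi_i(\mathscr{M}_i\otimes\xi_i)}\to\Gamma_{\xi_i(\bigoplus_j\mathscr{M}_j\otimes\xi_j)}$.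 Moreover $\mathscr{B}(U)$ is equivalent to $\mathsf{LF}_{\mathscr{T}_U}$. -/

import Mathlib

open CategoryTheory TopologicalSpace Opposite
open scoped ContDiff Manifold

universe u

namespace BraneFibration

noncomputable section

/-! ### Sheaves of functions, vector fields -/

/-- A sheaf of `ℂ`-algebras of `ℂ`-valued functions on a topological space. -/
structure FunctionSheaf (M : Type u) [TopologicalSpace M] where
  /-- the algebra of sections over `U` -/
  sec (U : Opens M) : Subalgebra ℂ (U → ℂ)
  res_mem {U V : Opens M} (h : V ≤ U) {f : U → ℂ} (hf : f ∈ sec U) :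
    f ∘ Set.inclusion h ∈ sec V
  mem_of_locally {U : Opens M} (f : U → ℂ)
    (hf : ∀ x : U, ∃ (V : Opens M) (h : V ≤ U), (x : M) ∈ V ∧ f ∘ Set.inclusion h ∈ sec V) :
    f ∈ sec U

namespace FunctionSheaf

variable {M : Type u} [TopologicalSpace M] (𝒪 : FunctionSheaf M)

/-- Restriction of functions. -/
def res {U V : Opens M} (h : V ≤ U) : 𝒪.sec U →ₐ[ℂ] 𝒪.sec V where
  toFun f := ⟨f.1 ∘ Set.inclusion h, 𝒪.res_mem h f.2⟩
  map_one' := rfl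
  map_mul' _ _ := rfl
  map_zero' := rfl
  map_add' _ _ := rfl
  commutes' _ := rfl

@[simp] lemma res_apply {U V : Opens M} (h : V ≤ U) (f : 𝒪.sec U) (x : V) :
    (𝒪.res h f).1 x = f.1 ⟨x, h x.2⟩ := rfl

@[simp] lemma res_self {U : Opens M} (f : 𝒪.sec U) : 𝒪.res le_rfl f = f := rfl

@[simp] lemma res_res {U V W : Opens M} (h : V ≤ U) (h' : W ≤ V) (f : 𝒪.sec U) :
    𝒪.res h' (𝒪.res h f) = 𝒪.res (h'.trans h) f := rfl

lemma ext_locally {U : Opens M} {f g : 𝒪.sec U}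
    (h : ∀ x ∈ U, ∃ (V : Opens M) (h : V ≤ U), x ∈ V ∧ 𝒪.res h f = 𝒪.res h g) : f = g := by
  apply Subtype.ext
  funext x
  obtain ⟨V, hV, hx, e⟩ := h x x.2
  exact congrFun (congrArg Subtype.val e) ⟨x, hx⟩

/-- Gluing of functions. -/
lemma exists_glue {U : Opens M} {ι : Type*} (V : ι → Opens M) (hV : ∀ i, V i ≤ U)
    (hU : ∀ x ∈ U, ∃ i, x ∈ V i) (f : ∀ i, 𝒪.sec (V i))
    (hf : ∀ i j (x : M) (hi : x ∈ V i) (hj : x ∈ V j), (f i).1 ⟨x, hi⟩ = (f j).1 ⟨x, hj⟩) :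
    ∃ g : 𝒪.sec U, ∀ i, 𝒪.res (hV i) g = f i := by
  choose c hc using hU
  have key : ∀ i, (fun x : U ↦ (f (c x x.2)).1 ⟨x, hc x x.2⟩) ∘ Set.inclusion (hV i) =
      (f i).1 := by
    intro i
    funext x
    exact hf _ _ _ _ _
  refine ⟨⟨fun x ↦ (f (c x x.2)).1 ⟨x, hc x x.2⟩, 𝒪.mem_of_locally _ fun x ↦
    ⟨V (c x x.2), hV _, hc x x.2, ?_⟩⟩, fun i ↦ Subtype.ext (key i)⟩
  rw [key]
  exact (f _).2

/-- The presheaf of rings underlying a sheaf of functions. -/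
def presheaf : (Opens M)ᵒᵖ ⥤ RingCat.{u} where
  obj U := RingCat.of (𝒪.sec U.unop)
  map f := RingCat.ofHom (𝒪.res f.unop.le).toRingHom

lemma isSheaf_presheaf : Presheaf.IsSheaf (Opens.grothendieckTopology M) 𝒪.presheaf := by
  refine (TopCat.Presheaf.isSheaf_iff_isSheafUniqueGluing
    (X := TopCat.of M) (F := 𝒪.presheaf)).2 ?_
  intro ι V f hf
  obtain ⟨g, hg⟩ := 𝒪.exists_glue (U := iSup V) V (fun i ↦ le_iSup V i)
    (fun x hx ↦ by simpa using hx) f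
    (fun i j x hi hj ↦ congrFun (congrArg Subtype.val (hf i j)) ⟨x, hi, hj⟩)
  refine ⟨g, fun i ↦ hg i, fun g' hg' ↦ ?_⟩
  refine 𝒪.ext_locally fun x hx ↦ ?_
  obtain ⟨i, hi⟩ : ∃ i, x ∈ V i := by simpa using hx
  exact ⟨V i, le_iSup V i, hi, (hg' i).trans (hg i).symm⟩

/-- The sheaf of rings underlying a sheaf of functions. -/
def sheaf : Sheaf (Opens.grothendieckTopology M) RingCat.{u} :=
  ⟨𝒪.presheaf, 𝒪.isSheaf_presheaf⟩

end FunctionSheaf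

/-- The structure sheaf of a manifold of class `C^k` over `𝕜`: its sections are the `ℂ`-valued
functions of class `C^k`. For `𝕜 = ℝ` these are the complex-valued smooth (`k = ∞`) or real
analytic (`k = ω`) functions, for `𝕜 = ℂ` the holomorphic functions. -/
def structureSheaf (𝕜 : Type*) [RCLike 𝕜] [NormedAlgebra 𝕜 ℂ] (E : Type*) [NormedAddCommGroup E]
    [NormedSpace 𝕜 E] (k : WithTop ℕ∞) (M : Type u) [TopologicalSpace M] [ChartedSpace E M] :
    FunctionSheaf M where
  sec U :=
    { carrier := {f | ContMDiff 𝓘(𝕜, E) 𝓘(𝕜, ℂ) k f}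
      mul_mem' := fun {f g} hf hg ↦ by
        have h : ContDiff 𝕜 k (fun p : ℂ × ℂ ↦ p.1 * p.2) := contDiff_mul
        exact h.contMDiff.comp (hf.prodMk_space hg)
      add_mem' := fun {f g} hf hg ↦ by
        have h : ContDiff 𝕜 k (fun p : ℂ × ℂ ↦ p.1 + p.2) := contDiff_add
        exact h.contMDiff.comp (hf.prodMk_space hg)
      algebraMap_mem' := fun _ ↦ contMDiff_const }
  res_mem h f hf := hf.comp (contMDiff_inclusion h)
  mem_of_locally {U} f hf := by
    intro x
    obtain ⟨V, h, hx, hV⟩ := hf x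
    have key : ∀ (W : Opens M) (hW : W ≤ U) (y : W),
        ContMDiffAt 𝓘(𝕜, E) 𝓘(𝕜, ℂ) k (fun z : W ↦ f ⟨z, hW z.2⟩) y ↔
          ContMDiffAt 𝓘(𝕜, E) 𝓘(𝕜, ℂ) k (Function.extend Subtype.val f 0) (y : M) := by
      intro W hW y
      rw [← contMDiffAt_subtype_iff (U := W)]
      have e : (fun z : W ↦ Function.extend Subtype.val f 0 (z : M)) =
          fun z : W ↦ f ⟨z, hW z.2⟩ := by
        funext z
        exact Subtype.val_injective.extend_apply f 0 ⟨z, hW z.2⟩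
      rw [e]
    exact (key U le_rfl x).2 ((key V h ⟨x, hx⟩).1 (hV ⟨x, hx⟩))

/-- A vector field on `U` (a section of the complexified tangent sheaf): a `ℂ`-linear derivation
of the sheaf of functions on `U`. -/
@[ext]
structure VectorField {M : Type u} [TopologicalSpace M] (𝒪 : FunctionSheaf M) (U : Opens M) where
  /-- the action on functions defined on `V ⊆ U` -/
  der (V : Opens M) (h : V ≤ U) : Derivation ℂ (𝒪.sec V) (𝒪.sec V)
  res_der {V W : Opens M} (h : V ≤ U) (h' : W ≤ V) (f : 𝒪.sec V) :
    𝒪.res h' (der V h f) = der W (h'.trans h) (𝒪.res h' f)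

namespace VectorField

variable {M : Type u} [TopologicalSpace M] {𝒪 : FunctionSheaf M} {U V W : Opens M}

instance : Zero (VectorField 𝒪 U) := ⟨⟨fun _ _ ↦ 0, fun _ _ _ ↦ by simp⟩⟩
instance : Add (VectorField 𝒪 U) :=
  ⟨fun X Y ↦ ⟨fun V h ↦ X.der V h + Y.der V h, fun h h' f ↦ by simp [X.res_der, Y.res_der]⟩⟩
instance : Neg (VectorField 𝒪 U) :=
  ⟨fun X ↦ ⟨fun V h ↦ -X.der V h, fun h h' f ↦ by simp [X.res_der]⟩⟩
instance : SMul (𝒪.sec U) (VectorField 𝒪 U) :=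
  ⟨fun g X ↦ ⟨fun V h ↦ 𝒪.res h g • X.der V h, fun h h' f ↦ by simp [X.res_der]⟩⟩

@[simp] lemma zero_der (h : V ≤ U) : (0 : VectorField 𝒪 U).der V h = 0 := rfl
@[simp] lemma add_der (X Y : VectorField 𝒪 U) (h : V ≤ U) :
    (X + Y).der V h = X.der V h + Y.der V h := rfl
@[simp] lemma neg_der (X : VectorField 𝒪 U) (h : V ≤ U) : (-X).der V h = -X.der V h := rfl
@[simp] lemma smul_der (g : 𝒪.sec U) (X : VectorField 𝒪 U) (h : V ≤ U) :
    (g • X).der V h = 𝒪.res h g • X.der V h := rfl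

instance : AddCommGroup (VectorField 𝒪 U) where
  add_assoc X Y Z := by ext : 3; simp [add_assoc]
  zero_add X := by ext : 3; simp
  add_zero X := by ext : 3; simp
  add_comm X Y := by ext : 3; simp [add_comm]
  neg_add_cancel X := by ext V h : 3; exact neg_add_cancel (X.der V h)
  nsmul := nsmulRec
  zsmul := zsmulRec

instance : Module (𝒪.sec U) (VectorField 𝒪 U) where
  one_smul X := by ext : 3; simp
  mul_smul f g X := by ext : 3; simp [mul_smul]
  smul_zero f := by ext : 3; simp
  smul_add f X Y := by ext : 3; simp
  add_smul f g X := by ext : 3; simp [add_smul]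
  zero_smul X := by ext : 3; simp

/-- Restriction of vector fields. -/
def res (h : V ≤ U) (X : VectorField 𝒪 U) : VectorField 𝒪 V :=
  ⟨fun W h' ↦ X.der W (h'.trans h), fun _ h'' f ↦ X.res_der _ h'' f⟩

@[simp] lemma res_der' (h : V ≤ U) (h' : W ≤ V) (X : VectorField 𝒪 U) :
    (X.res h).der W h' = X.der W (h'.trans h) := rfl

lemma res_add (h : V ≤ U) (X Y : VectorField 𝒪 U) : (X + Y).res h = X.res h + Y.res h := rfl

lemma res_zero (h : V ≤ U) : (0 : VectorField 𝒪 U).res h = 0 := rfl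

/-- Gluing of vector fields. -/
lemma existsUnique_glue {ι : Type*} (V : ι → Opens M) (hV : ∀ i, V i ≤ U)
    (hU : ∀ x ∈ U, ∃ i, x ∈ V i) (X : ∀ i, VectorField 𝒪 (V i))
    (hX : ∀ i j, (X i).res (inf_le_left : V i ⊓ V j ≤ V i) = (X j).res inf_le_right) :
    ∃! Y : VectorField 𝒪 U, ∀ i, Y.res (hV i) = X i := by
  have hX' : ∀ (i j) (W : Opens M) (hi : W ≤ V i) (hj : W ≤ V j),
      (X i).der W hi = (X j).der W hj := fun i j W hi hj ↦
    congrArg (fun Z : VectorField 𝒪 (V i ⊓ V j) ↦ Z.der W (le_inf hi hj)) (hX i j)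
  have glue : ∀ (W : Opens M) (hW : W ≤ U) (f : 𝒪.sec W), ∃ g : 𝒪.sec W,
      ∀ i (W' : Opens M) (h : W' ≤ W) (h' : W' ≤ V i),
        𝒪.res h g = (X i).der W' h' (𝒪.res h f) := by
    intro W hW f
    obtain ⟨g, hg⟩ := 𝒪.exists_glue (U := W) (fun i ↦ W ⊓ V i) (fun i ↦ inf_le_left)
      (fun x hx ↦ (hU x (hW hx)).imp fun i hi ↦ ⟨hx, hi⟩)
      (fun i ↦ (X i).der (W ⊓ V i) inf_le_right (𝒪.res inf_le_left f)) (by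
        intro i j x hi hj
        have h1 := (X i).res_der (W := W ⊓ V i ⊓ (W ⊓ V j)) inf_le_right inf_le_left
          (𝒪.res (inf_le_left : W ⊓ V i ≤ W) f)
        have h2 := (X j).res_der (W := W ⊓ V i ⊓ (W ⊓ V j)) inf_le_right inf_le_right
          (𝒪.res (inf_le_left : W ⊓ V j ≤ W) f)
        rw [hX' i j _ _ (inf_le_right.trans inf_le_right)] at h1
        exact congrFun (congrArg Subtype.val (h1.trans h2.symm)) ⟨x, hi, hj⟩)
    refine ⟨g, fun i W' h h' ↦ ?_⟩
    have h1 := congrArg (𝒪.res (le_inf h h')) (hg i)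
    rw [(X i).res_der] at h1
    exact h1
  have uniq : ∀ (W : Opens M) (hW : W ≤ U) (g g' : 𝒪.sec W),
      (∀ i (W' : Opens M) (h : W' ≤ W) (_ : W' ≤ V i), 𝒪.res h g = 𝒪.res h g') → g = g' := by
    intro W hW g g' h
    refine 𝒪.ext_locally fun x hx ↦ ?_
    obtain ⟨i, hi⟩ := hU x (hW hx)
    exact ⟨W ⊓ V i, inf_le_left, ⟨hx, hi⟩, h i _ _ inf_le_right⟩
  choose D hD using glue
  let Y : VectorField 𝒪 U :=
    { der := fun W hW ↦ Derivation.mk'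
        { toFun := D W hW
          map_add' := fun f g ↦ uniq W hW _ _ fun i W' h h' ↦ by
            rw [map_add, hD _ _ _ i W' h h', hD _ _ _ i W' h h', hD _ _ _ i W' h h', map_add,
              map_add]
          map_smul' := fun c f ↦ uniq W hW _ _ fun i W' h h' ↦ by
            rw [RingHom.id_apply, map_smul, hD _ _ _ i W' h h', hD _ _ _ i W' h h', map_smul]
            exact ((X i).der W' h').map_smul c _ }
        (fun f g ↦ uniq W hW _ _ fun i W' h h' ↦ by
          have e : ∀ f, 𝒪.res h (D W hW f) = (X i).der W' h' (𝒪.res h f) :=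
            fun f ↦ hD W hW f i W' h h'
          change 𝒪.res h (D W hW (f * g)) = 𝒪.res h (f * D W hW g + g * D W hW f)
          rw [map_add, map_mul, map_mul, e, e, e, map_mul, Derivation.leibniz]
          rfl)
      res_der := fun {W W₁} h h₁ f ↦ uniq W₁ (h₁.trans h) _ _ fun i W' h' h'' ↦ by
        have e1 := hD W h f i W' (h'.trans h₁) h''
        have e2 := hD W₁ (h₁.trans h) (𝒪.res h₁ f) i W' h' h''
        exact e1.trans e2.symm }
  have hY : ∀ i, Y.res (hV i) = X i := by
    intro i
    ext W hW f : 4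
    exact hD W (hW.trans (hV i)) f i W le_rfl hW
  refine ⟨Y, hY, fun Z hZ ↦ ?_⟩
  ext W hW f : 4
  refine uniq W hW _ _ fun i W' h h' ↦ ?_
  rw [Z.res_der, Y.res_der]
  have := congrArg (fun T : VectorField 𝒪 (V i) ↦ T.der W' h' (𝒪.res h f))
    ((hZ i).trans (hY i).symm)
  exact this

end VectorField

/-! ### Manifolds with multiplication and invariant metric -/

/-- A multiplication on the tangent sheaf: an associative bilinear map of sheaves with a global
unit vector field (given through its restrictions). -/
structure TangentMultiplication {M : Type u} [TopologicalSpace M] (𝒪 : FunctionSheaf M) where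
  /-- the product of vector fields -/
  mul {U : Opens M} : VectorField 𝒪 U → VectorField 𝒪 U → VectorField 𝒪 U
  /-- the unit vector field -/
  unit (U : Opens M) : VectorField 𝒪 U
  mul_res {U V : Opens M} (h : V ≤ U) (X Y : VectorField 𝒪 U) :
    (mul X Y).res h = mul (X.res h) (Y.res h)
  unit_res {U V : Opens M} (h : V ≤ U) : (unit U).res h = unit V
  add_mul {U : Opens M} (X Y Z : VectorField 𝒪 U) : mul (X + Y) Z = mul X Z + mul Y Z
  mul_add {U : Opens M} (X Y Z : VectorField 𝒪 U) : mul X (Y + Z) = mul X Y + mul X Z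
  smul_mul {U : Opens M} (f : 𝒪.sec U) (X Y : VectorField 𝒪 U) : mul (f • X) Y = f • mul X Y
  mul_smul {U : Opens M} (f : 𝒪.sec U) (X Y : VectorField 𝒪 U) : mul X (f • Y) = f • mul X Y
  mul_assoc {U : Opens M} (X Y Z : VectorField 𝒪 U) : mul (mul X Y) Z = mul X (mul Y Z)
  unit_mul {U : Opens M} (X : VectorField 𝒪 U) : mul (unit U) X = X
  mul_unit {U : Opens M} (X : VectorField 𝒪 U) : mul X (unit U) = X

namespace TangentMultiplication

variable {M : Type u} [TopologicalSpace M] {𝒪 : FunctionSheaf M} (𝒯 : TangentMultiplication 𝒪)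

/-- Vector fields on `U`, regarded as a ring under the multiplication of the tangent sheaf. -/
def Sec (_ : TangentMultiplication 𝒪) (U : Opens M) : Type u := VectorField 𝒪 U

instance (U : Opens M) : Ring (𝒯.Sec U) where
  __ := (inferInstance : AddCommGroup (VectorField 𝒪 U))
  mul := 𝒯.mul
  one := 𝒯.unit U
  left_distrib := 𝒯.mul_add
  right_distrib := 𝒯.add_mul
  zero_mul X := by
    have h := 𝒯.add_mul 0 0 X
    rw [add_zero] at h
    exact (add_eq_left (a := 𝒯.mul 0 X)).1 h.symm
  mul_zero X := by
    have h := 𝒯.mul_add X 0 0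
    rw [add_zero] at h
    exact (add_eq_left (a := 𝒯.mul X 0)).1 h.symm
  mul_assoc := 𝒯.mul_assoc
  one_mul := 𝒯.unit_mul
  mul_one := 𝒯.mul_unit

instance (U : Opens M) : Module (𝒪.sec U) (𝒯.Sec U) :=
  inferInstanceAs (Module (𝒪.sec U) (VectorField 𝒪 U))

/-- Restriction, as a ring homomorphism. -/
def res {U V : Opens M} (h : V ≤ U) : 𝒯.Sec U →+* 𝒯.Sec V where
  toFun X := VectorField.res h X
  map_zero' := rfl
  map_one' := 𝒯.unit_res h
  map_add' _ _ := rfl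
  map_mul' := 𝒯.mul_res h

/-- The tangent sheaf as a presheaf of rings. -/
def presheaf : (Opens M)ᵒᵖ ⥤ RingCat.{u} where
  obj U := RingCat.of (𝒯.Sec U.unop)
  map f := RingCat.ofHom (𝒯.res f.unop.le)

lemma isSheaf_presheaf : Presheaf.IsSheaf (Opens.grothendieckTopology M) 𝒯.presheaf := by
  refine (TopCat.Presheaf.isSheaf_iff_isSheafUniqueGluing
    (X := TopCat.of M) (F := 𝒯.presheaf)).2 ?_
  intro ι V X hX
  exact VectorField.existsUnique_glue (U := iSup V) V (fun i ↦ le_iSup V i)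
    (fun x hx ↦ by simpa using hx) X hX

/-- The tangent sheaf as a sheaf of rings. -/
def sheaf : Sheaf (Opens.grothendieckTopology M) RingCat.{u} :=
  ⟨𝒯.presheaf, 𝒯.isSheaf_presheaf⟩

/-- A frame `e₁, …, eₙ` of orthogonal idempotent vector fields over `U`; equivalently, an
isomorphism of sheaves of algebras between the tangent sheaf of `U` and `𝒪_U ^ n`. -/
structure IsIdempotentFrame {n : ℕ} {U : Opens M} (e : Fin n → 𝒯.Sec U) : Prop where
  mul_eq (i j : Fin n) : e i * e j = if i = j then e i else 0
  existsUnique_coeff {V : Opens M} (h : V ≤ U) (X : 𝒯.Sec V) :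
    ∃! f : Fin n → 𝒪.sec V, X = ∑ i, f i • 𝒯.res h (e i)

/-- The open set `U` is semisimple, with `n` simple idempotents. -/
def IsSemisimple (n : ℕ) (U : Opens M) : Prop :=
  ∃ e : Fin n → 𝒯.Sec U, 𝒯.IsIdempotentFrame e

end TangentMultiplication

/-- An invariant (nondegenerate symmetric bilinear) metric on a manifold with multiplication on
the tangent sheaf. -/
structure InvariantMetric {M : Type u} [TopologicalSpace M] {𝒪 : FunctionSheaf M}
    (𝒯 : TangentMultiplication 𝒪) where
  /-- the metric -/
  g {U : Opens M} : 𝒯.Sec U → 𝒯.Sec U → 𝒪.sec U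
  g_res {U V : Opens M} (h : V ≤ U) (X Y : 𝒯.Sec U) :
    𝒪.res h (g X Y) = g (𝒯.res h X) (𝒯.res h Y)
  g_add {U : Opens M} (X Y Z : 𝒯.Sec U) : g (X + Y) Z = g X Z + g Y Z
  g_smul {U : Opens M} (f : 𝒪.sec U) (X Y : 𝒯.Sec U) : g (f • X) Y = f * g X Y
  g_symm {U : Opens M} (X Y : 𝒯.Sec U) : g X Y = g Y X
  g_mul {U : Opens M} (X Y Z : 𝒯.Sec U) : g (X * Y) Z = g X (Y * Z)
  nondegenerate (x : M) : ∃ U : Opens M, x ∈ U ∧ ∀ V ≤ U, ∀ ℓ : 𝒯.Sec V →ₗ[𝒪.sec V] 𝒪.sec V,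
    ∃! X : 𝒯.Sec V, ∀ Y, g X Y = ℓ Y

/-- The trace `θ(X) = g(e, X)` of the tangent sheaf, `e` being the unit vector field. -/
def InvariantMetric.trace {M : Type u} [TopologicalSpace M] {𝒪 : FunctionSheaf M}
    {𝒯 : TangentMultiplication 𝒪} (η : InvariantMetric 𝒯) {U : Opens M} (X : 𝒯.Sec U) : 𝒪.sec U :=
  η.g 1 X

/-! ### Sheaves of modules over an open set -/

section Modules

variable {M : Type u} [TopologicalSpace M] {𝒪 : FunctionSheaf M} {U : Opens M}

/-- Sections of a sheaf of `𝒪_U`-modules over an open subset of `U`. -/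
def Sec (N : SheafOfModules.{u} (𝒪.sheaf.over U)) (T : Over U) : Type u := N.val.obj (op T)

instance (N : SheafOfModules.{u} (𝒪.sheaf.over U)) (T : Over U) : AddCommGroup (Sec N T) :=
  inferInstanceAs (AddCommGroup (N.val.obj (op T)))

instance (N : SheafOfModules.{u} (𝒪.sheaf.over U)) (T : Over U) :
    Module (𝒪.sec T.left) (Sec N T) :=
  inferInstanceAs (Module ((𝒪.sheaf.over U).obj.obj (op T)) (N.val.obj (op T)))

/-- Restriction of sections. -/
def Sec.res {N : SheafOfModules.{u} (𝒪.sheaf.over U)} {T T' : Over U} (f : T' ⟶ T)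
    (s : Sec N T) : Sec N T' :=
  N.val.map f.op s

/-- The map on sections induced by a morphism of sheaves of modules. -/
def Sec.map {N N' : SheafOfModules.{u} (𝒪.sheaf.over U)} (φ : N ⟶ N') {T : Over U}
    (s : Sec N T) : Sec N' T :=
  φ.val.app (op T) s

/-- A basis of `N` over `T ⊆ U`: a family of sections of `N` over `T` whose restriction to each
open subset `T'` of `T` is a basis of the `𝒪(T')`-module `N(T')`. -/
def IsBasis {N : SheafOfModules.{u} (𝒪.sheaf.over U)} {T : Over U} {r : ℕ}
    (s : Fin r → Sec N T) : Prop :=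
  ∀ (T' : Over U) (f : T' ⟶ T) (m : Sec N T'),
    ∃! c : Fin r → 𝒪.sec T'.left, m = ∑ j, c j • (s j).res f

/-- A sheaf of `𝒪_U`-modules is locally free, locally of finite rank. -/
def IsLocallyFree (N : SheafOfModules.{u} (𝒪.sheaf.over U)) : Prop :=
  ∀ x ∈ U, ∃ T : Over U, x ∈ T.left ∧ ∃ (r : ℕ) (s : Fin r → Sec N T), IsBasis s

variable (𝒪 U) in
/-- The category of locally free `𝒪_U`-modules (locally of finite rank). -/
abbrev LF : Type (u + 1) :=
  ObjectProperty.FullSubcategory (C := SheafOfModules.{u} (𝒪.sheaf.over U)) IsLocallyFree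

/-- Sections of a sheaf of `𝒯_U`-modules over an open subset of `U`. -/
def TSec {𝒯 : TangentMultiplication 𝒪} (N : SheafOfModules.{u} (𝒯.sheaf.over U))
    (T : Over U) : Type u := N.val.obj (op T)

instance {𝒯 : TangentMultiplication 𝒪} (N : SheafOfModules.{u} (𝒯.sheaf.over U)) (T : Over U) :
    AddCommGroup (TSec N T) :=
  inferInstanceAs (AddCommGroup (N.val.obj (op T)))

instance {𝒯 : TangentMultiplication 𝒪} (N : SheafOfModules.{u} (𝒯.sheaf.over U)) (T : Over U) :
    Module (𝒯.Sec T.left) (TSec N T) :=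
  inferInstanceAs (Module ((𝒯.sheaf.over U).obj.obj (op T)) (N.val.obj (op T)))

/-- Restriction of sections. -/
def TSec.res {𝒯 : TangentMultiplication 𝒪} {N : SheafOfModules.{u} (𝒯.sheaf.over U)}
    {T T' : Over U} (f : T' ⟶ T) (s : TSec N T) : TSec N T' :=
  N.val.map f.op s

/-- Let `π : S → M` be the spectral cover, so that `π_* 𝒪_S` is the tangent sheaf `𝒯`. If
`e₁, …, eₙ` is a frame of idempotents over `V`, then `π⁻¹(V)` is the disjoint union of `n` copies
of `V`, the functions on the `i`-th copy being `eᵢ 𝒯`. A sheaf of `𝒯_U`-modules is the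
direct image of a locally free `𝒪_S`-module (locally of finite rank) iff it is
locally isomorphic to `⨁ᵢ (eᵢ 𝒯) ^ dᵢ`: locally there are sections `sᵢⱼ` (`j = 1, …, dᵢ`) of `eᵢ N`
such that each section of `N` is uniquely a combination of the `sᵢⱼ` with coefficients in
`eᵢ 𝒯 = 𝒪 eᵢ`. -/
def IsLocallyFreeOverSpectralCover (𝒯 : TangentMultiplication 𝒪) (n : ℕ)
    (N : SheafOfModules.{u} (𝒯.sheaf.over U)) : Prop :=
  ∀ x ∈ U, ∃ T : Over U, x ∈ T.left ∧
    ∃ e : Fin n → 𝒯.Sec T.left, 𝒯.IsIdempotentFrame e ∧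
    ∃ (d : Fin n → ℕ) (s : ∀ i, Fin (d i) → TSec N T), (∀ i j, e i • s i j = s i j) ∧
      ∀ (T' : Over U) (f : T' ⟶ T) (m : TSec N T'), ∃! c : ∀ i, Fin (d i) → 𝒪.sec T'.left,
        m = ∑ i, ∑ j, (c i j • 𝒯.res f.left.le (e i)) • (s i j).res f

variable (U) in
/-- The category of `𝒯_U`-modules that are locally free over the spectral cover. -/
abbrev TangentLF (𝒯 : TangentMultiplication 𝒪) (n : ℕ) : Type (u + 1) :=
  ObjectProperty.FullSubcategory (C := SheafOfModules.{u} (𝒯.sheaf.over U))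
    (IsLocallyFreeOverSpectralCover 𝒯 n)

end Modules

/-! ### Cardy categories over an open set -/

section Cardy

variable {M : Type u} [TopologicalSpace M] {𝒪 : FunctionSheaf M}

/-- An `𝒪_U`-linear category of labels over an open set `U`: a category enriched in sheaves of
`𝒪_U`-modules. -/
structure SheafCategory (𝒪 : FunctionSheaf M) (U : Opens M) where
  /-- the labels -/
  Obj : Type (u + 1)
  /-- the sheaf `Γ_ab` -/
  Hom : Obj → Obj → SheafOfModules.{u} (𝒪.sheaf.over U)
  /-- the identity of a label, over `T ⊆ U` -/
  id (a : Obj) (T : Over U) : Sec (Hom a a) T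
  /-- composition (in diagrammatic order) over `T ⊆ U` -/
  comp {a b c : Obj} {T : Over U} : Sec (Hom a b) T → Sec (Hom b c) T → Sec (Hom a c) T
  id_res (a : Obj) {T T' : Over U} (f : T' ⟶ T) : (id a T).res f = id a T'
  comp_res {a b c : Obj} {T T' : Over U} (f : T' ⟶ T) (σ : Sec (Hom a b) T)
    (τ : Sec (Hom b c) T) : (comp σ τ).res f = comp (σ.res f) (τ.res f)
  add_comp {a b c : Obj} {T : Over U} (σ σ' : Sec (Hom a b) T) (τ : Sec (Hom b c) T) :
    comp (σ + σ') τ = comp σ τ + comp σ' τ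
  comp_add {a b c : Obj} {T : Over U} (σ : Sec (Hom a b) T) (τ τ' : Sec (Hom b c) T) :
    comp σ (τ + τ') = comp σ τ + comp σ τ'
  smul_comp {a b c : Obj} {T : Over U} (f : 𝒪.sec T.left) (σ : Sec (Hom a b) T)
    (τ : Sec (Hom b c) T) : comp (f • σ) τ = f • comp σ τ
  comp_smul {a b c : Obj} {T : Over U} (f : 𝒪.sec T.left) (σ : Sec (Hom a b) T)
    (τ : Sec (Hom b c) T) : comp σ (f • τ) = f • comp σ τ
  id_comp {a b : Obj} {T : Over U} (σ : Sec (Hom a b) T) : comp (id a T) σ = σ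
  comp_id {a b : Obj} {T : Over U} (σ : Sec (Hom a b) T) : comp σ (id b T) = σ
  assoc {a b c d : Obj} {T : Over U} (σ : Sec (Hom a b) T) (τ : Sec (Hom b c) T)
    (ρ : Sec (Hom c d) T) : comp (comp σ τ) ρ = comp σ (comp τ ρ)

/-- Two labels over `U` are isomorphic. -/
def SheafCategory.Isomorphic {U : Opens M} (𝒞 : SheafCategory 𝒪 U) (a b : 𝒞.Obj) : Prop :=
  ∃ (σ : Sec (𝒞.Hom a b) (Over.mk (𝟙 U))) (τ : Sec (𝒞.Hom b a) (Over.mk (𝟙 U))),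
    𝒞.comp σ τ = 𝒞.id a _ ∧ 𝒞.comp τ σ = 𝒞.id b _

/-- A Calabi-Yau category of labels over an open set `U`: the sheaves `Γ_ab` are locally free of
finite rank, there are symmetric traces `θ_a : Γ_aa → 𝒪_U`, and the pairings
`Γ_ab ⊗ Γ_ba → Γ_aa → 𝒪_U` are (locally) perfect. -/
structure CYCategory (𝒪 : FunctionSheaf M) (U : Opens M) extends SheafCategory 𝒪 U where
  /-- the trace `θ_a` -/
  trace {a : Obj} {T : Over U} : Sec (Hom a a) T → 𝒪.sec T.left
  trace_res {a : Obj} {T T' : Over U} (f : T' ⟶ T) (σ : Sec (Hom a a) T) :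
    𝒪.res f.left.le (trace σ) = trace (σ.res f)
  trace_add {a : Obj} {T : Over U} (σ τ : Sec (Hom a a) T) : trace (σ + τ) = trace σ + trace τ
  trace_smul {a : Obj} {T : Over U} (f : 𝒪.sec T.left) (σ : Sec (Hom a a) T) :
    trace (f • σ) = f * trace σ
  trace_comm {a b : Obj} {T : Over U} (σ : Sec (Hom a b) T) (τ : Sec (Hom b a) T) :
    trace (comp σ τ) = trace (comp τ σ)
  locallyFree (a b : Obj) : IsLocallyFree (Hom a b)
  perfect (a b : Obj) : ∀ x ∈ U, ∃ T : Over U, x ∈ T.left ∧ ∀ (T' : Over U) (_ : T' ⟶ T)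
    (ℓ : Sec (Hom b a) T' →ₗ[𝒪.sec T'.left] 𝒪.sec T'.left),
    ∃! σ : Sec (Hom a b) T', ∀ τ, trace (comp σ τ) = ℓ τ

variable {𝒯 : TangentMultiplication 𝒪} {U : Opens M}

/-- The structure of a Cardy category on a Calabi-Yau category of labels over `U`: transition
homomorphisms `ι_a : 𝒯_U → Γ_aa` and `ι^a : Γ_aa → 𝒯_U` which satisfy the centrality,
adjunction and Cardy conditions. -/
structure CardyStructure (η : InvariantMetric 𝒯) (𝒞 : CYCategory 𝒪 U) where
  /-- the homomorphism `ι_a` -/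
  ι (a : 𝒞.Obj) {T : Over U} : 𝒯.Sec T.left → Sec (𝒞.Hom a a) T
  /-- the homomorphism `ι^a` -/
  ι' (a : 𝒞.Obj) {T : Over U} : Sec (𝒞.Hom a a) T → 𝒯.Sec T.left
  ι_res (a : 𝒞.Obj) {T T' : Over U} (f : T' ⟶ T) (X : 𝒯.Sec T.left) :
    (ι a X).res f = ι a (𝒯.res f.left.le X)
  ι'_res (a : 𝒞.Obj) {T T' : Over U} (f : T' ⟶ T) (σ : Sec (𝒞.Hom a a) T) :
    𝒯.res f.left.le (ι' a σ) = ι' a (σ.res f)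
  ι_add (a : 𝒞.Obj) {T : Over U} (X Y : 𝒯.Sec T.left) : ι a (T := T) (X + Y) = ι a X + ι a Y
  ι_smul (a : 𝒞.Obj) {T : Over U} (f : 𝒪.sec T.left) (X : 𝒯.Sec T.left) :
    ι a (T := T) (f • X) = f • ι a X
  ι_one (a : 𝒞.Obj) {T : Over U} : ι a (T := T) 1 = 𝒞.id a T
  ι_mul (a : 𝒞.Obj) {T : Over U} (X Y : 𝒯.Sec T.left) :
    ι a (T := T) (X * Y) = 𝒞.comp (ι a Y) (ι a X)
  ι'_add (a : 𝒞.Obj) {T : Over U} (σ τ : Sec (𝒞.Hom a a) T) : ι' a (σ + τ) = ι' a σ + ι' a τ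
  ι'_smul (a : 𝒞.Obj) {T : Over U} (f : 𝒪.sec T.left) (σ : Sec (𝒞.Hom a a) T) :
    ι' a (f • σ) = f • ι' a σ
  central {a b : 𝒞.Obj} {T : Over U} (X : 𝒯.Sec T.left) (σ : Sec (𝒞.Hom a b) T) :
    𝒞.comp (ι a X) σ = 𝒞.comp σ (ι b X)
  adjoint (a : 𝒞.Obj) {T : Over U} (σ : Sec (𝒞.Hom a a) T) (X : 𝒯.Sec T.left) :
    η.trace (ι' a σ * X) = 𝒞.trace (𝒞.comp (ι a X) σ)
  /-- The Cardy condition `π_b^a = ι_b ∘ ι^a`, where locally `π_b^a(σ) = ∑ᵢ σᵢ σ σⁱ` for a basis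
  `σᵢ` of `Γ_ab` and the dual basis `σⁱ` of `Γ_ba`. -/
  cardy {a b : 𝒞.Obj} {T : Over U} {r : ℕ} (s : Fin r → Sec (𝒞.Hom a b) T)
    (t : Fin r → Sec (𝒞.Hom b a) T) (hs : IsBasis s)
    (hst : ∀ i j, 𝒞.trace (𝒞.comp (t j) (s i)) = if i = j then 1 else 0)
    (σ : Sec (𝒞.Hom a a) T) :
    ∑ i, 𝒞.comp (𝒞.comp (t i) σ) (s i) = ι b (ι' a σ)

/-- An embedding of Cardy categories of labels over `U`: it is fully faithful (an isomorphism on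
the sheaves of morphisms) and preserves all structure. -/
structure CardyEmbedding {η : InvariantMetric 𝒯} {𝒞 𝒟 : CYCategory 𝒪 U}
    (h : CardyStructure η 𝒞) (k : CardyStructure η 𝒟) where
  /-- the map on labels -/
  obj : 𝒞.Obj → 𝒟.Obj
  /-- the isomorphism on sheaves of morphisms -/
  hom (a b : 𝒞.Obj) : 𝒞.Hom a b ≅ 𝒟.Hom (obj a) (obj b)
  hom_id (a : 𝒞.Obj) (T : Over U) : (𝒞.id a T).map (hom a a).hom = 𝒟.id (obj a) T
  hom_comp {a b c : 𝒞.Obj} {T : Over U} (σ : Sec (𝒞.Hom a b) T) (τ : Sec (𝒞.Hom b c) T) :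
    (𝒞.comp σ τ).map (hom a c).hom = 𝒟.comp (σ.map (hom a b).hom) (τ.map (hom b c).hom)
  hom_trace {a : 𝒞.Obj} {T : Over U} (σ : Sec (𝒞.Hom a a) T) :
    𝒟.trace (σ.map (hom a a).hom) = 𝒞.trace σ
  hom_ι (a : 𝒞.Obj) {T : Over U} (X : 𝒯.Sec T.left) :
    (h.ι a (T := T) X).map (hom a a).hom = k.ι (obj a) X
  hom_ι' (a : 𝒞.Obj) {T : Over U} (σ : Sec (𝒞.Hom a a) T) :
    k.ι' (obj a) (σ.map (hom a a).hom) = h.ι' a σ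

/-- A Cardy category of labels over `U` is maximal if it cannot be enlarged: whenever it is
embedded in a Cardy category of labels over `U`, each label of the latter is isomorphic to a label
of the former. -/
def CardyStructure.IsMaximal {η : InvariantMetric 𝒯} {𝒞 : CYCategory 𝒪 U}
    (h : CardyStructure η 𝒞) : Prop :=
  ∀ (𝒟 : CYCategory 𝒪 U) (k : CardyStructure η 𝒟) (F : CardyEmbedding h k) (d : 𝒟.Obj),
    ∃ a : 𝒞.Obj, 𝒟.Isomorphic (F.obj a) d

end Cardy

/-! ### Cardy fibrations -/

open Pseudofunctor.LocallyDiscreteOpToCat Bicategory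

section Fibrations

variable {M : Type u} [TopologicalSpace M] {𝒪 : FunctionSheaf M}

/-- A stack of `𝒪`-linear categories on a space with a sheaf of functions. -/
structure LinearStack (𝒪 : FunctionSheaf M) where
  /-- the categories `B(U)` and their restriction functors -/
  fib : LocallyDiscrete (Opens M)ᵒᵖ ⥤ᵖ Cat.{u, u + 1}
  isStack : fib.IsStack (Opens.grothendieckTopology M)
  /-- the additive structure on morphisms -/
  preadditive (U : Opens M) : Preadditive (fib.obj (.mk (op U)))
  /-- the linear structure on morphisms -/
  linear (U : Opens M) : Linear (𝒪.sec U) (fib.obj (.mk (op U)))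
  map_add {U V : Opens M} (h : V ⟶ U) {a b : fib.obj (.mk (op U))} (σ τ : a ⟶ b) :
    (fib.map h.op.toLoc).toFunctor.map (σ + τ) =
      (fib.map h.op.toLoc).toFunctor.map σ + (fib.map h.op.toLoc).toFunctor.map τ
  map_smul {U V : Opens M} (h : V ⟶ U) {a b : fib.obj (.mk (op U))} (f : 𝒪.sec U) (σ : a ⟶ b) :
    (fib.map h.op.toLoc).toFunctor.map (f • σ) =
      𝒪.res h.le f • (fib.map h.op.toLoc).toFunctor.map σ

namespace LinearStack

variable (B : LinearStack 𝒪)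

/-- The category `B(U)`. -/
abbrev Label (U : Opens M) : Type (u + 1) := B.fib.obj (.mk (op U))

instance (U : Opens M) : Preadditive (B.Label U) := B.preadditive U
instance (U : Opens M) : Linear (𝒪.sec U) (B.Label U) := B.linear U

/-- The restriction functor `B(U) → B(V)`. -/
abbrev restr {U V : Opens M} (h : V ⟶ U) : B.Label U ⥤ B.Label V := (B.fib.map h.op.toLoc).toFunctor

variable {B} {U : Opens M}

/-- Sections of `Γ_ab` over `T ⊆ U`: the morphisms `a|_T → b|_T`. -/
abbrev HomOver (a b : B.Label U) (T : Over U) : Type u :=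
  (B.restr T.hom).obj a ⟶ (B.restr T.hom).obj b

/-- Restriction of sections of `Γ_ab`. -/
abbrev HomOver.res {a b : B.Label U} {T T' : Over U} (f : T' ⟶ T) (σ : HomOver a b T) :
    HomOver a b T' :=
  pullHom (F := B.fib) σ f.left T'.hom T'.hom (Over.w f) (Over.w f)

lemma HomOver.res_add {a b : B.Label U} {T T' : Over U} (f : T' ⟶ T) (σ τ : HomOver a b T) :
    (σ + τ).res f = σ.res f + τ.res f := by
  simp only [HomOver.res, pullHom, B.map_add, Preadditive.add_comp, Preadditive.comp_add]

lemma HomOver.res_smul {a b : B.Label U} {T T' : Over U} (f : T' ⟶ T) (g : 𝒪.sec T.left)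
    (σ : HomOver a b T) : HomOver.res f (g • σ) = 𝒪.res f.left.le g • σ.res f := by
  simp only [HomOver.res, pullHom, B.map_smul, Linear.smul_comp, Linear.comp_smul]

lemma HomOver.res_id (a : B.Label U) {T T' : Over U} (f : T' ⟶ T) :
    HomOver.res (a := a) (b := a) f (𝟙 _) = 𝟙 _ := by
  dsimp only [HomOver.res, pullHom]
  rw [CategoryTheory.Functor.map_id]
  erw [Category.id_comp]
  exact Cat.Hom.hom_inv_id_toNatTrans_app _ a

lemma HomOver.res_comp {a b c : B.Label U} {T T' : Over U} (f : T' ⟶ T) (σ : HomOver a b T)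
    (τ : HomOver b c T) :
    HomOver.res (a := a) (b := c) f (σ ≫ τ) = HomOver.res f σ ≫ HomOver.res f τ := by
  dsimp only [HomOver.res, pullHom]
  rw [CategoryTheory.Functor.map_comp]
  simp only [Category.assoc]
  congr 2
  erw [Cat.Hom.inv_hom_id_toNatTrans_app_assoc]

/-- The presheaf of abelian groups `Γ_ab`. -/
def homPresheaf (a b : B.Label U) : (Over U)ᵒᵖ ⥤ AddCommGrpCat.{u} where
  obj T := AddCommGrpCat.of (HomOver a b T.unop)
  map f := AddCommGrpCat.ofHom
    { toFun := HomOver.res f.unop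
      map_zero' := by simpa using HomOver.res_smul f.unop 0 (0 : HomOver a b _)
      map_add' := HomOver.res_add f.unop }
  map_id T := by
    ext σ
    exact pullHom_id (F := B.fib) σ
  map_comp f g := by
    ext σ
    exact (pullHom_pullHom (F := B.fib) σ f.unop.left _ _ g.unop.left _ _).symm

instance (a b : B.Label U) (T : (Over U)ᵒᵖ) :
    Module ((𝒪.sheaf.over U).obj.obj T) ((homPresheaf a b).obj T) :=
  inferInstanceAs (Module (𝒪.sec T.unop.left) (HomOver a b T.unop))

/-- The sheaf of `𝒪_U`-modules `Γ_ab` of morphisms between two labels over `U`. -/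
def homSheaf (a b : B.Label U) : SheafOfModules.{u} (𝒪.sheaf.over U) where
  val := PresheafOfModules.ofPresheaf (homPresheaf a b) fun _ _ f r m ↦
    HomOver.res_smul f.unop r m
  isSheaf := by
    refine (Presheaf.isSheaf_iff_isSheaf_forget _ _ (forget AddCommGrpCat.{u})).2 ?_
    have := B.isStack
    exact Pseudofunctor.IsPrestack.isSheaf (F := B.fib) (Opens.grothendieckTopology M) a b

lemma HomOver.res_map {a b : B.Label U} {T T' : Over U} (f : T' ⟶ T) (σ : a ⟶ b) :
    HomOver.res (a := a) (b := b) f ((B.restr T.hom).map σ) = (B.restr T'.hom).map σ := by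
  exact NatIso.naturality_2 (Cat.Hom.toNatIso (B.fib.mapComp' T.hom.op.toLoc f.left.op.toLoc
    T'.hom.op.toLoc (by rw [← Over.w f]; rfl))) σ

/-- The morphism `Γ_ab → Γ_ac` given by composition with a morphism `b → c` over `U`. -/
def homSheafMap (a : B.Label U) {b c : B.Label U} (σ : b ⟶ c) : homSheaf a b ⟶ homSheaf a c where
  val := PresheafOfModules.homMk
    { app := fun T ↦ AddCommGrpCat.ofHom
        { toFun := fun τ : HomOver a b T.unop ↦ (τ ≫ (B.restr T.unop.hom).map σ : HomOver a c T.unop)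
          map_zero' := Limits.zero_comp
          map_add' := fun _ _ ↦ Preadditive.add_comp _ _ _ _ _ _ }
      naturality := fun T T' f ↦ by
        ext τ
        exact (congrArg (fun x ↦ HomOver.res f.unop τ ≫ x) (HomOver.res_map f.unop σ).symm).trans
          (HomOver.res_comp f.unop τ ((B.restr T.unop.hom).map σ)).symm }
    fun T r τ ↦ Linear.smul_comp (R := 𝒪.sec T.unop.left) _ _ _ r τ ((B.restr T.unop.hom).map σ)

lemma map_homSheafMap (a : B.Label U) {b c : B.Label U} (σ : b ⟶ c) {T : Over U}
    (τ : HomOver a b T) :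
    Sec.map (N := homSheaf a b) (homSheafMap a σ) τ = τ ≫ (B.restr T.hom).map σ := rfl

end LinearStack

/-- A Calabi-Yau fibration: a stack of `𝒪`-linear categories whose sheaves of morphisms `Γ_ab` are
locally free of finite rank, with symmetric traces `θ_a : Γ_aa → 𝒪_U` such that the pairings
`Γ_ab ⊗ Γ_ba → Γ_aa → 𝒪_U` are (locally) perfect. -/
structure CYFibration (𝒪 : FunctionSheaf M) extends LinearStack 𝒪 where
  /-- the trace `θ_a` on global sections of `Γ_aa` -/
  trace {U : Opens M} {a : toLinearStack.Label U} : (a ⟶ a) → 𝒪.sec U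
  trace_restr {U V : Opens M} (h : V ⟶ U) {a : toLinearStack.Label U} (σ : a ⟶ a) :
    trace ((toLinearStack.restr h).map σ) = 𝒪.res h.le (trace σ)
  trace_add {U : Opens M} {a : toLinearStack.Label U} (σ τ : a ⟶ a) :
    trace (σ + τ) = trace σ + trace τ
  trace_smul {U : Opens M} {a : toLinearStack.Label U} (f : 𝒪.sec U) (σ : a ⟶ a) :
    trace (f • σ) = f * trace σ
  trace_comm {U : Opens M} {a b : toLinearStack.Label U} (σ : a ⟶ b) (τ : b ⟶ a) :
    trace (σ ≫ τ) = trace (τ ≫ σ)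
  locallyFree {U : Opens M} (a b : toLinearStack.Label U) :
    IsLocallyFree (LinearStack.homSheaf a b)
  perfect {U : Opens M} (a b : toLinearStack.Label U) : ∀ x ∈ U, ∃ T : Over U, x ∈ T.left ∧
    ∀ (T' : Over U) (_ : T' ⟶ T)
      (ℓ : LinearStack.HomOver b a T' →ₗ[𝒪.sec T'.left] 𝒪.sec T'.left),
      ∃! σ : LinearStack.HomOver a b T', ∀ τ : LinearStack.HomOver b a T', trace (σ ≫ τ) = ℓ τ

namespace CYFibration

variable (B : CYFibration 𝒪)

lemma trace_res {U : Opens M} {a : B.Label U} {T T' : Over U} (f : T' ⟶ T)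
    (σ : LinearStack.HomOver a a T) :
    B.trace (a := (B.restr T'.hom).obj a) (LinearStack.HomOver.res f σ) =
      𝒪.res f.left.le (B.trace σ) := by
  rw [← B.trace_restr]
  dsimp only [LinearStack.HomOver.res, pullHom]
  refine (B.trace_comm _ _).trans (congrArg B.trace ?_)
  refine (Category.assoc _ _ _).trans ?_
  refine (congrArg (fun x ↦ (B.restr f.left).map σ ≫ x)
    (Cat.Hom.inv_hom_id_toNatTrans_app _ a)).trans ?_
  exact Category.comp_id _

/-- The Calabi-Yau category of labels over `U` of a Calabi-Yau fibration, with the sheaves `Γ_ab`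
as morphisms. -/
def cyCategory (U : Opens M) : CYCategory 𝒪 U where
  Obj := B.Label U
  Hom a b := LinearStack.homSheaf a b
  id a T := 𝟙 ((B.restr T.hom).obj a)
  comp {a b c T} (σ : LinearStack.HomOver a b T) (τ : LinearStack.HomOver b c T) := σ ≫ τ
  id_res a _ _ f := LinearStack.HomOver.res_id a f
  comp_res f σ τ := LinearStack.HomOver.res_comp f σ τ
  add_comp _ _ _ := Preadditive.add_comp _ _ _ _ _ _
  comp_add _ _ _ := Preadditive.comp_add _ _ _ _ _ _
  smul_comp {_ _ _ T} f σ τ := Linear.smul_comp (R := 𝒪.sec T.left) _ _ _ f σ τ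
  comp_smul {_ _ _ T} f σ τ := Linear.comp_smul (R := 𝒪.sec T.left) _ _ _ σ f τ
  id_comp _ := Category.id_comp _
  comp_id _ := Category.comp_id _
  assoc _ _ _ := Category.assoc _ _ _
  trace {a T} (σ : LinearStack.HomOver a a T) := B.trace σ
  trace_res f σ := (B.trace_res f σ).symm
  trace_add _ _ := B.trace_add _ _
  trace_smul _ _ := B.trace_smul _ _
  trace_comm _ _ := B.trace_comm _ _
  locallyFree := B.locallyFree
  perfect := B.perfect

variable {B} {U : Opens M}

/-- The functor `B(U) → LF_{𝒪_U}`, `a ↦ Γ_{ξa}`. -/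
def homFunctor (ξ : B.Label U) : B.Label U ⥤ LF 𝒪 U where
  obj a := ⟨LinearStack.homSheaf ξ a, B.locallyFree ξ a⟩
  map σ := ObjectProperty.homMk (LinearStack.homSheafMap ξ σ)
  map_id a := by
    ext T τ
    exact (congrArg (fun x ↦ τ ≫ x) ((B.restr T.unop.hom).map_id a)).trans (Category.comp_id _)
  map_comp σ σ' := by
    ext T τ
    exact (congrArg (fun x ↦ τ ≫ x) ((B.restr T.unop.hom).map_comp σ σ')).trans
      (Category.assoc _ _ _).symm

/-- A morphism `η : N → Γ_{at}` exhibits the label `t` as the product `N ⊗ a` if it induces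
isomorphisms of sheaves `Γ_{tb} ≅ Hom(N, Γ_{ab})` (`≅ N^* ⊗ Γ_{ab}`) for all labels `b`: for each
`T ⊆ U`, every morphism of sheaves `N|_T → Γ_{ab}|_T` is of the form `m ↦ τ ∘ η(m)` for a unique
section `τ` of `Γ_{tb}` over `T`. -/
def IsTensor (N : SheafOfModules.{u} (𝒪.sheaf.over U)) (a t : B.Label U)
    (η : N ⟶ LinearStack.homSheaf a t) : Prop :=
  ∀ (b : B.Label U) (T : Over U)
    (φ : ∀ T' : Over U, (T' ⟶ T) → Sec N T' →ₗ[𝒪.sec T'.left] LinearStack.HomOver a b T'),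
    (∀ (T' T'' : Over U) (f : T' ⟶ T) (g : T'' ⟶ T') (m : Sec N T'),
      φ T'' (g ≫ f) (m.res g) = LinearStack.HomOver.res g (φ T' f m)) →
    ∃! τ : LinearStack.HomOver t b T, ∀ (T' : Over U) (f : T' ⟶ T) (m : Sec N T'),
      φ T' f m = (m.map η : LinearStack.HomOver a t T') ≫ LinearStack.HomOver.res f τ

/-- A family of morphisms `γᵢ : Nᵢ → Γ_{ξᵢ t}` exhibits the label `t` as `⨁ᵢ Nᵢ ⊗ ξᵢ`: the label
`t` is the direct sum of products `tᵢ = Nᵢ ⊗ ξᵢ` in such a way that `γᵢ` is the composition of the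
universal morphism `Nᵢ → Γ_{ξᵢ tᵢ}` with the inclusion `tᵢ → t`. -/
def IsSumOfTensors {n : ℕ} (N : Fin n → SheafOfModules.{u} (𝒪.sheaf.over U))
    (ξ : Fin n → B.Label U) (t : B.Label U)
    (γ : ∀ i, N i ⟶ LinearStack.homSheaf (ξ i) t) : Prop :=
  ∃ (s : Fin n → B.Label U) (η : ∀ i, N i ⟶ LinearStack.homSheaf (ξ i) (s i))
    (inj : ∀ i, s i ⟶ t) (proj : ∀ i, t ⟶ s i),
    (∀ i, IsTensor (N i) (ξ i) (s i) (η i)) ∧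
    (∀ i, inj i ≫ proj i = 𝟙 _) ∧ (∀ i j, i ≠ j → inj i ≫ proj j = 0) ∧
    ∑ i, proj i ≫ inj i = 𝟙 _ ∧
    ∀ i, γ i = η i ≫ LinearStack.homSheafMap (ξ i) (inj i)

end CYFibration

variable {𝒯 : TangentMultiplication 𝒪}

/-- A Cardy fibration over a space with multiplication and invariant metric on the tangent sheaf
(`n` being the rank of the latter): a Calabi-Yau fibration with a cover by semisimple open sets
over which there are transition homomorphisms which satisfy the centrality, adjunction and Cardy
conditions and are compatible with restriction. -/
structure CardyFibration (η : InvariantMetric 𝒯) (n : ℕ) extends CYFibration 𝒪 where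
  /-- the cover by semisimple open sets -/
  cover : Set (Opens M)
  covers (x : M) : ∃ U ∈ cover, x ∈ U
  semisimple : ∀ U ∈ cover, 𝒯.IsSemisimple n U
  /-- the transition homomorphisms -/
  cardy : ∀ U ∈ cover, CardyStructure η (CYFibration.cyCategory toCYFibration U)
  ι_restr {U V : Opens M} (hU : U ∈ cover) (hV : V ∈ cover) (h : V ⟶ U)
    (a : toCYFibration.Label U) (T : Over V) (X : 𝒯.Sec T.left) :
    (cardy V hV).ι ((toCYFibration.restr h).obj a) (T := T) X =
      (toCYFibration.fib.overMapCompPresheafHomIso a a h).hom.app (op T)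
        ((cardy U hU).ι a (T := (Over.map h).obj T) X)
  ι'_restr {U V : Opens M} (hU : U ∈ cover) (hV : V ∈ cover) (h : V ⟶ U)
    (a : toCYFibration.Label U) (T : Over V)
    (σ : LinearStack.HomOver a a ((Over.map h).obj T)) :
    (cardy V hV).ι' ((toCYFibration.restr h).obj a) (T := T)
      ((toCYFibration.fib.overMapCompPresheafHomIso a a h).hom.app (op T) σ) =
      (cardy U hU).ι' a (T := (Over.map h).obj T) σ

namespace CardyFibration

variable {η : InvariantMetric 𝒯} {n : ℕ} (B : CardyFibration η n)

/-- The fibration has its structure over all open subsets of the members of the cover. -/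
def IsTrivializable : Prop :=
  ∀ U ∈ B.cover, ∀ V : Opens M, V ≤ U → V ∈ B.cover

/-- The fibration is maximal: over no member of the cover can the Cardy category of labels be
enlarged. -/
def IsMaximal : Prop :=
  ∀ (U : Opens M) (hU : U ∈ B.cover), (B.cardy U hU).IsMaximal

variable {B}

/-- The label `a` over `U` is supported on the idempotent `X`, i.e. `ι_a(X) = 1_a`. -/
def IsSupportedOn {U : Opens M} (hU : U ∈ B.cover) (a : B.Label U) (X : 𝒯.Sec U) : Prop :=
  (B.cardy U hU).ι a (T := Over.mk (𝟙 U)) X = (B.cyCategory U).id a (Over.mk (𝟙 U))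

end CardyFibration

end Fibrations

end

end BraneFibration

open BraneFibration

/-!
Around each point of `M` the category `ℬ(U)` is recognized by means of *fibre functors*, one for
each idempotent `eᵢ` (`FibreFunctor`): linear functors from labels to locally free modules which
`eᵢ` acts on as the identity and the other idempotents as zero, with local liftings
`E c → Γ_bc` that make morphisms and traces recoverable from their actions.

Families of `n` locally free modules form themselves a Cardy category (`RootedFrame.cardy`), with
traces weighted by square roots of the functions `θ(eᵢ)`. The Cardy condition holds since the sum
in question does not depend on the choice of dual bases (`casimir_eq`) and can be computed with
elementary matrices. A family of fibre functors at all sheets embeds a Cardy category into this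
standard one (`FibreFunctor.embedding`), so for a maximal Cardy category each family of modules is
the family of fibres of a label (`FibreFunctor.exists_label`).

A fibre functor arises from an idempotent `p` of rank one, that is with `p Γ_aa p = 𝒪 p`, on which
`eᵢ` acts as the identity: it is `b ↦ p Γ_ab` (`RankOneIdempotent.Realization.fibreFunctor`). By the
Cardy condition `θ_a(p)² = θ(eᵢ)` (`RankOneIdempotent.trace_sq`), so `θ_a(p)` is the required root.
If `eᵢ` acts as zero on all labels, the zero functor will do, with any root.

Existence of `p`, around a point at which `eᵢ` acts on `Γ_aa` as a nonzero idempotent, is the heart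
of the matter. The Cardy condition, read as a formula for the trace of `y ↦ σ y τ`, shows that the
fibre of the algebra `Γ_aa` at the point is semisimple, hence a product of matrix algebras, and
contains an idempotent of rank one below `eᵢ` (`exists_fibre_rank_one`). It is extended to a
neighbourhood with the implicit function theorem, as an eigenvector of `m ↦ z m z` where `z` is any
extension (`CYCategory.exists_eigenvector`, `CardyStructure.exists_rank_one`). Besides
continuity, all that is used of the functions on `M` is that such equations can be solved locally:
for eigenvectors, inverses and square roots.

On a connected neighbourhood in the cover there are thus fibre functors for all `i`
(`CardyFibration.exists_fibreFunctors`), and maximality provides labels `ξᵢ` whose family of fibres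
is `𝒪` in the `i`-th place and zero elsewhere. Their identities are idempotents of rank one, with
fibre functors `b ↦ Γ_{ξᵢ b}`. Applied to these, the argument above shows that `F` is fully
faithful on sheaves of morphisms and essentially surjective (`CardyFibration.exists_isComplete`).
Hence `F` is an equivalence; a quasi-inverse takes a family to the sum of the `ℳᵢ ⊗ ξᵢ`, because
labels with a single nonzero component have the universal property of `ℳᵢ ⊗ ξᵢ`
(`CYFibration.IsComplete.isSumOfTensors`).

Finally a module over the spectral cover is the sum of its parts `eᵢ N` on the `n` sheets, which
are locally free (`TangentMultiplication.IsIdempotentFrame.sheetEquivalence`).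
-/

namespace BraneFibration

noncomputable section

/-! ### Sections of sheaves of modules -/

section Sections

variable {M : Type u} [TopologicalSpace M] {U : Opens M}

instance (T T' : Over U) : Subsingleton (T' ⟶ T) :=
  ⟨fun _ _ ↦ Over.OverMorphism.ext (Subsingleton.elim _ _)⟩

/-- The morphism of `Over U` underlying an inclusion of open sets. -/
def overHom {T T' : Over U} (h : T'.left ≤ T.left) : T' ⟶ T :=
  Over.homMk (homOfLE h) (Subsingleton.elim _ _)

/-- An open subset of `T` as an object over `U`. -/
def overMk (T : Over U) (V : Opens M) (h : V ≤ T.left) : Over U :=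
  Over.mk (homOfLE h ≫ T.hom)

/-- The intersection of two objects over `U`. -/
def overInf (T T' : Over U) : Over U := overMk T (T.left ⊓ T'.left) inf_le_left

/-- The first inclusion of an intersection. -/
def overInfLeft (T T' : Over U) : overInf T T' ⟶ T := overHom inf_le_left

/-- The second inclusion of an intersection. -/
def overInfRight (T T' : Over U) : overInf T T' ⟶ T' := overHom inf_le_right

lemma mem_overInf {T T' : Over U} {x : M} (h : x ∈ T.left) (h' : x ∈ T'.left) :
    x ∈ (overInf T T').left := ⟨h, h'⟩

lemma mem_over_iff_cover {T : Over U} (S : Sieve T) :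
    S ∈ (Opens.grothendieckTopology M).over U T ↔
      ∀ x ∈ T.left, ∃ (T' : Over U) (f : T' ⟶ T), S f ∧ x ∈ T'.left := by
  rw [GrothendieckTopology.mem_over_iff]
  constructor
  · intro h x hx
    obtain ⟨V, f, hf, hV⟩ := h x hx
    rw [Sieve.overEquiv_iff] at hf
    exact ⟨_, _, hf, hV⟩
  · intro h x hx
    obtain ⟨T', f, hf, hV⟩ := h x hx
    refine ⟨T'.left, f.left, ?_, hV⟩
    rw [Sieve.overEquiv_iff]
    have := S.downward_closed hf (overHom (T := T') (T' := Over.mk (f.left ≫ T.hom)) le_rfl)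
    convert! this using 1

variable {R : Sheaf ((Opens.grothendieckTopology M).over U) RingCat.{u}}

lemma section_ext_locally (N : SheafOfModules.{u} R) {T : Over U} {s s' : N.val.obj (op T)}
    (h : ∀ x ∈ T.left, ∃ (T' : Over U) (f : T' ⟶ T), x ∈ T'.left ∧
      N.val.map f.op s = N.val.map f.op s') : s = s' := by
  have hS := (Presheaf.isSheaf_iff_isSheaf_forget _ _ (forget AddCommGrpCat.{u})).1 N.isSheaf
  rw [isSheaf_iff_isSheaf_of_type] at hS
  let S : Sieve T :=
    { arrows := fun T' f ↦ N.val.map f.op s = N.val.map f.op s'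
      downward_closed := by
        intro T' T'' f hf g
        have h1 := N.val.presheaf.map_comp f.op g.op
        exact ((ConcreteCategory.congr_hom h1 s).trans
          (congrArg (N.val.presheaf.map g.op) hf)).trans
          (ConcreteCategory.congr_hom h1 s').symm }
  have := (hS S ((mem_over_iff_cover S).2 fun x hx ↦ by
    obtain ⟨T', f, h1, h2⟩ := h x hx
    exact ⟨T', f, h2, h1⟩)).isSeparatedFor
  exact this.ext fun T' f hf ↦ hf

lemma section_exists_glue (N : SheafOfModules.{u} R) {T : Over U} {ι : Type*} (T' : ι → Over U)
    (f : ∀ i, T' i ⟶ T) (hT : ∀ x ∈ T.left, ∃ i, x ∈ (T' i).left)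
    (s : ∀ i, N.val.obj (op (T' i)))
    (hs : ∀ i j (W : Over U) (g : W ⟶ T' i) (g' : W ⟶ T' j),
      (N.val.map g.op (s i) : N.val.obj (op W)) = N.val.map g'.op (s j)) :
    ∃ t : N.val.obj (op T), ∀ i, N.val.map (f i).op t = s i := by
  have hS := (Presheaf.isSheaf_iff_isSheaf_forget _ _ (forget AddCommGrpCat.{u})).1 N.isSheaf
  rw [isSheaf_iff_isSheaf_of_type] at hS
  let S : Sieve T :=
    { arrows := fun W _ ↦ ∃ i, Nonempty (W ⟶ T' i)
      downward_closed := by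
        rintro W W' f ⟨i, ⟨h⟩⟩ g
        exact ⟨i, ⟨g ≫ h⟩⟩ }
  have hsh := hS S ((mem_over_iff_cover S).2 fun x hx ↦ by
    obtain ⟨i, hi⟩ := hT x hx
    exact ⟨T' i, f i, ⟨i, ⟨𝟙 _⟩⟩, hi⟩)
  have mapcomp : ∀ {W W' W'' : Over U} (g : W' ⟶ W) (g' : W'' ⟶ W') (m : N.val.obj (op W)),
      (N.val.map g'.op (N.val.map g.op m : N.val.obj (op W')) : N.val.obj (op W'')) =
        N.val.map (g' ≫ g).op m := fun g g' m ↦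
    (ConcreteCategory.congr_hom (N.val.presheaf.map_comp g.op g'.op) m).symm
  -- on members of the sieve generated by the cover, the section is restricted from any `T' i`
  -- through which the arrow factors; `hs` makes this independent of the choice
  let φ : Presieve.FamilyOfElements (N.val.presheaf ⋙ forget AddCommGrpCat.{u}) S.arrows :=
    fun W g hg ↦ (N.val.map hg.choose_spec.some.op (s hg.choose) : N.val.obj (op W))
  have hφ : φ.Compatible := by
    rw [Presieve.compatible_iff_sieveCompatible]
    intro W W' g h hg
    have hg' : S (h ≫ g) := S.downward_closed hg h
    exact (hs _ _ _ hg'.choose_spec.some (h ≫ hg.choose_spec.some)).trans (mapcomp _ _ _).symm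
  obtain ⟨t, ht, -⟩ := hsh φ hφ
  refine ⟨t, fun i ↦ ?_⟩
  have h1 : S (f i) := ⟨i, ⟨𝟙 _⟩⟩
  refine (ht (f i) h1).trans ((hs _ i _ h1.choose_spec.some (𝟙 _)).trans ?_)
  exact ConcreteCategory.congr_hom (N.val.presheaf.map_id (op (T' i))) (s i)

/-- A sheaf of modules in terms of its sections: a family of modules with restriction maps for
which sections can be glued in a unique way. -/
structure SectionSystem (R : Sheaf ((Opens.grothendieckTopology M).over U) RingCat.{u})
    (A : Over U → Type u) [∀ T, AddCommGroup (A T)]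
    [∀ T, Module (R.obj.obj (op T)) (A T)] where
  /-- the restriction maps -/
  res {T T' : Over U} (f : T' ⟶ T) : A T →+ A T'
  res_id (T : Over U) (s : A T) : res (𝟙 T) s = s
  res_comp {T T' T'' : Over U} (f : T' ⟶ T) (g : T'' ⟶ T') (s : A T) :
    res (g ≫ f) s = res g (res f s)
  res_smul {T T' : Over U} (f : T' ⟶ T) (r : R.obj.obj (op T)) (s : A T) :
    res f (r • s) = R.obj.map f.op r • res f s
  sep {T : Over U} (s s' : A T) (h : ∀ x ∈ T.left, ∃ (T' : Over U) (f : T' ⟶ T),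
    x ∈ T'.left ∧ res f s = res f s') : s = s'
  glue {T : Over U} {ι : Type u} (T' : ι → Over U)
    (f : ∀ i, T' i ⟶ T) (hT : ∀ x ∈ T.left, ∃ i, x ∈ (T' i).left) (s : ∀ i, A (T' i))
    (hs : ∀ i j (W : Over U) (g : W ⟶ T' i) (g' : W ⟶ T' j), res g (s i) = res g' (s j)) :
    ∃ t : A T, ∀ i, res (f i) t = s i

namespace SectionSystem

variable {A : Over U → Type u} [∀ T, AddCommGroup (A T)] [∀ T, Module (R.obj.obj (op T)) (A T)]
  (D : SectionSystem R A)

/-- The presheaf of abelian groups of a system of sections. -/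
def presheaf : (Over U)ᵒᵖ ⥤ AddCommGrpCat.{u} where
  obj T := AddCommGrpCat.of (A T.unop)
  map f := AddCommGrpCat.ofHom (D.res f.unop)
  map_id T := by ext s; exact D.res_id _ s
  map_comp f g := by ext s; exact D.res_comp _ _ s

instance (T : (Over U)ᵒᵖ) : Module (R.obj.obj T) (D.presheaf.obj T) :=
  inferInstanceAs (Module (R.obj.obj (op T.unop)) (A T.unop))

lemma isSheaf_presheaf : Presheaf.IsSheaf ((Opens.grothendieckTopology M).over U) D.presheaf := by
  refine (Presheaf.isSheaf_iff_isSheaf_forget _ _ (forget AddCommGrpCat.{u})).2 ?_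
  rw [isSheaf_iff_isSheaf_of_type]
  intro T S hS
  rw [mem_over_iff_cover] at hS
  rw [← Presieve.isSeparatedFor_and_exists_isAmalgamation_iff_isSheafFor]
  refine ⟨?_, ?_⟩
  · intro φ s s' hs hs'
    refine D.sep s s' fun x hx ↦ ?_
    obtain ⟨T', f, hf, hx⟩ := hS x hx
    exact ⟨T', f, hx, (hs f hf).trans (hs' f hf).symm⟩
  · intro φ hφ
    have hS' : ∀ x : T.left, ∃ (T' : Over U) (f : T' ⟶ T), S f ∧ (x : M) ∈ T'.left :=
      fun x ↦ hS x x.2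
    choose T' f hf hx using hS'
    obtain ⟨t, ht⟩ := D.glue T' f (fun x hx' ↦ ⟨⟨x, hx'⟩, hx _⟩) (fun x ↦ φ (f x) (hf x))
      fun i j W g g' ↦ hφ g g' (hf i) (hf j) (Subsingleton.elim _ _)
    refine ⟨t, fun W g hg ↦ D.sep _ _ fun x hxW ↦ ?_⟩
    let i : T.left := ⟨x, g.left.le hxW⟩
    refine ⟨overInf W (T' i), overInfLeft _ _, mem_overInf hxW (hx i), ?_⟩
    have h1 := hφ (overInfLeft W (T' i)) (overInfRight W (T' i)) hg (hf i) (Subsingleton.elim _ _)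
    refine Eq.trans ?_ h1.symm
    refine (D.res_comp g (overInfLeft W (T' i)) t).symm.trans ?_
    refine Eq.trans ?_ (congrArg (D.res (overInfRight W (T' i))) (ht i))
    refine Eq.trans ?_ (D.res_comp (f i) (overInfRight W (T' i)) t)
    congr 1

/-- The sheaf of modules given by a system of sections. -/
def sheaf : SheafOfModules.{u} R where
  val := PresheafOfModules.ofPresheaf D.presheaf fun _ _ f r m ↦ D.res_smul f.unop r m
  isSheaf := D.isSheaf_presheaf

end SectionSystem

/-- A morphism of sheaves of modules in terms of sections. -/
def mkModuleHom {N N' : SheafOfModules.{u} R}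
    (φ : ∀ T : Over U, N.val.obj (op T) →+ N'.val.obj (op T))
    (hsmul : ∀ (T : Over U) (r : R.obj.obj (op T)) (s : N.val.obj (op T)),
      φ T (r • s) = r • φ T s)
    (hres : ∀ {T T' : Over U} (f : T' ⟶ T) (s : N.val.obj (op T)),
      φ T' (N.val.map f.op s : N.val.obj (op T')) = N'.val.map f.op (φ T s)) : N ⟶ N' where
  val := PresheafOfModules.homMk
    { app := fun T ↦ AddCommGrpCat.ofHom (φ T.unop)
      naturality := fun T T' f ↦ by
        ext s
        exact hres f.unop s }
    fun T r s ↦ hsmul T.unop r s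

lemma moduleHom_ext {N N' : SheafOfModules.{u} R} {φ ψ : N ⟶ N'}
    (h : ∀ (T : Over U) (s : N.val.obj (op T)), φ.val.app (op T) s = ψ.val.app (op T) s) :
    φ = ψ := by
  ext T s
  exact h T.unop s

lemma app_map {N N' : SheafOfModules.{u} R} (φ : N ⟶ N') {T T' : Over U} (f : T' ⟶ T)
    (s : N.val.obj (op T)) :
    φ.val.app (op T') (N.val.map f.op s : N.val.obj (op T')) =
      N'.val.map f.op (φ.val.app (op T) s) :=
  PresheafOfModules.naturality_apply φ.val f.op s

/-- A morphism of sheaves of modules which is bijective on sections is an isomorphism. -/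
def isoOfBijective {N N' : SheafOfModules.{u} R} (φ : N ⟶ N')
    (h : ∀ T : Over U, Function.Bijective fun s : N.val.obj (op T) ↦ φ.val.app (op T) s) :
    N ≅ N' where
  hom := φ
  inv := mkModuleHom (fun T ↦ (AddEquiv.ofBijective (φ.val.app (op T)).hom.toAddMonoidHom
        (h T)).symm.toAddMonoidHom)
    (fun T r s ↦ by
      refine (AddEquiv.symm_apply_eq _).2 ?_
      refine Eq.trans ?_ ((φ.val.app (op T)).hom.map_smul r _).symm
      exact congrArg (r • ·) ((AddEquiv.ofBijective (φ.val.app (op T)).hom.toAddMonoidHom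
        (h T)).apply_symm_apply s).symm)
    (fun {T T'} f s ↦ by
      refine (AddEquiv.symm_apply_eq _).2 ?_
      refine Eq.trans ?_ (app_map φ f _).symm
      exact congrArg (N'.val.map f.op) ((AddEquiv.ofBijective (φ.val.app (op T)).hom.toAddMonoidHom
        (h T)).apply_symm_apply s).symm)
  hom_inv_id := moduleHom_ext fun T s ↦
    (AddEquiv.ofBijective (φ.val.app (op T)).hom.toAddMonoidHom (h T)).symm_apply_apply s
  inv_hom_id := moduleHom_ext fun T s ↦
    (AddEquiv.ofBijective (φ.val.app (op T)).hom.toAddMonoidHom (h T)).apply_symm_apply s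

end Sections

end

end BraneFibration

namespace BraneFibration

noncomputable section

/-! ### Sections over the structure sheaf, local frames -/

section OSections

variable {M : Type u} [TopologicalSpace M] {𝒪 : FunctionSheaf M} {U : Opens M}
  {N N' N'' : SheafOfModules.{u} (𝒪.sheaf.over U)}

namespace Sec

variable {T T' T'' : Over U}

lemma res_add (f : T' ⟶ T) (s t : Sec N T) : (s + t).res f = s.res f + t.res f :=
  (N.val.map f.op).hom.map_add s t

lemma res_zero (f : T' ⟶ T) : (0 : Sec N T).res f = 0 := (N.val.map f.op).hom.map_zero

lemma res_smul (f : T' ⟶ T) (r : 𝒪.sec T.left) (s : Sec N T) :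
    (r • s).res f = 𝒪.res f.left.le r • s.res f := N.val.map_smul f.op r s

/-- Restriction as an additive map. -/
def resHom (f : T' ⟶ T) : Sec N T →+ Sec N T' :=
  AddMonoidHom.mk' (fun s ↦ s.res f) (res_add f)

lemma res_sum {ι : Type*} (f : T' ⟶ T) (a : Finset ι) (s : ι → Sec N T) :
    (∑ i ∈ a, s i).res f = ∑ i ∈ a, (s i).res f := map_sum (resHom f) s a

lemma res_neg (f : T' ⟶ T) (s : Sec N T) : (-s).res f = -s.res f := map_neg (resHom f) s

lemma res_sub (f : T' ⟶ T) (s t : Sec N T) : (s - t).res f = s.res f - t.res f :=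
  map_sub (resHom f) s t

lemma res_res (f : T' ⟶ T) (g : T'' ⟶ T') (s : Sec N T) : (s.res f).res g = s.res (g ≫ f) :=
  (ConcreteCategory.congr_hom (N.val.presheaf.map_comp f.op g.op) s).symm

lemma res_id (s : Sec N T) : s.res (𝟙 T) = s :=
  ConcreteCategory.congr_hom (N.val.presheaf.map_id (op T)) s

lemma res_self (f : T ⟶ T) (s : Sec N T) : s.res f = s := by
  rw [Subsingleton.elim f (𝟙 T), res_id]

lemma map_add (φ : N ⟶ N') (s t : Sec N T) : (s + t).map φ = s.map φ + t.map φ :=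
  (φ.val.app (op T)).hom.map_add s t

lemma map_zero (φ : N ⟶ N') : (0 : Sec N T).map φ = 0 := (φ.val.app (op T)).hom.map_zero

lemma map_smul (φ : N ⟶ N') (r : 𝒪.sec T.left) (s : Sec N T) :
    (r • s).map φ = r • s.map φ := (φ.val.app (op T)).hom.map_smul r s

/-- The linear map on sections induced by a morphism of sheaves. -/
def mapₗ (φ : N ⟶ N') (T : Over U) : Sec N T →ₗ[𝒪.sec T.left] Sec N' T where
  toFun s := s.map φ
  map_add' := map_add φ
  map_smul' := map_smul φ

lemma map_sum {ι : Type*} (φ : N ⟶ N') (a : Finset ι) (s : ι → Sec N T) :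
    (∑ i ∈ a, s i).map φ = ∑ i ∈ a, (s i).map φ := _root_.map_sum (mapₗ φ T) s a

lemma map_res (φ : N ⟶ N') (f : T' ⟶ T) (s : Sec N T) : (s.res f).map φ = (s.map φ).res f :=
  app_map φ f s

lemma map_comp (φ : N ⟶ N') (ψ : N' ⟶ N'') (s : Sec N T) : s.map (φ ≫ ψ) = (s.map φ).map ψ := rfl

lemma map_id (s : Sec N T) : s.map (𝟙 N) = s := rfl

lemma map_hom_inv (φ : N ≅ N') (s : Sec N T) : (s.map φ.hom).map φ.inv = s := by
  rw [← map_comp, φ.hom_inv_id, map_id]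

lemma map_inv_hom (φ : N ≅ N') (s : Sec N' T) : (s.map φ.inv).map φ.hom = s := by
  rw [← map_comp, φ.inv_hom_id, map_id]

lemma map_injective (φ : N ≅ N') : Function.Injective fun s : Sec N T ↦ s.map φ.hom :=
  Function.LeftInverse.injective (g := fun s : Sec N' T ↦ s.map φ.inv)
    (map_hom_inv φ)

lemma ext_locally {s s' : Sec N T} (h : ∀ x ∈ T.left, ∃ (T' : Over U) (f : T' ⟶ T),
    x ∈ T'.left ∧ s.res f = s'.res f) : s = s' := section_ext_locally N h

lemma exists_glue {ι : Type*} (T' : ι → Over U)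
    (f : ∀ i, T' i ⟶ T) (hT : ∀ x ∈ T.left, ∃ i, x ∈ (T' i).left) (s : ∀ i, Sec N (T' i))
    (hs : ∀ i j (W : Over U) (g : W ⟶ T' i) (g' : W ⟶ T' j), (s i).res g = (s j).res g') :
    ∃ t : Sec N T, ∀ i, t.res (f i) = s i := section_exists_glue N T' f hT s hs

lemma hom_ext {φ ψ : N ⟶ N'} (h : ∀ (T : Over U) (s : Sec N T), s.map φ = s.map ψ) : φ = ψ :=
  moduleHom_ext h

end Sec

/-- A morphism of sheaves of `𝒪_U`-modules in terms of sections. -/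
def mkHom (φ : ∀ T : Over U, Sec N T →ₗ[𝒪.sec T.left] Sec N' T)
    (hφ : ∀ {T T' : Over U} (f : T' ⟶ T) (s : Sec N T), φ T' (s.res f) = (φ T s).res f) :
    N ⟶ N' :=
  mkModuleHom (N := N) (N' := N') (fun T ↦ (φ T).toAddMonoidHom) (fun T ↦ (φ T).map_smul)
    fun f s ↦ hφ f s

lemma map_mkHom (φ : ∀ T : Over U, Sec N T →ₗ[𝒪.sec T.left] Sec N' T) (hφ) {T : Over U}
    (s : Sec N T) : s.map (mkHom φ hφ) = φ T s := rfl

/-- The finite family `s` of sections over `T` is a frame: it restricts to a basis over each open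
subset of `T`. -/
def IsFrame {ι : Type*} [Fintype ι] {T : Over U} (s : ι → Sec N T) : Prop :=
  ∀ (T' : Over U) (f : T' ⟶ T) (m : Sec N T'),
    ∃! c : ι → 𝒪.sec T'.left, m = ∑ j, c j • (s j).res f

/-- The basis given by a family with unique coefficients. -/
def basisOfExistsUnique {ι R A : Type*} [Fintype ι] [CommRing R] [AddCommGroup A] [Module R A]
    (v : ι → A) (h : ∀ m, ∃! c : ι → R, m = ∑ j, c j • v j) : Module.Basis ι R A :=
  Module.Basis.ofEquivFun (LinearEquiv.ofBijective (Fintype.linearCombination R v)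
    ⟨fun c c' hc ↦ (h (Fintype.linearCombination R v c)).unique rfl hc,
      fun m ↦ (h m).exists.imp fun _ hc ↦ hc.symm⟩).symm

@[simp] lemma basisOfExistsUnique_apply {ι R A : Type*} [Fintype ι] [CommRing R] [AddCommGroup A]
    [Module R A] (v : ι → A) (h : ∀ m, ∃! c : ι → R, m = ∑ j, c j • v j) (i : ι) :
    basisOfExistsUnique v h i = v i := by
  classical
  rw [basisOfExistsUnique, Module.Basis.coe_ofEquivFun]
  change Fintype.linearCombination R v (Pi.single i 1) = v i
  simp

lemma existsUnique_of_basis {ι R A : Type*} [Fintype ι] [CommRing R] [AddCommGroup A]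
    [Module R A] (b : Module.Basis ι R A) (m : A) : ∃! c : ι → R, m = ∑ j, c j • b j := by
  refine ⟨b.equivFun m, (b.sum_equivFun m).symm, fun c hc ↦ ?_⟩
  rw [hc, ← b.equivFun_symm_apply, LinearEquiv.apply_symm_apply]

namespace IsFrame

variable {ι : Type*} [Fintype ι] {T T' T'' : Over U} {s : ι → Sec N T}

/-- The basis of the module of sections over a smaller open set. -/
def basis (hs : IsFrame s) (f : T' ⟶ T) : Module.Basis ι (𝒪.sec T'.left) (Sec N T') :=
  basisOfExistsUnique (fun j ↦ (s j).res f) (hs T' f)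

@[simp] lemma basis_apply (hs : IsFrame s) (f : T' ⟶ T) (j : ι) : hs.basis f j = (s j).res f :=
  basisOfExistsUnique_apply _ _ j

lemma sum_repr (hs : IsFrame s) (f : T' ⟶ T) (m : Sec N T') :
    ∑ j, (hs.basis f).repr m j • (s j).res f = m := by
  simpa using (hs.basis f).sum_repr m

lemma restrict (hs : IsFrame s) (f : T' ⟶ T) : IsFrame fun j ↦ (s j).res f := by
  intro T'' g m
  simpa only [Sec.res_res] using hs T'' (g ≫ f) m

lemma repr_eq (hs : IsFrame s) (f : T' ⟶ T) {m : Sec N T'} {c : ι → 𝒪.sec T'.left}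
    (h : m = ∑ j, c j • (s j).res f) : ⇑((hs.basis f).repr m) = c :=
  (hs T' f m).unique (hs.sum_repr f m).symm h

lemma repr_res (hs : IsFrame s) (f : T' ⟶ T) (g : T'' ⟶ T') (h : T'' ⟶ T) (m : Sec N T') (j : ι) :
    (hs.basis h).repr (m.res g) j = 𝒪.res g.left.le ((hs.basis f).repr m j) := by
  obtain rfl : h = g ≫ f := Subsingleton.elim _ _
  refine congrFun (hs.repr_eq (g ≫ f) (c := fun j ↦ 𝒪.res g.left.le ((hs.basis f).repr m j)) ?_) j
  conv_lhs => rw [← hs.sum_repr f m]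
  simp only [Sec.res_sum, Sec.res_smul, Sec.res_res]

lemma reindex {κ : Type*} [Fintype κ] (hs : IsFrame s) (e : κ ≃ ι) : IsFrame (s ∘ e) := by
  intro T' f m
  have := existsUnique_of_basis ((hs.basis f).reindex e.symm) m
  simpa using this

lemma of_basis (b : ∀ (T' : Over U), (T' ⟶ T) → Module.Basis ι (𝒪.sec T'.left) (Sec N T'))
    (hb : ∀ T' f j, b T' f j = (s j).res f) : IsFrame s := by
  intro T' f m
  simpa only [hb] using existsUnique_of_basis (b T' f) m

lemma map_iso (hs : IsFrame s) (φ : N ≅ N') : IsFrame fun j ↦ (s j).map φ.hom := by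
  intro T' f m
  obtain ⟨c, hc, hc'⟩ := hs T' f (m.map φ.inv)
  refine ⟨c, ?_, fun c' h ↦ hc' c' ?_⟩
  · have := congrArg (Sec.map φ.hom) hc
    rw [Sec.map_inv_hom] at this
    simpa only [Sec.map_sum, Sec.map_smul, Sec.map_res] using this
  · have := congrArg (Sec.map φ.inv) h
    simpa only [Sec.map_sum, Sec.map_smul, ← Sec.map_res, Sec.map_hom_inv] using this

end IsFrame

lemma isLocallyFree_of_frames (h : ∀ x ∈ U, ∃ T : Over U, x ∈ T.left ∧
    ∃ (ι : Type) (_ : Fintype ι) (s : ι → Sec N T), IsFrame s) : IsLocallyFree N := by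
  intro x hx
  obtain ⟨T, hT, ι, _, s, hs⟩ := h x hx
  exact ⟨T, hT, _, _, hs.reindex (Fintype.equivFin ι).symm⟩

/-- Around each point of `T` there is a frame over an open subset of `T`. -/
lemma IsLocallyFree.exists_frame (h : IsLocallyFree N) (T : Over U) {x : M} (hx : x ∈ T.left) :
    ∃ (T' : Over U) (_ : T' ⟶ T), x ∈ T'.left ∧ ∃ (r : ℕ) (s : Fin r → Sec N T'), IsFrame s := by
  obtain ⟨T₁, hT₁, r, s, hs⟩ := h x (T.hom.le hx)
  exact ⟨overInf T T₁, overInfLeft _ _, mem_overInf hx hT₁, r, _,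
    IsFrame.restrict hs (overInfRight T T₁)⟩

/-! ### The sheaf of local homomorphisms -/

/-- A section over `T` of the sheaf of homomorphisms between two sheaves of modules. -/
@[ext]
structure LocHom (N N' : SheafOfModules.{u} (𝒪.sheaf.over U)) (T : Over U) where
  /-- the linear maps between sections over open subsets of `T` -/
  app {T' : Over U} (f : T' ⟶ T) : Sec N T' →ₗ[𝒪.sec T'.left] Sec N' T'
  app_res {T' T'' : Over U} (f : T' ⟶ T) (g : T'' ⟶ T') (m : Sec N T') :
    app (g ≫ f) (m.res g) = (app f m).res g

namespace LocHom

variable {T T' T'' : Over U}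

instance : Zero (LocHom N N' T) := ⟨⟨fun _ ↦ 0, fun _ _ _ ↦ by simp [Sec.res_zero]⟩⟩
instance : Add (LocHom N N' T) :=
  ⟨fun φ ψ ↦ ⟨fun f ↦ φ.app f + ψ.app f, fun f g m ↦ by simp [Sec.res_add, app_res]⟩⟩
instance : Neg (LocHom N N' T) :=
  ⟨fun φ ↦ ⟨fun f ↦ -φ.app f, fun f g m ↦ by simp [Sec.res_neg, app_res]⟩⟩
instance : SMul (𝒪.sec T.left) (LocHom N N' T) :=
  ⟨fun r φ ↦ ⟨fun f ↦ 𝒪.res f.left.le r • φ.app f,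
    fun f g m ↦ by simp [Sec.res_smul, app_res]⟩⟩

@[simp] lemma zero_app (f : T' ⟶ T) : (0 : LocHom N N' T).app f = 0 := rfl
@[simp] lemma add_app (φ ψ : LocHom N N' T) (f : T' ⟶ T) :
    (φ + ψ).app f = φ.app f + ψ.app f := rfl
@[simp] lemma neg_app (φ : LocHom N N' T) (f : T' ⟶ T) : (-φ).app f = -φ.app f := rfl
@[simp] lemma smul_app (r : 𝒪.sec T.left) (φ : LocHom N N' T) (f : T' ⟶ T) :
    (r • φ).app f = 𝒪.res f.left.le r • φ.app f := rfl

instance : AddCommGroup (LocHom N N' T) where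
  add_assoc φ ψ χ := by ext : 3; simp [add_assoc]
  zero_add φ := by ext : 3; simp
  add_zero φ := by ext : 3; simp
  add_comm φ ψ := by ext : 3; simp [add_comm]
  neg_add_cancel φ := by ext T' f : 3; simp
  nsmul := nsmulRec
  zsmul := zsmulRec

instance : Module (𝒪.sec T.left) (LocHom N N' T) where
  one_smul φ := by ext : 3; simp
  mul_smul r r' φ := by ext : 3; simp [mul_smul]
  smul_zero r := by ext : 3; simp
  smul_add r φ ψ := by ext : 3; simp
  add_smul r r' φ := by ext : 3; simp [add_smul]
  zero_smul φ := by ext : 3; simp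

/-- Restriction of local homomorphisms. -/
def res (g : T' ⟶ T) (φ : LocHom N N' T) : LocHom N N' T' :=
  ⟨fun f ↦ φ.app (f ≫ g), fun f h m ↦ by rw [Category.assoc, app_res]⟩

@[simp] lemma res_app (g : T' ⟶ T) (φ : LocHom N N' T) (f : T'' ⟶ T') :
    (φ.res g).app f = φ.app (f ≫ g) := rfl

/-- Composition of local homomorphisms, in diagrammatic order. -/
def comp (φ : LocHom N N' T) (ψ : LocHom N' N'' T) : LocHom N N'' T :=
  ⟨fun f ↦ ψ.app f ∘ₗ φ.app f, fun f g m ↦ by simp [app_res]⟩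

@[simp] lemma comp_app (φ : LocHom N N' T) (ψ : LocHom N' N'' T) (f : T' ⟶ T) :
    (φ.comp ψ).app f = ψ.app f ∘ₗ φ.app f := rfl

variable (N T) in
/-- The identity. -/
def id : LocHom N N T := ⟨fun _ ↦ LinearMap.id, fun _ _ _ ↦ rfl⟩

/-- The local homomorphism given by a morphism of sheaves. -/
def ofHom (φ : N ⟶ N') (T : Over U) : LocHom N N' T :=
  ⟨fun {T'} _ ↦ Sec.mapₗ φ T', fun _ g m ↦ Sec.map_res φ g m⟩

lemma app_congr (φ : LocHom N N' T) (f g : T' ⟶ T) (m : Sec N T') : φ.app f m = φ.app g m := by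
  rw [Subsingleton.elim f g]

/-- The morphism of sheaves given by a local homomorphism over all of `U`. -/
def toHom (φ : LocHom N N' (Over.mk (𝟙 U))) : N ⟶ N' :=
  mkHom (fun T ↦ φ.app (Over.mkIdTerminal.from T)) fun {T T'} f s ↦ by
    rw [← app_res]
    congr 1

lemma map_toHom (φ : LocHom N N' (Over.mk (𝟙 U))) (f : T ⟶ Over.mk (𝟙 U)) (s : Sec N T) :
    s.map φ.toHom = φ.app f s := by
  rw [toHom, map_mkHom]
  exact app_congr _ _ _ _

lemma app_res' (φ : LocHom N N' T) (f : T' ⟶ T) (g : T'' ⟶ T') (h : T'' ⟶ T) (m : Sec N T') :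
    φ.app h (m.res g) = (φ.app f m).res g := by
  rw [← app_res, Subsingleton.elim h (g ≫ f)]

lemma ext_app {φ ψ : LocHom N N' T}
    (h : ∀ (T' : Over U) (f : T' ⟶ T) (m : Sec N T'), φ.app f m = ψ.app f m) : φ = ψ := by
  ext T' f m
  exact h T' f m

lemma ext_locally {φ ψ : LocHom N N' T} (h : ∀ x ∈ T.left, ∃ (T' : Over U) (f : T' ⟶ T),
    x ∈ T'.left ∧ φ.res f = ψ.res f) : φ = ψ := by
  refine ext_app fun T' f m ↦ Sec.ext_locally fun x hx ↦ ?_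
  obtain ⟨T₁, f₁, hx₁, e⟩ := h x (f.left.le hx)
  refine ⟨overInf T' T₁, overInfLeft _ _, mem_overInf hx hx₁, ?_⟩
  have e' := congrArg (fun χ : LocHom N N' T₁ ↦
    χ.app (overInfRight T' T₁) (m.res (overInfLeft T' T₁))) e
  simp only [res_app] at e'
  rwa [app_res' φ f, app_res' ψ f] at e'

lemma exists_glue {ι : Type*} (T' : ι → Over U)
    (f : ∀ i, T' i ⟶ T) (hT : ∀ x ∈ T.left, ∃ i, x ∈ (T' i).left) (φ : ∀ i, LocHom N N' (T' i))
    (hφ : ∀ i j (W : Over U) (g : W ⟶ T' i) (g' : W ⟶ T' j), (φ i).res g = (φ j).res g') :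
    ∃ ψ : LocHom N N' T, ∀ i, ψ.res (f i) = φ i := by
  have hφ' : ∀ i j (W : Over U) (g : W ⟶ T' i) (g' : W ⟶ T' j) (m : Sec N W),
      (φ i).app g m = (φ j).app g' m := fun i j W g g' m ↦ by
    have := congrArg (fun χ : LocHom N N' W ↦ χ.app (𝟙 W) m) (hφ i j W g g')
    simpa only [res_app, Category.id_comp] using this
  -- the value of the glued homomorphism at a section is glued from the given values on intersections
  have glue : ∀ (W : Over U) (h : W ⟶ T) (m : Sec N W), ∃ m' : Sec N' W,
      ∀ i (W' : Over U) (g : W' ⟶ W) (g' : W' ⟶ T' i), m'.res g = (φ i).app g' (m.res g) := by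
    intro W h m
    obtain ⟨m', hm'⟩ := Sec.exists_glue (N := N') (fun i ↦ overInf W (T' i))
      (fun i ↦ overInfLeft _ _) (fun x hx ↦ (hT x (h.left.le hx)).imp fun i hi ↦ ⟨hx, hi⟩)
      (fun i ↦ (φ i).app (overInfRight _ _) (m.res (overInfLeft _ _))) (by
        intro i j W' g g'
        rw [← app_res, ← app_res, Sec.res_res, Sec.res_res,
          Subsingleton.elim (g' ≫ overInfLeft W (T' j)) (g ≫ overInfLeft W (T' i))]
        exact hφ' _ _ _ _ _ _)
    refine ⟨m', fun i W' g g' ↦ ?_⟩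
    have g₁ : W' ⟶ overInf W (T' i) := overHom (le_inf g.left.le g'.left.le)
    have := congrArg (Sec.res g₁) (hm' i)
    rw [Sec.res_res, ← app_res, Sec.res_res,
      Subsingleton.elim (g₁ ≫ overInfLeft W (T' i)) g] at this
    rw [this]
    exact app_congr _ _ _ _
  -- sections over `W` are determined by their restrictions to sets which lie in some `T' i`
  have uniq : ∀ (W : Over U) (_ : W ⟶ T) (m m' : Sec N' W),
      (∀ i (W' : Over U) (g : W' ⟶ W) (_ : W' ⟶ T' i), m.res g = m'.res g) → m = m' := by
    intro W h m m' e
    refine Sec.ext_locally fun x hx ↦ ?_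
    obtain ⟨i, hi⟩ := hT x (h.left.le hx)
    exact ⟨overInf W (T' i), overInfLeft _ _, ⟨hx, hi⟩, e i _ _ (overInfRight _ _)⟩
  choose D hD using glue
  let ψ : LocHom N N' T :=
    { app := fun {W} h ↦
        { toFun := D W h
          map_add' := fun m m' ↦ uniq W h _ _ fun i W' g g' ↦ by
            rw [Sec.res_add, hD _ _ _ i W' g g', hD _ _ _ i W' g g', hD _ _ _ i W' g g',
              Sec.res_add, map_add]
          map_smul' := fun r m ↦ uniq W h _ _ fun i W' g g' ↦ by
            rw [RingHom.id_apply, Sec.res_smul, hD _ _ _ i W' g g', hD _ _ _ i W' g g',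
              Sec.res_smul, map_smul] }
      app_res := fun {W W'} h g m ↦ uniq W' (g ≫ h) _ _ fun i W'' g' g'' ↦
        ((hD W' (g ≫ h) _ i W'' g' g'').trans (by rw [Sec.res_res])).trans
          ((hD W h m i W'' (g' ≫ g) g'').symm.trans (Sec.res_res _ _ _).symm) }
  refine ⟨ψ, fun i ↦ ext_app fun W h m ↦ ?_⟩
  have := hD W (h ≫ f i) m i W (𝟙 W) h
  rw [Sec.res_id, Sec.res_id] at this
  exact this

instance (T : Over U) : Module ((𝒪.sheaf.over U).obj.obj (op T)) (LocHom N N' T) :=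
  inferInstanceAs (Module (𝒪.sec T.left) (LocHom N N' T))

/-- The system of sections of the sheaf of homomorphisms. -/
def system (N N' : SheafOfModules.{u} (𝒪.sheaf.over U)) :
    SectionSystem (𝒪.sheaf.over U) (fun T ↦ LocHom N N' T) where
  res f := AddMonoidHom.mk' (res f) fun _ _ ↦ rfl
  res_id T φ := ext_app fun T' f m ↦ app_congr _ _ _ _
  res_comp f g φ := ext_app fun T' h m ↦ app_congr _ _ _ _
  res_smul f r φ := rfl
  sep _ _ h := ext_locally h
  glue T' f hT s hs := exists_glue T' f hT s hs

end LocHom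

end OSections

end

end BraneFibration

namespace BraneFibration

noncomputable section

/-! ### Local frames of sheaves of homomorphisms, traces of endomorphisms -/

section Frames

variable {M : Type u} [TopologicalSpace M] {𝒪 : FunctionSheaf M} {U : Opens M}
  {N N' N'' : SheafOfModules.{u} (𝒪.sheaf.over U)}

namespace LocHom

variable {ι ι' : Type*} [Fintype ι] [Fintype ι'] {T T' T'' : Over U} {s : ι → Sec N T}
  {s' : ι' → Sec N' T}

/-- A local homomorphism with prescribed values on a frame. -/
def ofFrame (hs : IsFrame s) (m : ι → Sec N' T) : LocHom N N' T where
  app f := ∑ j, ((hs.basis f).coord j).smulRight ((m j).res f)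
  app_res f g m := by
    simp only [LinearMap.coe_sum, Finset.sum_apply, LinearMap.smulRight_apply,
      Module.Basis.coord_apply, Sec.res_sum, Sec.res_smul, Sec.res_res, hs.repr_res f g]

lemma ofFrame_app (hs : IsFrame s) (m : ι → Sec N' T) (f : T' ⟶ T) (a : Sec N T') :
    (ofFrame hs m).app f a = ∑ j, (hs.basis f).repr a j • (m j).res f := by
  simp [ofFrame]

lemma ext_frame (hs : IsFrame s) {φ ψ : LocHom N N' T}
    (h : ∀ j, φ.app (𝟙 T) (s j) = ψ.app (𝟙 T) (s j)) : φ = ψ := by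
  refine ext_app fun T' f m ↦ ?_
  rw [← hs.sum_repr f m, map_sum, map_sum]
  refine Finset.sum_congr rfl fun j _ ↦ ?_
  rw [map_smul, map_smul, app_res' φ (𝟙 T), app_res' ψ (𝟙 T), h]

/-- The elementary homomorphism `s j ↦ s' k`. -/
def elem (hs : IsFrame s) (s' : ι' → Sec N' T) (j : ι) (k : ι') : LocHom N N' T where
  app f := ((hs.basis f).coord j).smulRight ((s' k).res f)
  app_res f g m := by
    simp only [LinearMap.smulRight_apply,
      Module.Basis.coord_apply, Sec.res_smul, Sec.res_res, hs.repr_res f g]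

lemma elem_app (hs : IsFrame s) (s' : ι' → Sec N' T) (j : ι) (k : ι') (f : T' ⟶ T)
    (m : Sec N T') : (elem hs s' j k).app f m = (hs.basis f).repr m j • (s' k).res f := rfl

lemma elem_apply [DecidableEq ι] (hs : IsFrame s) (s' : ι' → Sec N' T) (j : ι) (k : ι')
    (f : T' ⟶ T) (l : ι) : ((elem hs s' j k).res f).app (𝟙 T') ((s l).res f) =
      if j = l then (s' k).res f else 0 := by
  rw [res_app, elem_app, ← hs.basis_apply, Subsingleton.elim (𝟙 T' ≫ f) f, (hs.basis f).repr_self,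
    Finsupp.single_apply]
  split_ifs with h h' h'
  · rw [one_smul]
  · exact absurd h.symm h'
  · exact absurd h'.symm h
  · rw [zero_smul]

lemma sum_elem (hs : IsFrame s) (hs' : IsFrame s') (f : T' ⟶ T) (φ : LocHom N N' T') :
    φ = ∑ p : ι × ι', (hs'.basis f).repr (φ.app (𝟙 T') ((s p.1).res f)) p.2 •
      (elem hs s' p.1 p.2).res f := by
  classical
  refine ext_frame (hs.restrict f) fun j ↦ ?_
  let ev : LocHom N N' T' →ₗ[𝒪.sec T'.left] Sec N' T' :=
    { toFun := fun χ ↦ χ.app (𝟙 T') ((s j).res f)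
      map_add' := fun _ _ ↦ rfl
      map_smul' := fun c χ ↦ rfl }
  change ev φ = ev (∑ p : ι × ι', _)
  rw [map_sum, Fintype.sum_prod_type, Finset.sum_eq_single j]
  · refine (hs'.sum_repr f (ev φ)).symm.trans (Finset.sum_congr rfl fun k _ ↦ ?_)
    rw [map_smul]
    exact congrArg _ ((elem_apply hs s' j k f j).trans (if_pos rfl)).symm
  · intro j' _ hj
    refine Finset.sum_eq_zero fun k _ ↦ ?_
    rw [map_smul]
    refine (congrArg _ ((elem_apply hs s' j' k f j).trans (if_neg hj))).trans (smul_zero _)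
  · simp

lemma trace_app_eq (hs : IsFrame s) (φ : LocHom N N T) (f : T' ⟶ T) :
    LinearMap.trace (𝒪.sec T'.left) (Sec N T') (φ.app f) =
      ∑ j, (hs.basis f).repr (φ.app f ((s j).res f)) j := by
  classical
  rw [LinearMap.trace_eq_matrix_trace _ (hs.basis f), Matrix.trace]
  simp [LinearMap.toMatrix_apply]

lemma trace_app_res (hs : IsFrame s) (φ : LocHom N N T) (f : T' ⟶ T) (g : T'' ⟶ T') :
    𝒪.res g.left.le (LinearMap.trace (𝒪.sec T'.left) (Sec N T') (φ.app f)) =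
      LinearMap.trace (𝒪.sec T''.left) (Sec N T'') (φ.app (g ≫ f)) := by
  rw [trace_app_eq hs, trace_app_eq hs, map_sum]
  refine Finset.sum_congr rfl fun j _ ↦ ?_
  rw [← hs.repr_res f g (g ≫ f), ← app_res, Sec.res_res]

/-- Traces with respect to local frames agree on intersections, hence glue to a function. -/
lemma exists_trace (hN : IsLocallyFree N) (φ : LocHom N N T) : ∃ t : 𝒪.sec T.left,
    ∀ (T' : Over U) (f : T' ⟶ T) (r : ℕ) (s : Fin r → Sec N T') (_ : IsFrame s),
      𝒪.res f.left.le t = LinearMap.trace (𝒪.sec T'.left) (Sec N T') (φ.app f) := by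
  have h := fun x : T.left ↦ hN.exists_frame T x.2
  choose V hV hx r s hs using h
  -- traces over two sets with frames have the same values on the intersection
  have comp : ∀ (T' T'' : Over U) (f : T' ⟶ T) (g : T'' ⟶ T) (r r' : ℕ) (s : Fin r → Sec N T')
      (s' : Fin r' → Sec N T'') (_ : IsFrame s) (_ : IsFrame s') (x : M) (hx : x ∈ T'.left)
      (hx' : x ∈ T''.left), (LinearMap.trace (𝒪.sec T'.left) (Sec N T') (φ.app f)).1 ⟨x, hx⟩ =
        (LinearMap.trace (𝒪.sec T''.left) (Sec N T'') (φ.app g)).1 ⟨x, hx'⟩ := by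
    intro T' T'' f g r r' s s' hs hs' x hx hx'
    have h1 := trace_app_res hs (φ.res f) (𝟙 T') (overInfLeft T' T'')
    have h2 := trace_app_res hs' (φ.res g) (𝟙 T'') (overInfRight T' T'')
    simp only [res_app, Category.id_comp, Category.comp_id] at h1 h2
    rw [Subsingleton.elim (overInfRight T' T'' ≫ g) (overInfLeft T' T'' ≫ f)] at h2
    exact congrFun (congrArg Subtype.val (h1.trans h2.symm)) ⟨x, hx, hx'⟩
  obtain ⟨t, ht⟩ := 𝒪.exists_glue (U := T.left) (fun x ↦ (V x).left) (fun x ↦ (hV x).left.le)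
    (fun x hx' ↦ ⟨⟨x, hx'⟩, hx _⟩)
    (fun x ↦ LinearMap.trace (𝒪.sec (V x).left) (Sec N (V x)) (φ.app (hV x)))
    fun x y z hz hz' ↦ comp _ _ _ _ _ _ _ _ (hs x) (hs y) z hz hz'
  refine ⟨t, fun T' f r' s' hs' ↦ ?_⟩
  apply Subtype.ext
  funext z
  have hz : (z : M) ∈ T.left := f.left.le z.2
  rw [← comp _ _ (hV ⟨z, hz⟩) f _ _ _ _ (hs ⟨z, hz⟩) hs' z (hx ⟨z, hz⟩) z.2, ← ht]
  rfl

/-- The trace of an endomorphism of a locally free sheaf of modules. -/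
def trace (hN : IsLocallyFree N) (φ : LocHom N N T) : 𝒪.sec T.left := (exists_trace hN φ).choose

lemma res_trace_eq (hN : IsLocallyFree N) (φ : LocHom N N T) (f : T' ⟶ T) {r : ℕ}
    {s : Fin r → Sec N T'} (hs : IsFrame s) :
    𝒪.res f.left.le (trace hN φ) = LinearMap.trace (𝒪.sec T'.left) (Sec N T') (φ.app f) :=
  (exists_trace hN φ).choose_spec T' f r s hs

lemma trace_ext (hN : IsLocallyFree N) {t t' : 𝒪.sec T.left}
    (h : ∀ (T' : Over U) (f : T' ⟶ T) (r : ℕ) (s : Fin r → Sec N T') (_ : IsFrame s),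
      𝒪.res f.left.le t = 𝒪.res f.left.le t') : t = t' := by
  refine 𝒪.ext_locally fun x hx ↦ ?_
  obtain ⟨T', f, hx', r, s, hs⟩ := hN.exists_frame T hx
  exact ⟨T'.left, f.left.le, hx', h T' f r s hs⟩

lemma trace_res (hN : IsLocallyFree N) (φ : LocHom N N T) (g : T' ⟶ T) :
    𝒪.res g.left.le (trace hN φ) = trace hN (φ.res g) := by
  refine trace_ext hN fun T'' f r s hs ↦ ?_
  rw [res_trace_eq hN _ _ hs, FunctionSheaf.res_res]
  exact res_trace_eq hN φ (f ≫ g) hs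

lemma trace_add (hN : IsLocallyFree N) (φ ψ : LocHom N N T) :
    trace hN (φ + ψ) = trace hN φ + trace hN ψ := by
  refine trace_ext hN fun T'' f r s hs ↦ ?_
  rw [res_trace_eq hN _ f hs, map_add, res_trace_eq hN _ f hs, res_trace_eq hN _ f hs, add_app,
    map_add]

lemma trace_smul (hN : IsLocallyFree N) (c : 𝒪.sec T.left) (φ : LocHom N N T) :
    trace hN (c • φ) = c * trace hN φ := by
  refine trace_ext hN fun T'' f r s hs ↦ ?_
  rw [res_trace_eq hN _ f hs, map_mul, res_trace_eq hN _ f hs, smul_app, map_smul, smul_eq_mul]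

lemma trace_comm (hN : IsLocallyFree N) (hN' : IsLocallyFree N') (φ : LocHom N N' T)
    (ψ : LocHom N' N T) : trace hN (φ.comp ψ) = trace hN' (ψ.comp φ) := by
  refine 𝒪.ext_locally fun x hx ↦ ?_
  obtain ⟨T', f, hx', r, s, hs⟩ := hN.exists_frame T hx
  obtain ⟨T'', f', hx'', r', s', hs'⟩ := hN'.exists_frame T' hx'
  refine ⟨T''.left, f'.left.le.trans f.left.le, hx'', ?_⟩
  have h1 := res_trace_eq hN (φ.comp ψ) (f' ≫ f) (hs.restrict f')
  have h2 := res_trace_eq hN' (ψ.comp φ) (f' ≫ f) hs'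
  refine h1.trans (Eq.trans ?_ h2.symm)
  have := Module.Free.of_basis (hs.basis f')
  have := Module.Free.of_basis (hs'.basis (𝟙 _))
  have := Module.Finite.of_basis (hs.basis f')
  have := Module.Finite.of_basis (hs'.basis (𝟙 _))
  exact LinearMap.trace_comp_comm' _ _

lemma trace_eq_sum (hN : IsLocallyFree N) {r : ℕ} {s : Fin r → Sec N T} (hs : IsFrame s)
    (φ : LocHom N N T) (f : T' ⟶ T) : 𝒪.res f.left.le (trace hN φ) =
      ∑ j, (hs.basis f).repr (φ.app f ((s j).res f)) j := by
  rw [res_trace_eq hN φ f (hs.restrict f), trace_app_eq hs]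

/-- The trace pairing of a homomorphism with an elementary homomorphism. -/
lemma trace_comp_elem (hN' : IsLocallyFree N') {r : ℕ} {s : Fin r → Sec N T} (hs : IsFrame s)
    {r' : ℕ} {s' : Fin r' → Sec N' T} (hs' : IsFrame s') (j : Fin r) (k : Fin r') (f : T' ⟶ T)
    (φ : LocHom N N' T') :
    trace hN' (((elem hs' s k j).res f).comp φ) =
      (hs'.basis f).repr (φ.app (𝟙 T') ((s j).res f)) k := by
  have h := trace_eq_sum hN' (hs'.restrict f) (((elem hs' s k j).res f).comp φ) (𝟙 T')
  rw [FunctionSheaf.res_self] at h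
  rw [h, Finset.sum_eq_single k]
  · have e : ((hs'.restrict f).basis (𝟙 T')) = hs'.basis f := by
      ext j; simp [Sec.res_self]
    rw [e, comp_app, LinearMap.comp_apply, res_app, elem_app, Subsingleton.elim (𝟙 T' ≫ f) f,
      Sec.res_self, ← hs'.basis_apply, Module.Basis.repr_self]
    simp
  · intro l _ hl
    rw [comp_app, LinearMap.comp_apply, res_app, elem_app, Subsingleton.elim (𝟙 T' ≫ f) f,
      Sec.res_self, ← hs'.basis_apply, Module.Basis.repr_self]
    simp [hl]
  · simp

end LocHom

end Frames

end

end BraneFibration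

namespace BraneFibration

noncomputable section

/-! ### Coefficients with respect to a frame of idempotents -/

section IdempotentFrames

variable {M : Type u} [TopologicalSpace M] {𝒪 : FunctionSheaf M} {𝒯 : TangentMultiplication 𝒪}

namespace TangentMultiplication

instance (U : Opens M) : IsScalarTower (𝒪.sec U) (𝒯.Sec U) (𝒯.Sec U) :=
  ⟨fun f X Y ↦ 𝒯.smul_mul f X Y⟩

instance (U : Opens M) : SMulCommClass (𝒪.sec U) (𝒯.Sec U) (𝒯.Sec U) :=
  ⟨fun f X Y ↦ (𝒯.mul_smul f X Y).symm⟩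

lemma res_smul {U V : Opens M} (h : V ≤ U) (f : 𝒪.sec U) (X : 𝒯.Sec U) :
    𝒯.res h (f • X) = 𝒪.res h f • 𝒯.res h X := rfl

lemma res_res {U V W : Opens M} (h : V ≤ U) (h' : W ≤ V) (X : 𝒯.Sec U) :
    𝒯.res h' (𝒯.res h X) = 𝒯.res (h'.trans h) X := rfl

namespace IsIdempotentFrame

variable {n : ℕ} {U V W : Opens M} {e : Fin n → 𝒯.Sec U} (he : 𝒯.IsIdempotentFrame e)

include he

lemma restrict (h : V ≤ U) : 𝒯.IsIdempotentFrame fun i ↦ 𝒯.res h (e i) where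
  mul_eq i j := by
    rw [← map_mul, he.mul_eq]
    split_ifs
    · rfl
    · exact map_zero _
  existsUnique_coeff h' X := he.existsUnique_coeff (h'.trans h) X

/-- The coefficients of a vector field with respect to a frame of idempotents. -/
def coeff (h : V ≤ U) (X : 𝒯.Sec V) : Fin n → 𝒪.sec V := (he.existsUnique_coeff h X).choose

lemma sum_coeff (h : V ≤ U) (X : 𝒯.Sec V) : ∑ i, he.coeff h X i • 𝒯.res h (e i) = X :=
  (he.existsUnique_coeff h X).choose_spec.1.symm

lemma coeff_eq (h : V ≤ U) {X : 𝒯.Sec V} {f : Fin n → 𝒪.sec V}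
    (hX : X = ∑ i, f i • 𝒯.res h (e i)) : he.coeff h X = f :=
  (he.existsUnique_coeff h X).unique (he.sum_coeff h X).symm hX

lemma coeff_add (h : V ≤ U) (X Y : 𝒯.Sec V) :
    he.coeff h (X + Y) = he.coeff h X + he.coeff h Y := by
  refine he.coeff_eq h ?_
  simp only [Pi.add_apply, add_smul, Finset.sum_add_distrib, he.sum_coeff]

lemma coeff_smul (h : V ≤ U) (f : 𝒪.sec V) (X : 𝒯.Sec V) :
    he.coeff h (f • X) = f • he.coeff h X := by
  refine he.coeff_eq h ?_
  simp only [Pi.smul_apply, smul_assoc, ← Finset.smul_sum, he.sum_coeff]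

lemma coeff_res (h : V ≤ U) (h' : W ≤ V) (X : 𝒯.Sec V) (i : Fin n) :
    he.coeff (h'.trans h) (𝒯.res h' X) i = 𝒪.res h' (he.coeff h X i) := by
  refine congrFun (he.coeff_eq (h'.trans h) (f := fun i ↦ 𝒪.res h' (he.coeff h X i)) ?_) i
  conv_lhs => rw [← he.sum_coeff h X]
  rw [map_sum]
  rfl

lemma coeff_self (h : V ≤ U) (k i : Fin n) :
    he.coeff h (𝒯.res h (e k)) i = if k = i then 1 else 0 := by
  refine congrFun (he.coeff_eq h (f := fun i ↦ if k = i then 1 else 0) ?_) i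
  simp

lemma mul_self (h : V ≤ U) (i : Fin n) :
    𝒯.res h (e i) * 𝒯.res h (e i) = 𝒯.res h (e i) := by
  rw [← map_mul, he.mul_eq, if_pos rfl]

lemma mul_of_ne (h : V ≤ U) {i j : Fin n} (hij : i ≠ j) :
    𝒯.res h (e i) * 𝒯.res h (e j) = 0 := by
  rw [← map_mul, he.mul_eq, if_neg hij, map_zero]

lemma mul_eq_smul (h : V ≤ U) (X : 𝒯.Sec V) (k : Fin n) :
    X * 𝒯.res h (e k) = he.coeff h X k • 𝒯.res h (e k) := by
  conv_lhs => rw [← he.sum_coeff h X]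
  rw [Finset.sum_mul, Finset.sum_eq_single k]
  · rw [smul_mul_assoc, he.mul_self]
  · intro j _ hj
    rw [smul_mul_assoc, he.mul_of_ne h hj, smul_zero]
  · simp

lemma coeff_mul (h : V ≤ U) (X Y : 𝒯.Sec V) (i : Fin n) :
    he.coeff h (X * Y) i = he.coeff h X i * he.coeff h Y i := by
  refine congrFun (he.coeff_eq h (f := fun i ↦ he.coeff h X i * he.coeff h Y i) ?_) i
  conv_lhs => rw [← he.sum_coeff h Y]
  rw [Finset.mul_sum]
  refine Finset.sum_congr rfl fun k _ ↦ ?_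
  rw [mul_smul_comm, he.mul_eq_smul, smul_smul, mul_comm]

lemma coeff_one (h : V ≤ U) (i : Fin n) : he.coeff h 1 i = 1 := by
  have := he.coeff_mul h 1 (𝒯.res h (e i)) i
  rw [one_mul, he.coeff_self, if_pos rfl, mul_one] at this
  exact this.symm

lemma sum_eq_one (h : V ≤ U) : ∑ i, 𝒯.res h (e i) = 1 := by
  refine Eq.trans ?_ (he.sum_coeff h 1)
  simp [he.coeff_one]

lemma coeff_sum (h : V ≤ U) (f : Fin n → 𝒪.sec V) :
    he.coeff h (∑ i, f i • 𝒯.res h (e i)) = f := he.coeff_eq h rfl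

end IsIdempotentFrame

end TangentMultiplication

namespace InvariantMetric

variable (η : InvariantMetric 𝒯) {U V : Opens M}

lemma trace_add (X Y : 𝒯.Sec U) : η.trace (X + Y) = η.trace X + η.trace Y := by
  simp only [InvariantMetric.trace, η.g_symm 1, η.g_add]

lemma trace_smul (f : 𝒪.sec U) (X : 𝒯.Sec U) : η.trace (f • X) = f * η.trace X := by
  simp only [InvariantMetric.trace, η.g_symm 1, η.g_smul]

lemma trace_sum {ι : Type*} (a : Finset ι) (X : ι → 𝒯.Sec U) :
    η.trace (∑ i ∈ a, X i) = ∑ i ∈ a, η.trace (X i) :=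
  map_sum (AddMonoidHom.mk' η.trace η.trace_add) X a

lemma trace_res (h : V ≤ U) (X : 𝒯.Sec U) : η.trace (𝒯.res h X) = 𝒪.res h (η.trace X) := by
  rw [InvariantMetric.trace, InvariantMetric.trace, η.g_res, map_one]

lemma g_eq_trace (X Y : 𝒯.Sec U) : η.g X Y = η.trace (X * Y) := by
  rw [InvariantMetric.trace, ← η.g_mul, one_mul]

lemma trace_mul_idempotent {n : ℕ} {e : Fin n → 𝒯.Sec U} (he : 𝒯.IsIdempotentFrame e) (h : V ≤ U)
    (X : 𝒯.Sec V) (k : Fin n) :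
    η.trace (X * 𝒯.res h (e k)) = he.coeff h X k * 𝒪.res h (η.trace (e k)) := by
  rw [he.mul_eq_smul, η.trace_smul, η.trace_res]

end InvariantMetric

/-- A frame of orthogonal idempotents over `U` together with square roots of the functions
`θ(eᵢ)`, which are invertible. -/
structure RootedFrame (η : InvariantMetric 𝒯) (n : ℕ) (U : Opens M) where
  /-- the idempotents -/
  e : Fin n → 𝒯.Sec U
  frame : 𝒯.IsIdempotentFrame e
  /-- the square roots of `θ(eᵢ)` -/
  root : Fin n → 𝒪.sec U
  /-- their inverses -/
  rootInv : Fin n → 𝒪.sec U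
  root_mul_inv (i : Fin n) : root i * rootInv i = 1
  root_sq (i : Fin n) : root i * root i = η.trace (e i)

end IdempotentFrames

/-! ### The Cardy category of families of locally free modules -/

section Standard

variable {M : Type u} [TopologicalSpace M] {𝒪 : FunctionSheaf M} {U : Opens M}

/-- Products of systems of sections. -/
def SectionSystem.pi {R : Sheaf ((Opens.grothendieckTopology M).over U) RingCat.{u}} {κ : Type}
    {A : κ → Over U → Type u} [∀ i T, AddCommGroup (A i T)]
    [∀ i T, Module (R.obj.obj (op T)) (A i T)] (D : ∀ i, SectionSystem R (A i)) :
    SectionSystem R (fun T ↦ ∀ i, A i T) where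
  res f := AddMonoidHom.mk' (fun s i ↦ (D i).res f (s i)) fun s t ↦ by ext i; simp
  res_id T s := by ext i; exact (D i).res_id T (s i)
  res_comp f g s := by ext i; exact (D i).res_comp f g (s i)
  res_smul f r s := by ext i; exact (D i).res_smul f r (s i)
  sep s s' h := by
    ext i
    refine (D i).sep _ _ fun x hx ↦ ?_
    obtain ⟨T', f, hx', e⟩ := h x hx
    exact ⟨T', f, hx', congrFun e i⟩
  glue T' f hT s hs := by
    have := fun i ↦ (D i).glue T' f hT (fun j ↦ s j i) fun j j' W g g' ↦ congrFun (hs j j' W g g') i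
    choose t ht using this
    exact ⟨t, fun j ↦ by ext i; exact ht i j⟩

variable {n : ℕ} (N N' N'' N''' : Fin n → LF 𝒪 U)

/-- The sections over `T` of the sheaf of homomorphisms between families of modules. -/
abbrev StdSec (T : Over U) : Type u := ∀ i, LocHom (N i).obj (N' i).obj T

/-- The sheaf of homomorphisms between families of modules. -/
def stdHom : SheafOfModules.{u} (𝒪.sheaf.over U) :=
  (SectionSystem.pi fun i ↦ LocHom.system (N i).obj (N' i).obj).sheaf

namespace StdSec

variable {N N' N'' N'''} {T T' : Over U}

/-- Restriction, componentwise. -/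
def res (f : T' ⟶ T) (φ : StdSec N N' T) : StdSec N N' T' := fun i ↦ (φ i).res f

/-- Composition, componentwise. -/
def comp (φ : StdSec N N' T) (ψ : StdSec N' N'' T) : StdSec N N'' T := fun i ↦ (φ i).comp (ψ i)

/-- The sum of the traces of the components, weighted by the functions `v i`. -/
def trace (v : Fin n → 𝒪.sec U) (φ : StdSec N N T) : 𝒪.sec T.left :=
  ∑ i, 𝒪.res T.hom.le (v i) * LocHom.trace (N i).property (φ i)

lemma trace_res (v : Fin n → 𝒪.sec U) (f : T' ⟶ T) (φ : StdSec N N T) :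
    𝒪.res f.left.le (trace v φ) = trace v (φ.res f) := by
  rw [trace, map_sum]
  refine Finset.sum_congr rfl fun i _ ↦ ?_
  rw [map_mul, LocHom.trace_res]
  rfl

lemma trace_add (v : Fin n → 𝒪.sec U) (φ ψ : StdSec N N T) :
    trace v (φ + ψ) = trace v φ + trace v ψ := by
  simp only [trace, Pi.add_apply, LocHom.trace_add, mul_add, Finset.sum_add_distrib]

lemma trace_smul (v : Fin n → 𝒪.sec U) (c : 𝒪.sec T.left) (φ : StdSec N N T) :
    trace v (c • φ) = c * trace v φ := by
  simp only [trace, Pi.smul_apply, LocHom.trace_smul, Finset.mul_sum]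
  exact Finset.sum_congr rfl fun i _ ↦ by ring

lemma trace_comm (v : Fin n → 𝒪.sec U) (φ : StdSec N N' T) (ψ : StdSec N' N T) :
    trace v (φ.comp ψ) = trace v (ψ.comp φ) :=
  Finset.sum_congr rfl fun i _ ↦ congrArg _ (LocHom.trace_comm _ _ _ _)

lemma add_comp (φ φ' : StdSec N N' T) (ψ : StdSec N' N'' T) :
    (φ + φ').comp ψ = φ.comp ψ + φ'.comp ψ := by
  funext i; ext T' f m
  exact map_add ((ψ i).app f) _ _

lemma comp_add (φ : StdSec N N' T) (ψ ψ' : StdSec N' N'' T) :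
    φ.comp (ψ + ψ') = φ.comp ψ + φ.comp ψ' := rfl

lemma smul_comp (c : 𝒪.sec T.left) (φ : StdSec N N' T) (ψ : StdSec N' N'' T) :
    comp (c • φ) ψ = c • φ.comp ψ := by
  funext i; ext T' f m
  exact map_smul ((ψ i).app f) _ _

lemma comp_smul (c : 𝒪.sec T.left) (φ : StdSec N N' T) (ψ : StdSec N' N'' T) :
    φ.comp (c • ψ) = c • φ.comp ψ := rfl

/-- Composition as a bilinear map. -/
def compₗ (N N' N'' : Fin n → LF 𝒪 U) (T : Over U) :
    StdSec N N' T →ₗ[𝒪.sec T.left] StdSec N' N'' T →ₗ[𝒪.sec T.left] StdSec N N'' T :=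
  LinearMap.mk₂ _ comp add_comp smul_comp comp_add comp_smul

/-- The trace as a linear map. -/
def traceₗ (v : Fin n → 𝒪.sec U) (N : Fin n → LF 𝒪 U) (T : Over U) :
    StdSec N N T →ₗ[𝒪.sec T.left] 𝒪.sec T.left where
  toFun := trace v
  map_add' := trace_add v
  map_smul' := trace_smul v

section Elementary

variable {r r' : Fin n → ℕ} {s : ∀ i, Fin (r i) → Sec (N i).obj T}
  {s' : ∀ i, Fin (r' i) → Sec (N' i).obj T} (hs : ∀ i, IsFrame (s i)) (hs' : ∀ i, IsFrame (s' i))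

variable (s') in
/-- The elementary homomorphisms. -/
def elem (p : Σ i, Fin (r i) × Fin (r' i)) : StdSec N N' T :=
  Pi.single p.1 (LocHom.elem (hs p.1) (s' p.1) p.2.1 p.2.2)

variable (s) in
/-- The family dual to the elementary homomorphisms, `w` being inverse to the weights. -/
def dual (w : Fin n → 𝒪.sec U) (p : Σ i, Fin (r i) × Fin (r' i)) : StdSec N' N T :=
  Pi.single p.1 (𝒪.res T.hom.le (w p.1) • LocHom.elem (hs' p.1) (s p.1) p.2.2 p.2.1)

include hs in
lemma trace_dual_comp {v w : Fin n → 𝒪.sec U} (hvw : ∀ i, v i * w i = 1)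
    (p : Σ i, Fin (r i) × Fin (r' i)) (f : T' ⟶ T) (φ : StdSec N N' T') :
    trace v (comp (res f (dual s hs' w p)) φ) = ((hs' p.1).basis f).repr
      ((φ p.1).app (𝟙 T') ((s p.1 p.2.1).res f)) p.2.2 := by
  rw [trace, Finset.sum_eq_single p.1]
  · have e : (comp (res f (dual s hs' w p)) φ) p.1 = 𝒪.res T'.hom.le (w p.1) •
        ((LocHom.elem (hs' p.1) (s p.1) p.2.2 p.2.1).res f).comp (φ p.1) := by
      simp only [comp, res, dual, Pi.single_eq_same]
      ext T'' g m
      exact map_smul ((φ p.1).app g) _ _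
    rw [e, LocHom.trace_smul, ← mul_assoc, ← map_mul, hvw, map_one, one_mul,
      LocHom.trace_comp_elem _ (hs p.1)]
  · intro i _ hi
    have e : (comp (res f (dual s hs' w p)) φ) i = (0 : 𝒪.sec T'.left) • 0 := by
      simp only [comp, res, dual, Pi.single_eq_of_ne hi]
      ext T'' g m
      simp
    rw [e, LocHom.trace_smul, zero_mul, mul_zero]
  · simp

lemma expand {v w : Fin n → 𝒪.sec U} (hvw : ∀ i, v i * w i = 1) (f : T' ⟶ T)
    (φ : StdSec N N' T') :
    φ = ∑ p, trace v (comp (res f (dual s hs' w p)) φ) • res f (elem s' hs p) := by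
  funext i
  rw [Finset.sum_apply, Fintype.sum_sigma, Finset.sum_eq_single i]
  · refine (LocHom.sum_elem (hs i) (hs' i) f (φ i)).trans (Finset.sum_congr rfl fun p _ ↦ ?_)
    rw [Pi.smul_apply, trace_dual_comp hs hs' hvw]
    simp [res, elem]
  · intro j _ hj
    refine Finset.sum_eq_zero fun p _ ↦ ?_
    rw [Pi.smul_apply]
    have : res f (elem s' hs ⟨j, p⟩) i = 0 := by
      simp only [res, elem, Pi.single_eq_of_ne hj.symm]
      rfl
    rw [this, smul_zero]
  · simp

lemma trace_dual_elem {v w : Fin n → 𝒪.sec U} (hvw : ∀ i, v i * w i = 1) (f : T' ⟶ T)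
    (p q : Σ i, Fin (r i) × Fin (r' i)) :
    trace v (comp (res f (dual s hs' w p)) (res f (elem s' hs q))) = if p = q then 1 else 0 := by
  classical
  rw [trace_dual_comp hs hs' hvw]
  obtain ⟨i, j, k⟩ := p
  obtain ⟨i', j', k'⟩ := q
  by_cases h : i = i'
  · subst h
    simp only [res, elem, Pi.single_eq_same, LocHom.elem_apply]
    by_cases hj : j' = j
    · subst hj
      rw [if_pos rfl, ← (hs' i).basis_apply, Module.Basis.repr_self, Finsupp.single_apply]
      simp [eq_comm]
    · simp [hj, Ne.symm hj]
  · simp only [res, elem, Pi.single_eq_of_ne h]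
    simp [h]

/-- The Cardy condition for the basis of elementary homomorphisms. -/
lemma sum_dual_comp_elem (w : Fin n → 𝒪.sec U) (σ : StdSec N N T) :
    ∑ p, comp (comp (dual s hs' w p) σ) (elem s' hs p) =
      fun i ↦ (𝒪.res T.hom.le (w i) * LocHom.trace (N i).property (σ i)) •
        LocHom.id (N' i).obj T := by
  classical
  funext i
  refine LocHom.ext_frame (hs' i) fun k ↦ ?_
  -- both sides are evaluated at a member of the frame of `N' i`
  let ev : StdSec N' N' T →+ Sec (N' i).obj T :=
    AddMonoidHom.mk' (fun χ ↦ (χ i).app (𝟙 T) (s' i k)) fun _ _ ↦ rfl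
  have h1 : ∀ p : Σ i, Fin (r i) × Fin (r' i), p.1 ≠ i →
      ev (comp (comp (dual s hs' w p) σ) (elem s' hs p)) = 0 := by
    intro p hp
    simp only [ev, AddMonoidHom.mk'_apply, comp, LocHom.comp_app, LinearMap.comp_apply, elem,
      Pi.single_eq_of_ne hp.symm, LocHom.zero_app, LinearMap.zero_apply]
  have h2 : ∀ (j : Fin (r i)) (k' : Fin (r' i)),
      ev (comp (comp (dual s hs' w ⟨i, j, k'⟩) σ) (elem s' hs ⟨i, j, k'⟩)) =
        if k' = k then 𝒪.res T.hom.le (w i) • (((hs i).basis (𝟙 T)).repr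
          ((σ i).app (𝟙 T) (s i j)) j • s' i k) else 0 := by
    intro j k'
    have e := LocHom.elem_apply (hs' i) (s i) k' j (𝟙 T) k
    simp only [LocHom.res_app, Sec.res_id, Category.id_comp] at e
    simp only [ev, AddMonoidHom.mk'_apply, comp, LocHom.comp_app, LinearMap.comp_apply, elem,
      dual, Pi.single_eq_same, LocHom.smul_app, LinearMap.smul_apply, e, map_smul]
    split_ifs with hk
    · subst hk
      rw [LocHom.elem_app, Sec.res_id]
      rfl
    · simp
  change ev (∑ p, _) = _
  rw [map_sum, Fintype.sum_sigma, Finset.sum_eq_single i (fun j _ hj ↦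
    Finset.sum_eq_zero fun p _ ↦ h1 ⟨j, p⟩ hj) (by simp), Fintype.sum_prod_type]
  simp only [h2, Finset.sum_ite_eq', Finset.mem_univ, if_true]
  have h3 := LocHom.trace_eq_sum (N i).property (hs i) (σ i) (𝟙 T)
  simp only [Sec.res_id] at h3
  rw [← Finset.smul_sum, ← Finset.sum_smul, ← h3, smul_smul]
  rfl

end Elementary

end StdSec

end Standard

end

end BraneFibration

namespace BraneFibration

noncomputable section

/-! ### Dual bases in Calabi-Yau categories -/

section CalabiYau

/-- The Casimir element of a perfect pairing does not depend on the choice of dual bases. -/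
lemma casimir_eq {R P Q W ι κ : Type*} [Fintype ι] [Fintype κ] [CommRing R] [AddCommGroup P]
    [AddCommGroup Q] [AddCommGroup W] [Module R P] [Module R Q] [Module R W]
    (β : Q → P → R) (γ : Q →ₗ[R] P →ₗ[R] W) {s : ι → P} {t : ι → Q} {s' : κ → P} {t' : κ → Q}
    (h : ∀ m, m = ∑ k, β (t' k) m • s' k) (h' : ∀ q, q = ∑ j, β q (s j) • t j) :
    ∑ j, γ (t j) (s j) = ∑ k, γ (t' k) (s' k) := by
  calc ∑ j, γ (t j) (s j) = ∑ j, ∑ k, β (t' k) (s j) • γ (t j) (s' k) := by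
        refine Finset.sum_congr rfl fun j _ ↦ ?_
        conv_lhs => rw [h (s j)]
        simp
    _ = ∑ k, ∑ j, β (t' k) (s j) • γ (t j) (s' k) := Finset.sum_comm
    _ = ∑ k, γ (t' k) (s' k) := by
        refine Finset.sum_congr rfl fun k _ ↦ ?_
        conv_rhs => rw [h' (t' k)]
        simp

variable {M : Type u} [TopologicalSpace M] {𝒪 : FunctionSheaf M} {U : Opens M}

namespace CYCategory

variable (𝒞 : CYCategory 𝒪 U) {a b c : 𝒞.Obj} {T T' : Over U}

/-- Composition as a bilinear map. -/
def compₗ (a b c : 𝒞.Obj) (T : Over U) : Sec (𝒞.Hom a b) T →ₗ[𝒪.sec T.left]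
    Sec (𝒞.Hom b c) T →ₗ[𝒪.sec T.left] Sec (𝒞.Hom a c) T :=
  LinearMap.mk₂ _ 𝒞.comp 𝒞.add_comp 𝒞.smul_comp 𝒞.comp_add 𝒞.comp_smul

/-- The trace as a linear map. -/
def traceₗ (a : 𝒞.Obj) (T : Over U) : Sec (𝒞.Hom a a) T →ₗ[𝒪.sec T.left] 𝒪.sec T.left where
  toFun := 𝒞.trace
  map_add' := 𝒞.trace_add
  map_smul' := 𝒞.trace_smul

lemma comp_zero (σ : Sec (𝒞.Hom a b) T) : 𝒞.comp σ (0 : Sec (𝒞.Hom b c) T) = 0 :=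
  (𝒞.compₗ a b c T σ).map_zero

lemma zero_comp (τ : Sec (𝒞.Hom b c) T) : 𝒞.comp (0 : Sec (𝒞.Hom a b) T) τ = 0 :=
  (𝒞.compₗ a b c T).map_zero₂ τ

lemma comp_sum {κ : Type*} (I : Finset κ) (σ : Sec (𝒞.Hom a b) T) (τ : κ → Sec (𝒞.Hom b c) T) :
    𝒞.comp σ (∑ i ∈ I, τ i) = ∑ i ∈ I, 𝒞.comp σ (τ i) :=
  map_sum (𝒞.compₗ a b c T σ) τ I

lemma sum_comp {κ : Type*} (I : Finset κ) (σ : κ → Sec (𝒞.Hom a b) T) (τ : Sec (𝒞.Hom b c) T) :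
    𝒞.comp (∑ i ∈ I, σ i) τ = ∑ i ∈ I, 𝒞.comp (σ i) τ :=
  (𝒞.compₗ a b c T).map_sum₂ I σ τ

lemma trace_sum {κ : Type*} (I : Finset κ) (σ : κ → Sec (𝒞.Hom a a) T) :
    𝒞.trace (∑ i ∈ I, σ i) = ∑ i ∈ I, 𝒞.trace (σ i) := map_sum (𝒞.traceₗ a T) σ I

lemma trace_zero : 𝒞.trace (0 : Sec (𝒞.Hom a a) T) = 0 := (𝒞.traceₗ a T).map_zero

/-- The trace pairing is nondegenerate. -/
lemma eq_of_trace_eq {σ σ' : Sec (𝒞.Hom a b) T} (h : ∀ (T' : Over U) (f : T' ⟶ T)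
    (τ : Sec (𝒞.Hom b a) T'), 𝒞.trace (𝒞.comp (σ.res f) τ) = 𝒞.trace (𝒞.comp (σ'.res f) τ)) :
    σ = σ' := by
  refine Sec.ext_locally fun x hx ↦ ?_
  obtain ⟨T₁, hx₁, h₁⟩ := 𝒞.perfect a b x (T.hom.le hx)
  refine ⟨overInf T T₁, overInfLeft _ _, mem_overInf hx hx₁, ?_⟩
  exact (h₁ _ (overInfRight T T₁) (𝒞.traceₗ a _ ∘ₗ
    𝒞.compₗ a b a (overInf T T₁) (σ.res (overInfLeft T T₁)))).unique (fun τ ↦ rfl)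
      (fun τ ↦ (h _ _ τ).symm)

/-- A frame determines sections up to the trace pairing. -/
lemma eq_of_trace_frame_eq {ι : Type*} [Fintype ι] {s : ι → Sec (𝒞.Hom a b) T} (hs : IsFrame s)
    {q q' : Sec (𝒞.Hom b a) T}
    (h : ∀ j, 𝒞.trace (𝒞.comp q (s j)) = 𝒞.trace (𝒞.comp q' (s j))) : q = q' := by
  refine 𝒞.eq_of_trace_eq fun T' f τ ↦ ?_
  rw [← hs.sum_repr f τ, 𝒞.comp_sum, 𝒞.comp_sum, 𝒞.trace_sum, 𝒞.trace_sum]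
  refine Finset.sum_congr rfl fun j _ ↦ ?_
  rw [𝒞.comp_smul, 𝒞.comp_smul, 𝒞.trace_smul, 𝒞.trace_smul, ← 𝒞.comp_res, ← 𝒞.comp_res,
    ← 𝒞.trace_res, ← 𝒞.trace_res, h]

/-- The expansion of a section with respect to a dual basis. -/
lemma dual_expand {ι : Type*} [Fintype ι] [DecidableEq ι] {s : ι → Sec (𝒞.Hom a b) T}
    {t : ι → Sec (𝒞.Hom b a) T} (hs : IsFrame s)
    (hst : ∀ i j, 𝒞.trace (𝒞.comp (t j) (s i)) = if i = j then 1 else 0)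
    (q : Sec (𝒞.Hom b a) T) : q = ∑ j, 𝒞.trace (𝒞.comp q (s j)) • t j := by
  refine 𝒞.eq_of_trace_frame_eq hs fun i ↦ ?_
  rw [𝒞.sum_comp, 𝒞.trace_sum]
  simp [𝒞.smul_comp, 𝒞.trace_smul, hst]

lemma dual_res {ι : Type*} [DecidableEq ι] {s : ι → Sec (𝒞.Hom a b) T}
    {t : ι → Sec (𝒞.Hom b a) T}
    (hst : ∀ i j, 𝒞.trace (𝒞.comp (t j) (s i)) = if i = j then 1 else 0) (f : T' ⟶ T) (i j : ι) :
    𝒞.trace (𝒞.comp ((t j).res f) ((s i).res f)) = if i = j then 1 else 0 := by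
  rw [← 𝒞.comp_res, ← 𝒞.trace_res, hst]
  split_ifs
  · exact map_one _
  · exact map_zero _

/-- Locally, each frame has a dual one. -/
lemma exists_dual {ι : Type*} [Fintype ι] [DecidableEq ι] {s : ι → Sec (𝒞.Hom a b) T}
    (hs : IsFrame s) {x : M} (hx : x ∈ T.left) : ∃ (T' : Over U) (f : T' ⟶ T), x ∈ T'.left ∧
      ∃ t : ι → Sec (𝒞.Hom b a) T',
        ∀ i j, 𝒞.trace (𝒞.comp (t j) ((s i).res f)) = if i = j then 1 else 0 := by
  obtain ⟨T₁, hx₁, h₁⟩ := 𝒞.perfect b a x (T.hom.le hx)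
  refine ⟨overInf T T₁, overInfLeft _ _, mem_overInf hx hx₁, ?_⟩
  choose t ht using fun j ↦ (h₁ _ (overInfRight T T₁)
    ((hs.basis (overInfLeft T T₁)).coord j)).exists
  refine ⟨t, fun i j ↦ ?_⟩
  rw [ht, ← hs.basis_apply, Module.Basis.coord_apply, Module.Basis.repr_self, Finsupp.single_apply]

end CYCategory

end CalabiYau

/-! ### The standard Cardy category -/

section Standard

variable {M : Type u} [TopologicalSpace M] {𝒪 : FunctionSheaf M} {U : Opens M} {n : ℕ}

lemma std_isFrame {N N' : Fin n → LF 𝒪 U} {v w : Fin n → 𝒪.sec U} (hvw : ∀ i, v i * w i = 1)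
    {T : Over U} {r r' : Fin n → ℕ} {s : ∀ i, Fin (r i) → Sec (N i).obj T}
    {s' : ∀ i, Fin (r' i) → Sec (N' i).obj T} (hs : ∀ i, IsFrame (s i))
    (hs' : ∀ i, IsFrame (s' i)) : IsFrame (N := stdHom N N') (StdSec.elem s' hs) := by
  intro T' f m
  refine ⟨fun p ↦ StdSec.trace v (StdSec.comp (StdSec.res f (StdSec.dual s hs' w p)) m),
    StdSec.expand hs hs' hvw f m, fun c hc ↦ ?_⟩
  funext p
  have h1 := congrArg (fun m' : StdSec N N' T' ↦
    StdSec.traceₗ v N' T' (StdSec.compₗ N' N N' T' (StdSec.res f (StdSec.dual s hs' w p)) m')) hc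
  refine Eq.trans ?_ h1.symm
  change _ = StdSec.traceₗ v N' T' (StdSec.compₗ N' N N' T' (StdSec.res f (StdSec.dual s hs' w p))
    (∑ j, c j • (StdSec.res f (StdSec.elem s' hs j) : StdSec N N' T')))
  rw [map_sum, map_sum]
  have h2 : ∀ q, StdSec.traceₗ v N' T' (StdSec.compₗ N' N N' T'
      (StdSec.res f (StdSec.dual s hs' w p)) (c q • (StdSec.res f (StdSec.elem s' hs q)))) =
        c q * if p = q then 1 else 0 := fun q ↦ by
    rw [map_smul, map_smul, smul_eq_mul]
    exact congrArg _ (StdSec.trace_dual_elem hs hs' hvw f p q)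
  simp only [h2]
  simp

/-- Around each point there are frames of all members of a family of locally free modules. -/
lemma exists_frames (N : Fin n → LF 𝒪 U) (T : Over U) {x : M} (hx : x ∈ T.left) :
    ∃ (T' : Over U) (_ : T' ⟶ T), x ∈ T'.left ∧
      ∃ (r : Fin n → ℕ) (s : ∀ i, Fin (r i) → Sec (N i).obj T'), ∀ i, IsFrame (s i) := by
  have h := fun i ↦ (N i).property.exists_frame T hx
  choose V f hV r s hs using h
  let W : Opens M := T.left ⊓ Finset.univ.inf fun i ↦ (V i).left
  have hW : ∀ i, W ≤ (V i).left := fun i ↦ inf_le_right.trans (Finset.inf_le (Finset.mem_univ i))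
  refine ⟨overMk T W inf_le_left, overHom inf_le_left, ⟨hx, ?_⟩, r,
    fun i j ↦ (s i j).res (overHom (hW i)), fun i ↦ (hs i).restrict _⟩
  have : x ∈ Finset.univ.inf fun i ↦ (V i).left := by
    rw [← SetLike.mem_coe, Opens.coe_finset_inf]
    simpa using hV
  exact this

/-- The weighted trace pairing is perfect where frames exist. -/
lemma StdSec.existsUnique_trace_comp {N N' : Fin n → LF 𝒪 U} {v w : Fin n → 𝒪.sec U}
    (hvw : ∀ i, v i * w i = 1) {T T' : Over U} {r r' : Fin n → ℕ}
    {s : ∀ i, Fin (r i) → Sec (N i).obj T} {s' : ∀ i, Fin (r' i) → Sec (N' i).obj T}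
    (hs : ∀ i, IsFrame (s i)) (hs' : ∀ i, IsFrame (s' i)) (g : T' ⟶ T)
    (ℓ : StdSec N' N T' →ₗ[𝒪.sec T'.left] 𝒪.sec T'.left) :
    ∃! σ : StdSec N N' T', ∀ τ, StdSec.trace v (StdSec.comp σ τ) = ℓ τ := by
  -- the section representing `ℓ` is `∑ₚ ℓ(Eₚ) Dₚ`, where `Dₚ` is dual to the frame `Eₚ`
  let σ₀ : StdSec N N' T' := ∑ p, ℓ (StdSec.res g (StdSec.elem s hs' p)) •
    StdSec.res g (StdSec.dual s' hs w p)
  have h₀ : ∀ τ, StdSec.trace v (StdSec.comp σ₀ τ) = ℓ τ := by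
    intro τ
    change StdSec.traceₗ v N T' (StdSec.compₗ N N' N T' σ₀ τ) = ℓ τ
    have h1 := congrArg ℓ (StdSec.expand hs' hs hvw g τ)
    rw [map_sum] at h1
    rw [h1, map_sum, LinearMap.sum_apply, map_sum]
    refine Finset.sum_congr rfl fun p _ ↦ ?_
    rw [map_smul, LinearMap.smul_apply, map_smul, map_smul, smul_eq_mul, smul_eq_mul, mul_comm]
    rfl
  refine ⟨σ₀, h₀, fun σ hσ ↦ ?_⟩
  rw [StdSec.expand hs hs' hvw g σ, StdSec.expand hs hs' hvw g σ₀]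
  refine Finset.sum_congr rfl fun q _ ↦ ?_
  rw [StdSec.trace_comm, hσ, StdSec.trace_comm, h₀]

/-- The Calabi-Yau category of families of locally free modules, with traces weighted by invertible
functions `v i`. -/
def stdCategory (v w : Fin n → 𝒪.sec U) (hvw : ∀ i, v i * w i = 1) : CYCategory 𝒪 U where
  Obj := Fin n → LF 𝒪 U
  Hom := stdHom
  id N T := (fun i ↦ LocHom.id (N i).obj T : StdSec N N T)
  comp {N N' N'' T} (φ : StdSec N N' T) (ψ : StdSec N' N'' T) := StdSec.comp φ ψ
  id_res _ _ _ _ := rfl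
  comp_res _ _ _ := rfl
  add_comp {N N' N'' T} (φ φ' : StdSec N N' T) (ψ : StdSec N' N'' T) := StdSec.add_comp φ φ' ψ
  comp_add _ _ _ := rfl
  smul_comp {N N' N'' T} c (φ : StdSec N N' T) (ψ : StdSec N' N'' T) := StdSec.smul_comp c φ ψ
  comp_smul _ _ _ := rfl
  id_comp _ := rfl
  comp_id _ := rfl
  assoc _ _ _ := rfl
  trace {N T} (φ : StdSec N N T) := StdSec.trace v φ
  trace_res {N T T'} f (φ : StdSec N N T) := StdSec.trace_res v f φ
  trace_add {N T} (φ ψ : StdSec N N T) := StdSec.trace_add v φ ψ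
  trace_smul {N T} c (φ : StdSec N N T) := StdSec.trace_smul v c φ
  trace_comm {N N' T} (φ : StdSec N N' T) (ψ : StdSec N' N T) := StdSec.trace_comm v φ ψ
  locallyFree N N' := isLocallyFree_of_frames fun x hx ↦ by
    obtain ⟨T, f, hx', r, s, hs⟩ := exists_frames N (Over.mk (𝟙 U)) hx
    obtain ⟨T', f', hx'', r', s', hs'⟩ := exists_frames N' T hx'
    exact ⟨T', hx'', _, inferInstance, _, std_isFrame hvw (fun i ↦ (hs i).restrict f') hs'⟩
  perfect N N' := by
    intro x hx
    obtain ⟨T, f, hx', r, s, hs⟩ := exists_frames N (Over.mk (𝟙 U)) hx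
    obtain ⟨T₁, f₁, hx'', r', s', hs'⟩ := exists_frames N' T hx'
    exact ⟨T₁, hx'', fun T' g ℓ ↦ StdSec.existsUnique_trace_comp hvw
      (fun i ↦ (hs i).restrict f₁) hs' g ℓ⟩

lemma std_sum_comp {v w : Fin n → 𝒪.sec U} (hvw : ∀ i, v i * w i = 1) {N N' : Fin n → LF 𝒪 U}
    {T : Over U} {ι : Type*} [Fintype ι] [DecidableEq ι] {s : ι → Sec (stdHom N N') T}
    {t : ι → Sec (stdHom N' N) T} (hs : IsFrame s)
    (hst : ∀ i j, StdSec.trace v (StdSec.comp (t j) (s i)) = if i = j then 1 else 0)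
    {r r' : Fin n → ℕ} {a : ∀ i, Fin (r i) → Sec (N i).obj T}
    {a' : ∀ i, Fin (r' i) → Sec (N' i).obj T} (ha : ∀ i, IsFrame (a i))
    (ha' : ∀ i, IsFrame (a' i)) (σ : StdSec N N T) :
    ∑ i, StdSec.comp (StdSec.comp (t i) σ) (s i) =
      fun i ↦ (𝒪.res T.hom.le (w i) * LocHom.trace (N i).property (σ i)) •
        LocHom.id (N' i).obj T := by
  rw [← StdSec.sum_dual_comp_elem ha ha' w σ]
  have h := fun m ↦ StdSec.expand ha ha' hvw (𝟙 T) m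
  refine casimir_eq (fun q m ↦ StdSec.trace v (StdSec.comp q m))
    ((StdSec.compₗ N' N N' T).comp ((StdSec.compₗ N' N N T).flip σ)) (s := s) (t := t) h ?_
  exact fun q ↦ (stdCategory v w hvw).dual_expand hs hst q

variable {𝒯 : TangentMultiplication 𝒪} {η : InvariantMetric 𝒯}

/-- The Calabi-Yau category of families of locally free modules attached to a rooted frame. -/
abbrev RootedFrame.category (D : RootedFrame η n U) : CYCategory 𝒪 U :=
  stdCategory D.root D.rootInv D.root_mul_inv

/-- The Cardy structure on families of locally free modules: `∑ fᵢ eᵢ` acts on the `i`-th module as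
multiplication by `fᵢ`, and `ι^N` is the trace weighted by the inverse roots. -/
def RootedFrame.cardy (D : RootedFrame η n U) : CardyStructure η D.category where
  ι N {T} X := (fun i ↦ D.frame.coeff T.hom.le X i • LocHom.id (N i).obj T : StdSec N N T)
  ι' N {T} σ := ∑ i, (𝒪.res T.hom.le (D.rootInv i) *
    LocHom.trace (N i).property ((σ : StdSec N N T) i)) • 𝒯.res T.hom.le (D.e i)
  ι_res N {T T'} f X := by
    refine funext fun i ↦ ?_
    exact congrArg (· • LocHom.id (N i).obj T')
      (D.frame.coeff_res T.hom.le f.left.le X i).symm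
  ι'_res N {T T'} f σ := by
    rw [map_sum]
    refine Finset.sum_congr rfl fun i _ ↦ ?_
    rw [TangentMultiplication.res_smul, map_mul, LocHom.trace_res]
    rfl
  ι_add N {T} X Y := by
    refine funext fun i ↦ ?_
    rw [D.frame.coeff_add]
    exact add_smul _ _ _
  ι_smul N {T} f X := by
    refine funext fun i ↦ ?_
    rw [D.frame.coeff_smul]
    exact mul_smul _ _ _
  ι_one N {T} := by
    refine funext fun i ↦ ?_
    rw [D.frame.coeff_one]
    exact one_smul _ _
  ι_mul N {T} X Y := by
    refine funext fun i ↦ ?_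
    rw [D.frame.coeff_mul, mul_smul]
    rfl
  ι'_add N {T} σ τ := by
    rw [← Finset.sum_add_distrib]
    refine Finset.sum_congr rfl fun i _ ↦ ?_
    rw [← add_smul, ← mul_add, ← LocHom.trace_add]
    rfl
  ι'_smul N {T} c σ := by
    rw [Finset.smul_sum]
    refine Finset.sum_congr rfl fun i _ ↦ ?_
    have h : LocHom.trace (N i).property ((c • σ : StdSec N N T) i) =
        c * LocHom.trace (N i).property ((σ : StdSec N N T) i) := LocHom.trace_smul _ c _
    rw [smul_smul, mul_left_comm, ← h]
  central {N N' T} X σ := by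
    refine funext fun i ↦ LocHom.ext_app fun T' f m ↦ ?_
    exact map_smul (((σ : StdSec N N' T) i).app f) _ _
  adjoint N {T} σ X := by
    -- the contributions of the idempotents agree: with `w` inverse to the root `v` of `θ(eᵢ)`, the
    -- factor on the left is `w θ(eᵢ) = v`
    have h1 : ∀ i, η.trace (((𝒪.res T.hom.le (D.rootInv i) *
        LocHom.trace (N i).property ((σ : StdSec N N T) i)) • 𝒯.res T.hom.le (D.e i)) * X) =
        𝒪.res T.hom.le (D.root i) * LocHom.trace (N i).property
          ((D.frame.coeff T.hom.le X i • LocHom.id (N i).obj T).comp ((σ : StdSec N N T) i)) := by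
      intro i
      have e1 : (D.frame.coeff T.hom.le X i • LocHom.id (N i).obj T).comp ((σ : StdSec N N T) i) =
          D.frame.coeff T.hom.le X i • (σ : StdSec N N T) i :=
        congrFun (StdSec.smul_comp (D.frame.coeff T.hom.le X i)
          (fun i ↦ LocHom.id (N i).obj T : StdSec N N T) σ) i
      have e2 : 𝒯.res T.hom.le (D.e i) * X =
          D.frame.coeff T.hom.le X i • 𝒯.res T.hom.le (D.e i) := by
        conv_lhs => rw [← D.frame.sum_coeff T.hom.le X]
        rw [Finset.mul_sum, Finset.sum_eq_single i]
        · rw [mul_smul_comm, D.frame.mul_self]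
        · intro j _ hj
          rw [mul_smul_comm, D.frame.mul_of_ne _ hj.symm, smul_zero]
        · simp
      rw [e1, LocHom.trace_smul, smul_mul_assoc, e2, η.trace_smul, η.trace_smul, η.trace_res,
        ← D.root_sq, map_mul]
      have e3 : 𝒪.res T.hom.le (D.root i) * 𝒪.res T.hom.le (D.rootInv i) = 1 := by
        rw [← map_mul, D.root_mul_inv, map_one]
      linear_combination (LocHom.trace (N i).property ((σ : StdSec N N T) i) *
        D.frame.coeff T.hom.le X i * 𝒪.res T.hom.le (D.root i)) * e3
    rw [Finset.sum_mul, η.trace_sum]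
    exact Finset.sum_congr rfl fun i _ ↦ h1 i
  cardy {N N' T r} s t hs hst σ := by
    -- the Casimir sum does not depend on the dual bases, so around each point it may be computed with
    -- the elementary homomorphisms of frames of the two families
    refine Sec.ext_locally (N := stdHom N' N') fun x hx ↦ ?_
    obtain ⟨T₁, f, hx', r₁, s₁, hs₁⟩ := exists_frames N T hx
    obtain ⟨T₂, f₂, hx'', r₂, s₂, hs₂⟩ := exists_frames N' T₁ hx'
    refine ⟨T₂, f₂ ≫ f, hx'', ?_⟩
    rw [D.frame.coeff_sum]
    refine (Sec.res_sum (N := stdHom N' N') (f₂ ≫ f) Finset.univ _).trans ?_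
    refine (std_sum_comp D.root_mul_inv (IsFrame.restrict hs (f₂ ≫ f))
      (D.category.dual_res hst (f₂ ≫ f)) (fun i ↦ (hs₁ i).restrict f₂) hs₂
        (StdSec.res (f₂ ≫ f) σ)).trans (funext fun i ↦ ?_)
    have e := LocHom.trace_res (N i).property ((σ : StdSec N N T) i) (f₂ ≫ f)
    have e₂ : ∀ c : 𝒪.sec T.left, LocHom.res (f₂ ≫ f) (c • LocHom.id (N' i).obj T) =
        𝒪.res (f₂ ≫ f).left.le c • LocHom.id (N' i).obj T₂ := fun _ ↦ rfl
    refine Eq.trans ?_ (e₂ _).symm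
    refine congrArg (fun c : 𝒪.sec T₂.left ↦ c • LocHom.id (N' i).obj T₂) ?_
    exact (congrArg _ e.symm).trans (map_mul (𝒪.res (f₂ ≫ f).left.le)
      (𝒪.res T.hom.le (D.rootInv i)) _).symm

end Standard

end

end BraneFibration

namespace BraneFibration

noncomputable section

/-! ### Fibre functors and embeddings into the standard Cardy category -/

section FibreFunctors

variable {M : Type u} [TopologicalSpace M] {𝒪 : FunctionSheaf M} {𝒯 : TangentMultiplication 𝒪}
  {η : InvariantMetric 𝒯} {U : Opens M} {n : ℕ}

/-- The isomorphism given by mutually inverse local homomorphisms over all of `U`. -/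
def LocHom.isoOfInverse {N N' : SheafOfModules.{u} (𝒪.sheaf.over U)}
    (φ : LocHom N N' (Over.mk (𝟙 U))) (ψ : LocHom N' N (Over.mk (𝟙 U)))
    (h : φ.comp ψ = LocHom.id _ _) (h' : ψ.comp φ = LocHom.id _ _) : N ≅ N' where
  hom := φ.toHom
  inv := ψ.toHom
  hom_inv_id := Sec.hom_ext fun T s ↦ by
    rw [Sec.map_comp, LocHom.map_toHom _ (Over.mkIdTerminal.from T),
      LocHom.map_toHom _ (Over.mkIdTerminal.from T)]
    exact congrArg (fun χ : LocHom N N (Over.mk (𝟙 U)) ↦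
      χ.app (Over.mkIdTerminal.from T) s) h
  inv_hom_id := Sec.hom_ext fun T s ↦ by
    rw [Sec.map_comp, LocHom.map_toHom _ (Over.mkIdTerminal.from T),
      LocHom.map_toHom _ (Over.mkIdTerminal.from T)]
    exact congrArg (fun χ : LocHom N' N' (Over.mk (𝟙 U)) ↦
      χ.app (Over.mkIdTerminal.from T) s) h'

/-- A fibre functor of a Cardy category at the `i`-th sheet of the spectral cover: a linear functor
to locally free modules on which the idempotent `eᵢ` acts as the identity and the other ones act as
zero. Locally there are a frame `sⱼ` of `E b` and natural liftings `E c → Γ_bc` inverse to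
`σ ↦ (sⱼ σ)ⱼ`, which are compatible with the traces. -/
structure FibreFunctor (D : RootedFrame η n U) {𝒞 : CYCategory 𝒪 U} (h : CardyStructure η 𝒞)
    (i : Fin n) where
  /-- the values on labels -/
  E : 𝒞.Obj → LF 𝒪 U
  /-- the values on morphisms -/
  act {b c : 𝒞.Obj} {T : Over U} :
    Sec (𝒞.Hom b c) T →ₗ[𝒪.sec T.left] LocHom (E b).obj (E c).obj T
  act_res {b c : 𝒞.Obj} {T T' : Over U} (f : T' ⟶ T) (σ : Sec (𝒞.Hom b c) T) :
    act (σ.res f) = (act σ).res f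
  act_id (b : 𝒞.Obj) (T : Over U) : act (𝒞.id b T) = LocHom.id (E b).obj T
  act_comp {b c d : 𝒞.Obj} {T : Over U} (σ : Sec (𝒞.Hom b c) T) (τ : Sec (𝒞.Hom c d) T) :
    act (𝒞.comp σ τ) = (act σ).comp (act τ)
  act_ι (b : 𝒞.Obj) (T : Over U) (k : Fin n) :
    act (h.ι b (T := T) (𝒯.res T.hom.le (D.e k))) = if i = k then LocHom.id (E b).obj T else 0
  exists_lift (b : 𝒞.Obj) (T : Over U) {x : M} (hx : x ∈ T.left) :
    ∃ (T' : Over U) (_ : T' ⟶ T), x ∈ T'.left ∧ ∃ (r : ℕ) (s : Fin r → Sec (E b).obj T')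
      (hs : IsFrame s) (lift : ∀ c, Fin r → Sec (E c).obj T' → Sec (𝒞.Hom b c) T'),
      (∀ c j k m, (act (lift c j m)).app (𝟙 T') (s k) = if k = j then m else 0) ∧
      (∀ c d j m (τ : Sec (𝒞.Hom c d) T'),
        lift d j ((act τ).app (𝟙 T') m) = 𝒞.comp (lift c j m) τ) ∧
      ∑ j, lift b j (s j) = h.ι b (𝒯.res T'.hom.le (D.e i)) ∧
      ∀ j m, 𝒞.trace (lift b j m) = 𝒪.res T'.hom.le (D.root i) * (hs.basis (𝟙 T')).repr m j

namespace CardyStructure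

variable {𝒞 : CYCategory 𝒪 U} (h : CardyStructure η 𝒞) (D : RootedFrame η n U) {T : Over U}

lemma ι_sum (b : 𝒞.Obj) {κ : Type*} (I : Finset κ) (X : κ → 𝒯.Sec T.left) :
    h.ι b (T := T) (∑ i ∈ I, X i) = ∑ i ∈ I, h.ι b (X i) :=
  map_sum (AddMonoidHom.mk' (fun X ↦ h.ι b (T := T) X) (h.ι_add b)) X I

lemma sum_ι (b : 𝒞.Obj) (T : Over U) :
    ∑ i, h.ι b (T := T) (𝒯.res T.hom.le (D.e i)) = 𝒞.id b T := by
  rw [← h.ι_sum, D.frame.sum_eq_one, h.ι_one]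

lemma eq_sum_ι_comp {b c : 𝒞.Obj} (σ : Sec (𝒞.Hom b c) T) :
    σ = ∑ i, 𝒞.comp (h.ι b (T := T) (𝒯.res T.hom.le (D.e i))) σ := by
  rw [← 𝒞.sum_comp, h.sum_ι, 𝒞.id_comp]

lemma coeff_ι' (b : 𝒞.Obj) (σ : Sec (𝒞.Hom b b) T) (i : Fin n) :
    D.frame.coeff T.hom.le (h.ι' b σ) i * 𝒪.res T.hom.le (η.trace (D.e i)) =
      𝒞.trace (𝒞.comp (h.ι b (T := T) (𝒯.res T.hom.le (D.e i))) σ) := by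
  rw [← h.adjoint, η.trace_mul_idempotent D.frame]

end CardyStructure

namespace FibreFunctor

variable {D : RootedFrame η n U} {𝒞 : CYCategory 𝒪 U} {h : CardyStructure η 𝒞}
  (Φ : ∀ i, FibreFunctor D h i) {b c d : 𝒞.Obj} {T T' : Over U}

lemma act_comp_ι {i : Fin n} (Ψ : FibreFunctor D h i) (k : Fin n) (σ : Sec (𝒞.Hom b c) T) :
    Ψ.act (𝒞.comp σ (h.ι c (T := T) (𝒯.res T.hom.le (D.e k)))) = if i = k then Ψ.act σ else 0 := by
  rw [Ψ.act_comp, Ψ.act_ι]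
  split_ifs
  · rfl
  · rfl

/-- A fibre functor is faithful on the part of a morphism which belongs to its sheet. -/
lemma ι_comp_eq {i : Fin n} (Ψ : FibreFunctor D h i) {σ σ' : Sec (𝒞.Hom b c) T}
    (e : Ψ.act σ = Ψ.act σ') : 𝒞.comp (h.ι b (T := T) (𝒯.res T.hom.le (D.e i))) σ =
      𝒞.comp (h.ι b (T := T) (𝒯.res T.hom.le (D.e i))) σ' := by
  refine Sec.ext_locally fun x hx ↦ ?_
  obtain ⟨T', f, hx', r, s, hs, lift, h1, h2, h3, h4⟩ := Ψ.exists_lift b T hx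
  refine ⟨T', f, hx', ?_⟩
  rw [𝒞.comp_res, 𝒞.comp_res, h.ι_res, TangentMultiplication.res_res, ← h3, 𝒞.sum_comp, 𝒞.sum_comp]
  refine Finset.sum_congr rfl fun j _ ↦ ?_
  rw [← h2, ← h2, Ψ.act_res, Ψ.act_res, e]

/-- Fibre functors at all sheets are jointly faithful. -/
lemma eq_of_act_eq {σ σ' : Sec (𝒞.Hom b c) T} (e : ∀ i, (Φ i).act σ = (Φ i).act σ') : σ = σ' := by
  rw [h.eq_sum_ι_comp D σ, h.eq_sum_ι_comp D σ']
  exact Finset.sum_congr rfl fun i _ ↦ (Φ i).ι_comp_eq (e i)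

/-- Fullness at one sheet: locally the liftings of the images `φ(sⱼ)` of a frame add up to a preimage
of `φ`, and these glue since morphisms are determined by their actions. -/
lemma exists_act_eq_single (i : Fin n) (φ : LocHom ((Φ i).E b).obj ((Φ i).E c).obj T) :
    ∃ σ : Sec (𝒞.Hom b c) T, (Φ i).act σ = φ ∧ ∀ k, k ≠ i → (Φ k).act σ = 0 := by
  have h0 := fun x : T.left ↦ (Φ i).exists_lift b T x.2
  choose V f hx r s hs lift h1 h2 h3 h4 using h0
  let σ : ∀ x, Sec (𝒞.Hom b c) (V x) := fun x ↦
    ∑ j, lift x c j (((φ.res (f x)).app (𝟙 _)) (s x j))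
  have hσ : ∀ x, (Φ i).act (σ x) = φ.res (f x) := by
    intro x
    refine LocHom.ext_frame (hs x) fun k ↦ ?_
    let ev : LocHom ((Φ i).E b).obj ((Φ i).E c).obj (V x) →+ Sec ((Φ i).E c).obj (V x) :=
      AddMonoidHom.mk' (fun χ ↦ χ.app (𝟙 _) (s x k)) fun _ _ ↦ rfl
    change ev _ = _
    rw [map_sum, map_sum]
    simp [ev, h1]
  have hσ' : ∀ x k, k ≠ i → (Φ k).act (σ x) = 0 := by
    intro x k hk
    rw [map_sum]
    refine Finset.sum_eq_zero fun j _ ↦ ?_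
    -- liftings factor through `ι_c(eᵢ)`, on which the other fibre functors vanish
    have e1 : ∀ m, lift x c j m =
        𝒞.comp (lift x c j m) (h.ι c (T := V x) (𝒯.res (V x).hom.le (D.e i))) := by
      intro m
      rw [← h2, (Φ i).act_ι, if_pos rfl]
      rfl
    rw [e1, (Φ k).act_comp_ι, if_neg hk]
  obtain ⟨t, ht⟩ := Sec.exists_glue V f (fun x hx' ↦ ⟨⟨x, hx'⟩, hx _⟩) σ (by
    intro x y W g g'
    refine eq_of_act_eq Φ fun k ↦ ?_
    rw [(Φ k).act_res, (Φ k).act_res]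
    by_cases hk : k = i
    · subst hk
      rw [hσ, hσ]
      exact LocHom.ext_app fun _ _ _ ↦ LocHom.app_congr _ _ _ _
    · rw [hσ' _ _ hk, hσ' _ _ hk]
      rfl)
  refine ⟨t, LocHom.ext_locally fun x hx' ↦ ⟨V ⟨x, hx'⟩, f _, hx _, ?_⟩, fun k hk ↦
    LocHom.ext_locally fun x hx' ↦ ⟨V ⟨x, hx'⟩, f _, hx _, ?_⟩⟩
  · rw [← (Φ i).act_res, ht, hσ]
  · rw [← (Φ k).act_res, ht, hσ' _ _ hk]
    rfl

lemma exists_act_eq (φ : ∀ i, LocHom ((Φ i).E b).obj ((Φ i).E c).obj T) :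
    ∃ σ : Sec (𝒞.Hom b c) T, ∀ i, (Φ i).act σ = φ i := by
  choose σ h1 h2 using fun i ↦ exists_act_eq_single Φ i (φ i)
  refine ⟨∑ i, σ i, fun i ↦ ?_⟩
  rw [map_sum, Finset.sum_eq_single i, h1]
  · exact fun k _ hk ↦ h2 _ _ hk.symm
  · simp

lemma trace_ι_comp {i : Fin n} (Ψ : FibreFunctor D h i) (σ : Sec (𝒞.Hom b b) T) :
    𝒞.trace (𝒞.comp (h.ι b (T := T) (𝒯.res T.hom.le (D.e i))) σ) =
      𝒪.res T.hom.le (D.root i) * LocHom.trace (Ψ.E b).property (Ψ.act σ) := by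
  refine 𝒪.ext_locally fun x hx ↦ ?_
  obtain ⟨T', f, hx', r, s, hs, lift, h1, h2, h3, h4⟩ := Ψ.exists_lift b T hx
  refine ⟨T'.left, f.left.le, hx', ?_⟩
  rw [𝒞.trace_res, 𝒞.comp_res, h.ι_res, TangentMultiplication.res_res, ← h3, 𝒞.sum_comp,
    𝒞.trace_sum, map_mul, LocHom.trace_res, ← Ψ.act_res]
  have h5 := LocHom.trace_eq_sum (Ψ.E b).property hs (Ψ.act (σ.res f)) (𝟙 T')
  rw [FunctionSheaf.res_self] at h5
  rw [h5, Finset.mul_sum]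
  refine Finset.sum_congr rfl fun j _ ↦ ?_
  rw [← h2, h4, Sec.res_id]
  rfl

lemma trace_eq_sum (σ : Sec (𝒞.Hom b b) T) : 𝒞.trace σ =
    ∑ i, 𝒪.res T.hom.le (D.root i) * LocHom.trace ((Φ i).E b).property ((Φ i).act σ) := by
  conv_lhs => rw [h.eq_sum_ι_comp D σ]
  rw [𝒞.trace_sum]
  exact Finset.sum_congr rfl fun i _ ↦ (Φ i).trace_ι_comp σ

/-- The simultaneous action of a family of fibre functors. -/
def actPi (b c : 𝒞.Obj) (T : Over U) : Sec (𝒞.Hom b c) T →ₗ[𝒪.sec T.left]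
    StdSec (fun i ↦ (Φ i).E b) (fun i ↦ (Φ i).E c) T where
  toFun σ i := (Φ i).act σ
  map_add' σ τ := funext fun i ↦ map_add _ σ τ
  map_smul' r σ := funext fun i ↦ map_smul _ r σ

/-- The isomorphism of sheaves of morphisms given by a family of fibre functors. -/
def homIso (b c : 𝒞.Obj) : 𝒞.Hom b c ≅ stdHom (fun i ↦ (Φ i).E b) (fun i ↦ (Φ i).E c) :=
  isoOfBijective (mkHom (N' := stdHom (fun i ↦ (Φ i).E b) (fun i ↦ (Φ i).E c))
    (fun T ↦ actPi Φ b c T)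
    fun f σ ↦ funext fun i ↦ (Φ i).act_res f σ)
    fun T ↦ ⟨fun σ σ' e ↦ eq_of_act_eq Φ fun i ↦ congrFun e i,
      fun φ ↦ (exists_act_eq Φ φ).imp fun σ hσ ↦ funext hσ⟩

/-- A family of fibre functors, one for each sheet of the spectral cover, embeds a Cardy category
into the standard one. -/
def embedding : CardyEmbedding h D.cardy where
  obj b i := (Φ i).E b
  hom := homIso Φ
  hom_id b T := funext fun i ↦ (Φ i).act_id b T
  hom_comp σ τ := funext fun i ↦ (Φ i).act_comp σ τ
  hom_trace σ := (trace_eq_sum Φ σ).symm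
  hom_ι b T X := by
    refine funext fun i ↦ ?_
    change (Φ i).act _ = D.frame.coeff T.hom.le X i • LocHom.id _ T
    conv_lhs => rw [← D.frame.sum_coeff T.hom.le X]
    rw [h.ι_sum, map_sum, Finset.sum_eq_single i]
    · rw [h.ι_smul, map_smul, (Φ i).act_ι, if_pos rfl]
    · intro k _ hk
      rw [h.ι_smul, map_smul, (Φ i).act_ι, if_neg hk.symm, smul_zero]
    · simp
  hom_ι' b T σ := by
    change ∑ i, (𝒪.res T.hom.le (D.rootInv i) * LocHom.trace ((Φ i).E b).property
      ((Φ i).act σ)) • 𝒯.res T.hom.le (D.e i) = h.ι' b σ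
    rw [← D.frame.sum_coeff T.hom.le (h.ι' b σ)]
    refine Finset.sum_congr rfl fun i _ ↦ ?_
    have h1 := h.coeff_ι' D b σ i
    rw [(Φ i).trace_ι_comp, ← D.root_sq, map_mul] at h1
    -- by adjunction, `θ(eᵢ)` times the coefficient of `ι'_b(σ)` is `θ_b(eᵢ σ)`, where `θ(eᵢ)` is the
    -- square of the root and `θ_b(eᵢ σ)` is the root times the trace on the fibre
    have h2 : 𝒪.res T.hom.le (D.root i) * 𝒪.res T.hom.le (D.rootInv i) = 1 := by
      rw [← map_mul, D.root_mul_inv, map_one]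
    refine congrArg (fun c : 𝒪.sec T.left ↦ c • 𝒯.res T.hom.le (D.e i)) ?_
    set v := 𝒪.res T.hom.le (D.root i)
    set w := 𝒪.res T.hom.le (D.rootInv i)
    set a := D.frame.coeff T.hom.le (h.ι' b σ) i
    linear_combination (-(w * w)) * h1 + (v * w * a + a -
      w * LocHom.trace ((Φ i).E b).property ((Φ i).act σ)) * h2

/-- In a maximal Cardy category with fibre functors at all sheets, each family of locally free
modules is the family of fibres of a label. -/
lemma exists_label (hmax : h.IsMaximal) (N : Fin n → LF 𝒪 U) :
    ∃ b : 𝒞.Obj, ∀ i, Nonempty ((N i).obj ≅ ((Φ i).E b).obj) := by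
  obtain ⟨b, σ, τ, h1, h2⟩ := hmax D.category D.cardy (embedding Φ) N
  exact ⟨b, fun i ↦ ⟨LocHom.isoOfInverse ((τ : StdSec _ _ _) i) ((σ : StdSec _ _ _) i)
    (congrFun h2 i) (congrFun h1 i)⟩⟩

end FibreFunctor

end FibreFunctors

end

end BraneFibration

namespace BraneFibration

noncomputable section

/-! ### Local invertibility, frames adapted to a projector -/

section LocalInverses

variable {M : Type u} [TopologicalSpace M] {𝒪 : FunctionSheaf M}

namespace FunctionSheaf

variable (𝒪) in
/-- Functions which do not vanish at a point are invertible around it. -/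
def HasLocalInverses : Prop :=
  ∀ (U : Opens M) (f : 𝒪.sec U) (x : U), f.1 x ≠ 0 →
    ∃ (V : Opens M) (h : V ≤ U), (x : M) ∈ V ∧ IsUnit (𝒪.res h f)

lemma isUnit_of_locally {U : Opens M} {f : 𝒪.sec U}
    (h : ∀ x ∈ U, ∃ (V : Opens M) (h : V ≤ U), x ∈ V ∧ IsUnit (𝒪.res h f)) : IsUnit f := by
  choose V hV hx hu using fun x : U ↦ h x x.2
  choose g hg using fun x ↦ (hu x).exists_right_inv
  have hg' : ∀ (x : U) (y : V x), f.1 ⟨y, hV x y.2⟩ * (g x).1 y = 1 := fun x y ↦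
    congrFun (congrArg Subtype.val (hg x)) y
  obtain ⟨k, hk⟩ := 𝒪.exists_glue (U := U) V hV (fun x hx' ↦ ⟨⟨x, hx'⟩, hx _⟩) g
    (fun x y z hz hz' ↦ by
      have h1 := hg' x ⟨z, hz⟩
      have h2 := hg' y ⟨z, hz'⟩
      dsimp only at h1 h2
      linear_combination (g y).1 ⟨z, hz'⟩ * h1 - (g x).1 ⟨z, hz⟩ * h2)
  refine IsUnit.of_mul_eq_one k (𝒪.ext_locally fun x hx' ↦ ⟨V ⟨x, hx'⟩, hV _, hx ⟨x, hx'⟩, ?_⟩)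
  rw [map_mul, hk, hg, map_one]

/-- Evaluation of functions at a point. -/
def eval {U : Opens M} (x : U) : 𝒪.sec U →ₐ[ℂ] ℂ :=
  (Pi.evalAlgHom ℂ (fun _ : U ↦ ℂ) x).comp (𝒪.sec U).val

@[simp] lemma eval_apply {U : Opens M} (x : U) (f : 𝒪.sec U) : eval x f = f.1 x := rfl

end FunctionSheaf

variable {U : Opens M} {N : SheafOfModules.{u} (𝒪.sheaf.over U)} {T : Over U}

/-- A family of sections which is a basis at a point is a frame around this point. -/
lemma IsFrame.exists_isFrame_res (h𝒪 : 𝒪.HasLocalInverses) {ι : Type*} [Fintype ι]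
    [DecidableEq ι] {s : ι → Sec N T} (hs : IsFrame s) (v : ι → Sec N T) (x : T.left)
    (hv : (((hs.basis (𝟙 T)).toMatrix v).map (FunctionSheaf.eval x)).det ≠ 0) :
    ∃ (T' : Over U) (f : T' ⟶ T), (x : M) ∈ T'.left ∧ IsFrame fun i ↦ (v i).res f := by
  have h1 : (((hs.basis (𝟙 T)).toMatrix v).det).1 x ≠ 0 := by
    rw [← FunctionSheaf.eval_apply]
    rwa [AlgHom.map_det]
  obtain ⟨V, hV, hx, hu⟩ := h𝒪 _ _ x h1
  refine ⟨overMk T V hV, overHom hV, hx, ?_⟩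
  -- the determinant is invertible at `x`, hence around `x`, and remains so under restriction
  have key : ∀ (T' : Over U) (f : T' ⟶ overMk T V hV),
      IsUnit ((hs.basis (f ≫ overHom hV)).det fun i ↦ ((v i).res (overHom hV)).res f) := by
    intro T' f
    have e : (hs.basis (f ≫ overHom hV)).toMatrix (fun i ↦ ((v i).res (overHom hV)).res f) =
        ((hs.basis (𝟙 T)).toMatrix v).map (𝒪.res (f ≫ overHom hV).left.le) := by
      ext i j
      rw [Module.Basis.toMatrix_apply, Matrix.map_apply, Module.Basis.toMatrix_apply, Sec.res_res,
        hs.repr_res (𝟙 T) (f ≫ overHom hV)]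
    rw [Module.Basis.det_apply, e]
    have h2 : IsUnit (𝒪.res (f ≫ overHom hV).left.le ((hs.basis (𝟙 T)).toMatrix v).det) :=
      hu.map (𝒪.res f.left.le)
    rwa [AlgHom.map_det] at h2
  have key' := fun T' f ↦ (Module.Basis.is_basis_iff_det _).2 (key T' f)
  exact IsFrame.of_basis (fun T' f ↦ Module.Basis.mk (key' T' f).1 (key' T' f).2.ge)
    fun T' f j ↦ Module.Basis.mk_apply _ _ _

/-- The space on which a projector acts has a basis of eigenvectors. -/
lemma exists_basis_of_idempotent {r : ℕ} (P : (Fin r → ℂ) →ₗ[ℂ] (Fin r → ℂ))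
    (hP : ∀ w, P (P w) = P w) :
    ∃ w : Module.Basis (Fin r) ℂ (Fin r → ℂ), ∀ i, P (w i) = w i ∨ P (w i) = 0 := by
  let S : Set (Fin r → ℂ) := {w | P w = w ∨ P w = 0}
  have hS : ⊤ ≤ Submodule.span ℂ S := by
    intro w _
    have e : w = P w + (w - P w) := by abel
    rw [e]
    refine Submodule.add_mem _ (Submodule.subset_span (Or.inl (hP w)))
      (Submodule.subset_span (Or.inr ?_))
    rw [map_sub, hP, sub_self]
  let b := Module.Basis.ofSpan hS
  let ε := b.indexEquiv (Pi.basisFun ℂ (Fin r))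
  refine ⟨b.reindex ε, fun i ↦ ?_⟩
  have h1 : b (ε.symm i) ∈ S := Module.Basis.ofSpan_subset hS ⟨_, rfl⟩
  rw [Module.Basis.reindex_apply]
  exact h1

/-- Around each point there is a frame adapted to a projector: each of its members is fixed or
annihilated. -/
lemma exists_adapted_frame (h𝒪 : 𝒪.HasLocalInverses) (hN : IsLocallyFree N) (P : LocHom N N T)
    (hP : P.comp P = P) {x : M} (hx : x ∈ T.left) :
    ∃ (T' : Over U) (f : T' ⟶ T), x ∈ T'.left ∧ ∃ (r : ℕ) (v : Fin r → Sec N T'), IsFrame v ∧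
      ∀ i, P.app f (v i) = v i ∨ P.app f (v i) = 0 := by
  obtain ⟨T₁, f₁, hx₁, r, s, hs⟩ := hN.exists_frame T hx
  let b := hs.basis (𝟙 T₁)
  let A : Matrix (Fin r) (Fin r) (𝒪.sec T₁.left) := LinearMap.toMatrix b b (P.app f₁)
  let A₀ : Matrix (Fin r) (Fin r) ℂ := A.map (FunctionSheaf.eval ⟨x, hx₁⟩)
  have hPP : P.app f₁ ∘ₗ P.app f₁ = P.app f₁ := by
    conv_rhs => rw [← hP]
    rfl
  have hA : A * A = A := by
    rw [← LinearMap.toMatrix_comp, hPP]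
  have hA₀ : A₀ * A₀ = A₀ := by
    change A.map _ * A.map _ = A.map _
    rw [← Matrix.map_mul, hA]
  obtain ⟨w, hw⟩ := exists_basis_of_idempotent (Matrix.toLin' A₀) fun w ↦ by
    rw [← LinearMap.comp_apply, ← Matrix.toLin'_mul, hA₀]
  -- constant sections with values `w i` at `x`, projected to the image or to the kernel
  let c : Fin r → Sec N T₁ := fun i ↦ ∑ j, algebraMap ℂ (𝒪.sec T₁.left) (w i j) • s j
  classical
  let v : Fin r → Sec N T₁ := fun i ↦
    if Matrix.toLin' A₀ (w i) = w i then P.app f₁ (c i) else c i - P.app f₁ (c i)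
  have hc : ∀ i j, b.repr (c i) j = algebraMap ℂ _ (w i j) := fun i j ↦
    congrFun
    (hs.repr_eq (𝟙 T₁) (c := fun j ↦ algebraMap ℂ _ (w i j)) (by simp only [c, Sec.res_id])) j
  have hPc : ∀ i j, FunctionSheaf.eval ⟨x, hx₁⟩ (b.repr (P.app f₁ (c i)) j) =
      Matrix.toLin' A₀ (w i) j := by
    intro i j
    have h1 := congrFun (LinearMap.toMatrix_mulVec_repr b b (P.app f₁) (c i)) j
    rw [← h1, Matrix.toLin'_apply, Matrix.mulVec, dotProduct, map_sum, Matrix.mulVec, dotProduct]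
    refine Finset.sum_congr rfl fun k _ ↦ ?_
    rw [map_mul, hc]
    rfl
  have hv : (b.toMatrix v).map (FunctionSheaf.eval ⟨x, hx₁⟩) =
      (Pi.basisFun ℂ (Fin r)).toMatrix w := by
    ext j i
    rw [Matrix.map_apply, Module.Basis.toMatrix_apply, Module.Basis.toMatrix_apply,
      Pi.basisFun_repr]
    by_cases h : Matrix.toLin' A₀ (w i) = w i
    · simp only [v, if_pos h]
      rw [hPc, h]
    · simp only [v, if_neg h]
      rw [map_sub, Finsupp.sub_apply, map_sub, hPc, (hw i).resolve_left h, hc]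
      simp
  -- the values of `v` at `x` form a basis, so `v` is a frame around `x`
  have hdet : ((b.toMatrix v).map (FunctionSheaf.eval ⟨x, hx₁⟩)).det ≠ 0 := by
    rw [hv]
    exact ((Module.Basis.is_basis_iff_det (Pi.basisFun ℂ (Fin r))).1
      ⟨w.linearIndependent, w.span_eq⟩).ne_zero
  obtain ⟨T', f, hx', hf⟩ := hs.exists_isFrame_res h𝒪 v ⟨x, hx₁⟩ hdet
  refine ⟨T', f ≫ f₁, hx', r, _, hf, fun i ↦ ?_⟩
  have h2 : ∀ m, P.app f₁ (P.app f₁ m) = P.app f₁ m := fun m ↦ LinearMap.congr_fun hPP m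
  by_cases h : Matrix.toLin' A₀ (w i) = w i
  · left
    rw [P.app_res]
    simp only [v, if_pos h, h2]
  · right
    rw [P.app_res]
    simp only [v, if_neg h, map_sub, h2, sub_self, Sec.res_zero]

end LocalInverses

section Weights

variable {M : Type u} [TopologicalSpace M] {𝒪 : FunctionSheaf M} {𝒯 : TangentMultiplication 𝒪}
  {U : Opens M} {n : ℕ}

/-- The metric is nondegenerate, so the functions `θ(eᵢ)` are invertible. -/
lemma TangentMultiplication.IsIdempotentFrame.isUnit_trace {e : Fin n → 𝒯.Sec U}
    (he : 𝒯.IsIdempotentFrame e) (η : InvariantMetric 𝒯) (i : Fin n) :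
    IsUnit (η.trace (e i)) := by
  refine FunctionSheaf.isUnit_of_locally fun x hx ↦ ?_
  obtain ⟨V, hxV, hV⟩ := η.nondegenerate x
  refine ⟨V ⊓ U, inf_le_right, ⟨hxV, hx⟩, ?_⟩
  let ℓ : 𝒯.Sec (V ⊓ U) →ₗ[𝒪.sec (V ⊓ U)] 𝒪.sec (V ⊓ U) :=
    { toFun := fun X ↦ he.coeff inf_le_right X i
      map_add' := fun X Y ↦ by rw [he.coeff_add]; rfl
      map_smul' := fun f X ↦ by rw [he.coeff_smul]; rfl }
  obtain ⟨X, hX, -⟩ := hV (V ⊓ U) inf_le_left ℓ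
  have h1 := hX (𝒯.res inf_le_right (e i))
  rw [η.g_eq_trace, η.trace_mul_idempotent he] at h1
  refine IsUnit.of_mul_eq_one_right (he.coeff inf_le_right X i) (h1.trans ?_)
  change he.coeff _ _ i = 1
  rw [he.coeff_self, if_pos rfl]

end Weights

end

end BraneFibration

namespace BraneFibration

noncomputable section

/-! ### Rank one idempotents and their fibre functors -/

section RankOne

variable {M : Type u} [TopologicalSpace M] {𝒪 : FunctionSheaf M} {𝒯 : TangentMultiplication 𝒪}
  {η : InvariantMetric 𝒯} {U : Opens M} {n : ℕ}

/-- The inclusion of an open subset of `U` in `U`. -/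
abbrev toTop (T : Over U) : T ⟶ Over.mk (𝟙 U) := Over.mkIdTerminal.from T

/-- An idempotent endomorphism `p` of a label `a` with `p Γ_aa p = 𝒪 p`, on which the idempotent
vector field `X` acts as the identity. -/
structure RankOneIdempotent {𝒞 : CYCategory 𝒪 U} (h : CardyStructure η 𝒞) (X : 𝒯.Sec U)
    (a : 𝒞.Obj) where
  /-- the idempotent -/
  p : Sec (𝒞.Hom a a) (Over.mk (𝟙 U))
  idem : 𝒞.comp p p = p
  support : 𝒞.comp (h.ι a (T := Over.mk (𝟙 U)) X) p = p
  existsUnique (T : Over U) (σ : Sec (𝒞.Hom a a) T) : ∃! c : 𝒪.sec T.left,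
    𝒞.comp (𝒞.comp (p.res (toTop T)) σ) (p.res (toTop T)) = c • p.res (toTop T)

namespace RankOneIdempotent

variable {𝒞 : CYCategory 𝒪 U} {h : CardyStructure η 𝒞} {X : 𝒯.Sec U} {a b : 𝒞.Obj}
  (R : RankOneIdempotent h X a) {T T' : Over U}

/-- The restriction of a rank one idempotent. -/
def pOver (T : Over U) : Sec (𝒞.Hom a a) T := R.p.res (toTop T)

lemma pOver_res (f : T' ⟶ T) : (R.pOver T).res f = R.pOver T' := by
  rw [pOver, Sec.res_res, pOver, Subsingleton.elim (f ≫ toTop T) (toTop T')]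

lemma pOver_idem (T : Over U) : 𝒞.comp (R.pOver T) (R.pOver T) = R.pOver T := by
  rw [pOver, ← 𝒞.comp_res, R.idem]

lemma pOver_support (T : Over U) :
    𝒞.comp (h.ι a (T := T) (𝒯.res T.hom.le X)) (R.pOver T) = R.pOver T := by
  have := congrArg (Sec.res (toTop T)) R.support
  rw [𝒞.comp_res, h.ι_res] at this
  exact this

/-- The coefficient `c` in `p σ p = c p`. -/
def coeff (σ : Sec (𝒞.Hom a a) T) : 𝒪.sec T.left := (R.existsUnique T σ).choose

lemma comp_comp (σ : Sec (𝒞.Hom a a) T) :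
    𝒞.comp (𝒞.comp (R.pOver T) σ) (R.pOver T) = R.coeff σ • R.pOver T :=
  (R.existsUnique T σ).choose_spec.1

lemma smul_injective {c c' : 𝒪.sec T.left} (e : c • R.pOver T = c' • R.pOver T) : c = c' := by
  have h0 : ∀ c : 𝒪.sec T.left, 𝒞.comp (𝒞.comp (R.pOver T) (c • R.pOver T)) (R.pOver T) =
      c • R.pOver T := fun c ↦ by
    rw [𝒞.comp_smul, 𝒞.smul_comp, R.pOver_idem, R.pOver_idem]
  exact (R.existsUnique T (c • R.pOver T)).unique (h0 c) (by rw [e]; exact h0 c')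

/-- The coefficient as a linear map. -/
def coeffₗ (T : Over U) : Sec (𝒞.Hom a a) T →ₗ[𝒪.sec T.left] 𝒪.sec T.left where
  toFun := R.coeff
  map_add' σ τ := R.smul_injective (by
    rw [← comp_comp, 𝒞.comp_add, 𝒞.add_comp, add_smul, comp_comp, comp_comp])
  map_smul' c σ := R.smul_injective (by
    rw [← comp_comp, 𝒞.comp_smul, 𝒞.smul_comp, comp_comp, smul_smul]; rfl)

lemma coeff_pOver : R.coeff (R.pOver T) = 1 := R.smul_injective (by
  rw [← comp_comp, R.pOver_idem, R.pOver_idem, one_smul])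

lemma trace_pOver (T : Over U) : 𝒞.trace (R.pOver T) = 𝒪.res T.hom.le (𝒞.trace R.p) := by
  rw [pOver, ← 𝒞.trace_res]

/-- The trace of a rank one idempotent is invertible, since the trace pairing is perfect. -/
lemma isUnit_trace : IsUnit (𝒞.trace R.p) := by
  refine FunctionSheaf.isUnit_of_locally fun x hx ↦ ?_
  obtain ⟨T, hxT, hT⟩ := 𝒞.perfect a a x hx
  refine ⟨T.left, T.hom.le, hxT, ?_⟩
  obtain ⟨τ, hτ, -⟩ := hT T (𝟙 T) (R.coeffₗ T)
  have h1 : 𝒞.trace (𝒞.comp τ (R.pOver T)) = 1 := (hτ _).trans R.coeff_pOver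
  have h2 := congrArg 𝒞.trace (R.comp_comp τ)
  rw [𝒞.trace_comm, ← 𝒞.assoc, R.pOver_idem, 𝒞.trace_comm, h1, 𝒞.trace_smul] at h2
  rw [← R.trace_pOver]
  exact IsUnit.of_mul_eq_one_right _ h2.symm

/-- Frames of `Γ_ab` and of its dual which are adapted to a rank one idempotent. -/
lemma exists_adapted_dual (h𝒪 : 𝒪.HasLocalInverses) (b : 𝒞.Obj) (T : Over U) {x : M}
    (hx : x ∈ T.left) : ∃ (T' : Over U) (_ : T' ⟶ T), x ∈ T'.left ∧ ∃ (r : ℕ)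
      (v : Fin r → Sec (𝒞.Hom a b) T') (w : Fin r → Sec (𝒞.Hom b a) T') (K : Fin r → Prop),
      IsFrame v ∧ (∀ i j, 𝒞.trace (𝒞.comp (w j) (v i)) = if i = j then 1 else 0) ∧
      (∀ i, K i → 𝒞.comp (R.pOver T') (v i) = v i) ∧
      (∀ i, ¬ K i → 𝒞.comp (R.pOver T') (v i) = 0) ∧
      (∀ i, K i → 𝒞.comp (w i) (R.pOver T') = w i) ∧
      ∀ i, ¬ K i → 𝒞.comp (w i) (R.pOver T') = 0 := by
  classical
  -- composition with `p` is a projector, to which a frame `v` of `Γ_ab` is adapted; the dual frame `w`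
  -- is then adapted to composition with `p` on the other side
  let P : LocHom (𝒞.Hom a b) (𝒞.Hom a b) T :=
    { app := fun {T'} _ ↦ 𝒞.compₗ a a b T' (R.pOver T')
      app_res := fun f g m ↦ by
        rw [← R.pOver_res g]
        exact (𝒞.comp_res g _ _).symm }
  have hP : P.comp P = P := LocHom.ext_app fun T' f m ↦ by
    change 𝒞.comp (R.pOver T') (𝒞.comp (R.pOver T') m) = 𝒞.comp (R.pOver T') m
    rw [← 𝒞.assoc, R.pOver_idem]
  obtain ⟨T₁, f₁, hx₁, r, v, hv, hPv⟩ := exists_adapted_frame h𝒪 (𝒞.locallyFree a b) P hP hx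
  obtain ⟨T₂, f₂, hx₂, w, hw⟩ := 𝒞.exists_dual hv hx₁
  have hfix : ∀ i, 𝒞.comp (R.pOver T₁) (v i) = v i →
      𝒞.comp (R.pOver T₂) ((v i).res f₂) = (v i).res f₂ := fun i hi ↦ by
    rw [← R.pOver_res f₂, ← 𝒞.comp_res, hi]
  have hkill : ∀ i, ¬ 𝒞.comp (R.pOver T₁) (v i) = v i →
      𝒞.comp (R.pOver T₂) ((v i).res f₂) = 0 := fun i hi ↦ by
    rw [← R.pOver_res f₂, ← 𝒞.comp_res, show 𝒞.comp (R.pOver T₁) (v i) = 0 from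
      (hPv i).resolve_left hi,
      Sec.res_zero]
  refine ⟨T₂, f₂ ≫ f₁, hx₂, r, fun i ↦ (v i).res f₂, w,
    fun i ↦ 𝒞.comp (R.pOver T₁) (v i) = v i, hv.restrict f₂, hw, hfix, hkill, ?_, ?_⟩
  · intro i hi
    refine 𝒞.eq_of_trace_frame_eq (hv.restrict f₂) fun k ↦ ?_
    rw [𝒞.assoc]
    by_cases hk : 𝒞.comp (R.pOver T₁) (v k) = v k
    · rw [hfix k hk]
    · have hki : k ≠ i := fun e ↦ hk (e ▸ hi)
      rw [hkill k hk, 𝒞.comp_zero, 𝒞.trace_zero, hw, if_neg hki]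
  · intro i hi
    refine 𝒞.eq_of_trace_frame_eq (hv.restrict f₂) fun k ↦ ?_
    rw [𝒞.assoc, 𝒞.zero_comp, 𝒞.trace_zero]
    by_cases hk : 𝒞.comp (R.pOver T₁) (v k) = v k
    · have hki : k ≠ i := fun e ↦ hi (e ▸ hk)
      rw [hfix k hk, hw, if_neg hki]
    · rw [hkill k hk, 𝒞.comp_zero, 𝒞.trace_zero]

lemma coeff_mul_trace (v : Sec (𝒞.Hom a b) T) (w : Sec (𝒞.Hom b a) T)
    (hv : 𝒞.comp (R.pOver T) v = v) (hw : 𝒞.comp w (R.pOver T) = w) {t : 𝒪.sec T.left}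
    (ht : t * 𝒪.res T.hom.le (𝒞.trace R.p) = 1) :
    𝒞.comp v w = (t * 𝒞.trace (𝒞.comp w v)) • R.pOver T := by
  have h1 : 𝒞.comp v w = R.coeff (𝒞.comp v w) • R.pOver T := by
    rw [← R.comp_comp, ← 𝒞.assoc, hv, 𝒞.assoc, hw]
  have h2 := congrArg 𝒞.trace h1
  rw [𝒞.trace_comm, 𝒞.trace_smul, R.trace_pOver] at h2
  rw [h1, h2]
  congr 1
  linear_combination (-R.coeff (𝒞.comp v w)) * ht

variable {e : Fin n → 𝒯.Sec U} (he : 𝒯.IsIdempotentFrame e) {i : Fin n}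
  (R : RankOneIdempotent h (e i) a)

include he in
/-- The adjunction computes `ι^a(p)`. -/
lemma ι'_pOver (T : Over U) {t : 𝒪.sec T.left} (ht : t * 𝒪.res T.hom.le (η.trace (e i)) = 1) :
    h.ι' a (R.pOver T) = (t * 𝒪.res T.hom.le (𝒞.trace R.p)) • 𝒯.res T.hom.le (e i) := by
  have h1 : ∀ k, he.coeff T.hom.le (h.ι' a (R.pOver T)) k * 𝒪.res T.hom.le (η.trace (e k)) =
      if k = i then 𝒪.res T.hom.le (𝒞.trace R.p) else 0 := by
    intro k
    rw [← η.trace_mul_idempotent he, h.adjoint]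
    split_ifs with hk
    · subst hk
      rw [R.pOver_support, R.trace_pOver]
    · rw [← R.pOver_support, ← 𝒞.assoc, ← h.ι_mul, he.mul_of_ne _ (Ne.symm hk)]
      have : h.ι a (T := T) 0 = 0 := by
        have := h.ι_smul a (T := T) 0 0
        rwa [zero_smul, zero_smul] at this
      rw [this, 𝒞.zero_comp, 𝒞.trace_zero]
  have h2 : ∀ k, he.coeff T.hom.le (h.ι' a (R.pOver T)) k =
      if k = i then t * 𝒪.res T.hom.le (𝒞.trace R.p) else 0 := by
    intro k
    have hk := h1 k
    split_ifs with hki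
    · subst hki
      rw [if_pos rfl] at hk
      rw [← hk]
      linear_combination (-he.coeff T.hom.le (h.ι' a (R.pOver T)) k) * ht
    · rw [if_neg hki] at hk
      exact ((he.isUnit_trace η k).map (𝒪.res T.hom.le)).mul_left_eq_zero.1 hk
  rw [← he.sum_coeff T.hom.le (h.ι' a (R.pOver T))]
  simp [h2, ite_smul]

include he in
/-- The Cardy condition expresses the action of `eᵢ` on a label `b` through morphisms from and to
the image of a rank one idempotent. -/
lemma sum_comp_eq {r : ℕ} {v : Fin r → Sec (𝒞.Hom a b) T} {w : Fin r → Sec (𝒞.Hom b a) T}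
    (K : Fin r → Prop) [DecidablePred K] (hv : IsFrame v)
    (hvw : ∀ i j, 𝒞.trace (𝒞.comp (w j) (v i)) = if i = j then 1 else 0)
    (h1 : ∀ i, K i → 𝒞.comp (w i) (R.pOver T) = w i)
    (h2 : ∀ i, ¬ K i → 𝒞.comp (w i) (R.pOver T) = 0)
    {t : 𝒪.sec T.left} (ht : t * 𝒪.res T.hom.le (η.trace (e i)) = 1) :
    ∑ j, (if K j then 𝒞.comp (w j) (v j) else 0) =
      (t * 𝒪.res T.hom.le (𝒞.trace R.p)) • h.ι b (𝒯.res T.hom.le (e i)) := by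
  have h3 := h.cardy v w hv hvw (R.pOver T)
  rw [R.ι'_pOver he T ht, h.ι_smul] at h3
  rw [← h3]
  refine Finset.sum_congr rfl fun j _ ↦ ?_
  split_ifs with hj
  · rw [h1 j hj]
  · rw [h2 j hj, 𝒞.zero_comp]

include he in
/-- `θ_a(p)² = θ(eᵢ)`. -/
lemma trace_sq (h𝒪 : 𝒪.HasLocalInverses) :
    𝒞.trace R.p * 𝒞.trace R.p = η.trace (e i) := by
  classical
  refine 𝒪.ext_locally fun x hx ↦ ?_
  obtain ⟨T, f, hxT, r, v, w, K, hv, hvw, h1, h2, h3, h4⟩ :=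
    R.exists_adapted_dual h𝒪 a (Over.mk (𝟙 U)) hx
  refine ⟨T.left, T.hom.le, hxT, ?_⟩
  obtain ⟨t, ht⟩ := ((he.isUnit_trace η i).map (𝒪.res T.hom.le)).exists_left_inv
  obtain ⟨t', ht'⟩ := (R.isUnit_trace.map (𝒪.res T.hom.le)).exists_left_inv
  have h5 := R.sum_comp_eq he K hv hvw h3 h4 ht
  rw [map_mul]
  set θ := 𝒪.res T.hom.le (η.trace (e i))
  set ϑ := 𝒪.res T.hom.le (𝒞.trace R.p)
  -- both sides of the Cardy condition are composed with the `k`-th section of the frame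
  have h6 : ∀ k, K k → t' • v k = (t * ϑ) • v k := by
    intro k hk
    have h7 := congrArg (𝒞.comp (v k)) h5
    rw [𝒞.comp_sum, 𝒞.comp_smul, ← h.central, ← h1 k hk, ← 𝒞.assoc, R.pOver_support, h1 k hk,
      Finset.sum_eq_single k] at h7
    · rw [if_pos hk, ← 𝒞.assoc, R.coeff_mul_trace _ _ (h1 k hk) (h3 k hk) ht', hvw, if_pos rfl,
        mul_one, 𝒞.smul_comp, h1 k hk] at h7
      exact h7
    · intro j _ hj
      split_ifs with hjK
      · rw [← 𝒞.assoc, R.coeff_mul_trace _ _ (h1 k hk) (h3 j hjK) ht', hvw, if_neg hj.symm,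
          mul_zero, zero_smul, 𝒞.zero_comp]
      · rw [𝒞.comp_zero]
    · simp
  -- `p` is a combination of the `v k` which it fixes
  have h8 : t' • R.pOver T = (t * ϑ) • R.pOver T := by
    have e1 : R.pOver T = ∑ k, (hv.basis (𝟙 T)).repr (R.pOver T) k •
        (if K k then v k else 0) := by
      have e0 := congrArg (𝒞.comp (R.pOver T)) (hv.sum_repr (𝟙 T) (R.pOver T))
      rw [R.pOver_idem, 𝒞.comp_sum] at e0
      refine e0.symm.trans ?_
      refine Finset.sum_congr rfl fun k _ ↦ ?_
      rw [𝒞.comp_smul, Sec.res_id]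
      split_ifs with hk
      · rw [h1 k hk]
      · rw [h2 k hk]
    rw [e1, Finset.smul_sum, Finset.smul_sum]
    refine Finset.sum_congr rfl fun k _ ↦ ?_
    rw [smul_comm, smul_comm (t * ϑ)]
    split_ifs with hk
    · rw [h6 k hk]
    · simp
  have h9 := R.smul_injective h8
  linear_combination (-(θ * ϑ)) * h9 - (ϑ * ϑ) * ht + θ * ht'

end RankOneIdempotent

end RankOne

end

end BraneFibration

namespace BraneFibration

noncomputable section

section RankOne

variable {M : Type u} [TopologicalSpace M] {𝒪 : FunctionSheaf M} {𝒯 : TangentMultiplication 𝒪}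
  {η : InvariantMetric 𝒯} {U : Opens M} {n : ℕ}

namespace RankOneIdempotent

variable {𝒞 : CYCategory 𝒪 U} {h : CardyStructure η 𝒞} {X : 𝒯.Sec U} {a b c : 𝒞.Obj}
  (R : RankOneIdempotent h X a) {T T' : Over U}

/-- The sections of `p Γ_ab`. -/
def fixed (b : 𝒞.Obj) (T : Over U) : Submodule (𝒪.sec T.left) (Sec (𝒞.Hom a b) T) where
  carrier := {σ | 𝒞.comp (R.pOver T) σ = σ}
  add_mem' {σ τ} hσ hτ := by
    change 𝒞.comp _ _ = _
    rw [𝒞.comp_add, hσ, hτ]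
  zero_mem' := 𝒞.comp_zero _
  smul_mem' c σ hσ := by
    change 𝒞.comp _ _ = _
    rw [𝒞.comp_smul, hσ]

lemma mem_fixed {σ : Sec (𝒞.Hom a b) T} : σ ∈ R.fixed b T ↔ 𝒞.comp (R.pOver T) σ = σ := Iff.rfl

lemma res_mem_fixed (f : T' ⟶ T) {σ : Sec (𝒞.Hom a b) T} (hσ : σ ∈ R.fixed b T) :
    σ.res f ∈ R.fixed b T' := by
  rw [mem_fixed, ← R.pOver_res f, ← 𝒞.comp_res, R.mem_fixed.1 hσ]

instance (b : 𝒞.Obj) (T : Over U) : Module ((𝒪.sheaf.over U).obj.obj (op T)) (R.fixed b T) :=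
  inferInstanceAs (Module (𝒪.sec T.left) (R.fixed b T))

/-- The system of sections of `p Γ_ab`. -/
def fixedSystem (b : 𝒞.Obj) : SectionSystem (𝒪.sheaf.over U) fun T ↦ R.fixed b T where
  res f := AddMonoidHom.mk' (fun σ ↦ ⟨σ.1.res f, R.res_mem_fixed f σ.2⟩) fun σ τ ↦
    Subtype.ext (Sec.res_add f σ.1 τ.1)
  res_id T σ := Subtype.ext (Sec.res_id σ.1)
  res_comp f g σ := Subtype.ext (Sec.res_res f g σ.1).symm
  res_smul f r σ := Subtype.ext (Sec.res_smul f r σ.1)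
  sep σ τ e := Subtype.ext (Sec.ext_locally fun x hx ↦ by
    obtain ⟨T', f, hx', e'⟩ := e x hx
    exact ⟨T', f, hx', congrArg Subtype.val e'⟩)
  glue {T _} T' f hT σ hσ := by
    obtain ⟨t, ht⟩ := Sec.exists_glue T' f hT (fun i ↦ (σ i).1)
      fun i j W g g' ↦ congrArg Subtype.val (hσ i j W g g')
    refine ⟨⟨t, ?_⟩, fun i ↦ Subtype.ext (ht i)⟩
    refine Sec.ext_locally fun x hx ↦ ?_
    obtain ⟨i, hi⟩ := hT x hx
    refine ⟨T' i, f i, hi, ?_⟩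
    rw [𝒞.comp_res, R.pOver_res, ht]
    exact (σ i).2

/-- The sheaf `p Γ_ab`. -/
def fixedSheaf (b : 𝒞.Obj) : SheafOfModules.{u} (𝒪.sheaf.over U) := (R.fixedSystem b).sheaf

/-- The inclusion of `p Γ_ab` in `Γ_ab`. -/
def fixedInclusion (b : 𝒞.Obj) : R.fixedSheaf b ⟶ 𝒞.Hom a b :=
  mkHom (N := R.fixedSheaf b) (fun T ↦ (R.fixed b T).subtype) fun _ _ ↦ rfl

/-- A realization of the subsheaves `p Γ_ab` of `Γ_ab` for all labels `b`. -/
structure Realization where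
  /-- the sheaf -/
  E : 𝒞.Obj → SheafOfModules.{u} (𝒪.sheaf.over U)
  /-- the inclusion -/
  j (b : 𝒞.Obj) : E b ⟶ 𝒞.Hom a b
  injective (b : 𝒞.Obj) (T : Over U) {s s' : Sec (E b) T} : s.map (j b) = s'.map (j b) → s = s'
  map_mem (b : 𝒞.Obj) (T : Over U) (s : Sec (E b) T) : s.map (j b) ∈ R.fixed b T
  exists_map_eq (b : 𝒞.Obj) (T : Over U) {σ : Sec (𝒞.Hom a b) T} :
    σ ∈ R.fixed b T → ∃ s : Sec (E b) T, s.map (j b) = σ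

/-- The realization by subsheaves. -/
def fixedRealization : R.Realization where
  E := R.fixedSheaf
  j := R.fixedInclusion
  injective b T _ _ e := Subtype.ext e
  map_mem b T s := Subtype.property (p := fun σ ↦ σ ∈ R.fixed b T) s
  exists_map_eq b T _ hσ := ⟨⟨_, hσ⟩, rfl⟩

/-- The realization by the sheaves `Γ_ab` themselves if the idempotent is the identity. -/
def idRealization (hp : R.p = 𝒞.id a _) : R.Realization where
  E b := 𝒞.Hom a b
  j b := 𝟙 _
  injective b T _ _ e := e
  map_mem b T s := by
    rw [mem_fixed, pOver, hp, 𝒞.id_res, 𝒞.id_comp]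
  exists_map_eq b T σ _ := ⟨σ, rfl⟩

namespace Realization

variable {R} (ℛ : R.Realization)

/-- The section of `E b` given by a section of `p Γ_ab`. -/
def lift (b : 𝒞.Obj) (T : Over U) (σ : Sec (𝒞.Hom a b) T) (hσ : σ ∈ R.fixed b T) : Sec (ℛ.E b) T :=
  (ℛ.exists_map_eq b T hσ).choose

lemma map_lift (σ : Sec (𝒞.Hom a b) T) (hσ : σ ∈ R.fixed b T) :
    (ℛ.lift b T σ hσ).map (ℛ.j b) = σ := (ℛ.exists_map_eq b T hσ).choose_spec

lemma comp_mem (m : Sec (ℛ.E b) T) (σ : Sec (𝒞.Hom b c) T) :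
    𝒞.comp (m.map (ℛ.j b)) σ ∈ R.fixed c T := by
  rw [mem_fixed, ← 𝒞.assoc, R.mem_fixed.1 (ℛ.map_mem b T m)]

/-- The action of morphisms by composition. -/
def act {T : Over U} : Sec (𝒞.Hom b c) T →ₗ[𝒪.sec T.left] LocHom (ℛ.E b) (ℛ.E c) T where
  toFun σ :=
    { app := fun {T'} f ↦
        { toFun := fun m ↦ ℛ.lift c T' (𝒞.comp (m.map (ℛ.j b)) (σ.res f)) (ℛ.comp_mem _ _)
          map_add' := fun m m' ↦ ℛ.injective c T' (by
            refine (ℛ.map_lift _ (ℛ.comp_mem _ _)).trans ?_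
            rw [Sec.map_add (ℛ.j c), map_lift, map_lift, Sec.map_add, 𝒞.add_comp])
          map_smul' := fun r m ↦ ℛ.injective c T' (by
            refine (ℛ.map_lift _ (ℛ.comp_mem _ _)).trans ?_
            rw [RingHom.id_apply, Sec.map_smul (ℛ.j c), map_lift, Sec.map_smul, 𝒞.smul_comp]) }
      app_res := fun {T' T''} f g m ↦ ℛ.injective c T'' (by
        refine (ℛ.map_lift _ (ℛ.comp_mem _ _)).trans ?_
        refine Eq.trans ?_ (Sec.map_res (ℛ.j c) g _).symm
        refine Eq.trans ?_ (congrArg (Sec.res g) (ℛ.map_lift _ (ℛ.comp_mem _ _))).symm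
        rw [Sec.map_res, 𝒞.comp_res, Sec.res_res]) }
  map_add' σ τ := LocHom.ext_app fun T' f m ↦ ℛ.injective c T' (by
    refine (ℛ.map_lift _ (ℛ.comp_mem _ _)).trans ?_
    refine Eq.trans ?_ (Sec.map_add (ℛ.j c) _ _).symm
    refine Eq.trans ?_ (congrArg₂ (· + ·) (ℛ.map_lift _ (ℛ.comp_mem _ _))
      (ℛ.map_lift _ (ℛ.comp_mem _ _))).symm
    rw [Sec.res_add, 𝒞.comp_add])
  map_smul' r σ := LocHom.ext_app fun T' f m ↦ ℛ.injective c T' (by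
    refine (ℛ.map_lift _ (ℛ.comp_mem _ _)).trans ?_
    refine Eq.trans ?_ (Sec.map_smul (ℛ.j c) _ _).symm
    refine Eq.trans ?_ (congrArg (𝒪.res f.left.le r • ·) (ℛ.map_lift _ (ℛ.comp_mem _ _))).symm
    rw [Sec.res_smul, 𝒞.comp_smul])

lemma map_act (σ : Sec (𝒞.Hom b c) T) (f : T' ⟶ T) (m : Sec (ℛ.E b) T') :
    ((ℛ.act σ).app f m).map (ℛ.j c) = 𝒞.comp (m.map (ℛ.j b)) (σ.res f) :=
  ℛ.map_lift _ (ℛ.comp_mem _ _)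

/-- The members of an adapted frame of `Γ_ab` which are fixed by `p` form a frame of `p Γ_ab`. -/
lemma isFrame {r : ℕ} {v : Fin r → Sec (𝒞.Hom a b) T} {K : Fin r → Prop} [DecidablePred K]
    (hv : IsFrame v) (h1 : ∀ i, K i → 𝒞.comp (R.pOver T) (v i) = v i)
    (h2 : ∀ i, ¬ K i → 𝒞.comp (R.pOver T) (v i) = 0) :
    IsFrame fun i : {i // K i} ↦ ℛ.lift b T (v i) (R.mem_fixed.2 (h1 i i.2)) := by
  intro T' f m
  have hmap : ∀ c : {i // K i} → 𝒪.sec T'.left,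
      (∑ i, c i • (ℛ.lift b T (v i) (R.mem_fixed.2 (h1 i i.2))).res f).map (ℛ.j b) =
        ∑ i : {i // K i}, c i • (v i).res f := fun c ↦ by
    rw [Sec.map_sum]
    exact Finset.sum_congr rfl fun i _ ↦ by
      rw [Sec.map_smul, Sec.map_res, ℛ.map_lift (v i) (R.mem_fixed.2 (h1 i i.2))]
  obtain ⟨c, hc, hc'⟩ := hv T' f (m.map (ℛ.j b))
  refine ⟨fun i ↦ c i, ℛ.injective b T' ?_, fun d hd ↦ ?_⟩
  · rw [hmap]
    have h3 : m.map (ℛ.j b) = ∑ i, if K i then c i • (v i).res f else 0 := by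
      rw [← R.mem_fixed.1 (ℛ.map_mem b T' m)]
      conv_lhs => rw [hc]
      rw [𝒞.comp_sum]
      refine Finset.sum_congr rfl fun i _ ↦ ?_
      rw [𝒞.comp_smul, ← R.pOver_res f, ← 𝒞.comp_res]
      split_ifs with hi
      · rw [h1 i hi]
      · rw [h2 i hi, Sec.res_zero, smul_zero]
    rw [h3, ← Finset.sum_filter]
    exact (Finset.sum_subtype _ (by simp) fun i ↦ c i • (v i).res f)
  · have h4 := hc' (fun i ↦ if hi : K i then d ⟨i, hi⟩ else 0) (by
      dsimp only
      rw [hd, hmap]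
      have : ∀ i, (if hi : K i then d ⟨i, hi⟩ else 0) • (v i).res f =
          if K i then (if hi : K i then d ⟨i, hi⟩ else 0) • (v i).res f else 0 := fun i ↦ by
        split_ifs <;> simp
      rw [Finset.sum_congr rfl fun i _ ↦ this i, ← Finset.sum_filter,
        Finset.sum_subtype (p := K) _ (by simp)]
      exact Finset.sum_congr rfl fun i _ ↦ by rw [dif_pos i.2])
    funext i
    rw [← h4]
    change d i = if hi : K i then d ⟨i, hi⟩ else 0
    rw [dif_pos i.2]

lemma isLocallyFree (h𝒪 : 𝒪.HasLocalInverses) (b : 𝒞.Obj) : IsLocallyFree (ℛ.E b) := by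
  classical
  refine isLocallyFree_of_frames fun x hx ↦ ?_
  obtain ⟨T, f, hxT, r, v, w, K, hv, hvw, h1, h2, h3, h4⟩ :=
    R.exists_adapted_dual h𝒪 b (Over.mk (𝟙 U)) hx
  exact ⟨T, hxT, {i // K i}, inferInstance, _, ℛ.isFrame hv h1 h2⟩

end Realization

variable {D : RootedFrame η n U} {i : Fin n} {R : RankOneIdempotent h (D.e i) a}

/-- The fibre functor `b ↦ p Γ_ab` given by a rank one idempotent `p`. -/
def Realization.fibreFunctor (ℛ : R.Realization) (h𝒪 : 𝒪.HasLocalInverses)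
    (hroot : D.root i = 𝒞.trace R.p) : FibreFunctor D h i where
  E b := ⟨ℛ.E b, ℛ.isLocallyFree h𝒪 b⟩
  act := ℛ.act
  act_res {b c T T'} f σ := LocHom.ext_app fun T'' g m ↦ ℛ.injective c T'' (by
    rw [LocHom.res_app, ℛ.map_act, ℛ.map_act, Sec.res_res])
  act_id b T := LocHom.ext_app fun T' f m ↦ ℛ.injective b T' (by
    rw [ℛ.map_act, 𝒞.id_res, 𝒞.comp_id]; rfl)
  act_comp {b c d T} σ τ := LocHom.ext_app fun T' f m ↦ ℛ.injective d T' (by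
    rw [LocHom.comp_app, LinearMap.comp_apply, ℛ.map_act, ℛ.map_act, ℛ.map_act, 𝒞.comp_res,
      𝒞.assoc])
  act_ι b T k := LocHom.ext_app fun T' f m ↦ ℛ.injective b T' (by
    rw [ℛ.map_act, h.ι_res, TangentMultiplication.res_res, ← h.central]
    have h1 := R.mem_fixed.1 (ℛ.map_mem b T' m)
    split_ifs with hik
    · subst hik
      rw [← h1, ← 𝒞.assoc, R.pOver_support, h1]
      rfl
    · rw [← h1, ← R.pOver_support, 𝒞.assoc, ← 𝒞.assoc, ← h.ι_mul, D.frame.mul_of_ne _ hik]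
      have h2 : h.ι a (T := T') 0 = 0 := by
        have := h.ι_smul a (T := T') 0 0
        rwa [zero_smul, zero_smul] at this
      rw [h2, 𝒞.zero_comp]
      exact (Sec.map_zero _).symm)
  exists_lift b T {x} hx := by
    classical
    obtain ⟨T', f, hxT, r, v, w, K, hv, hvw, h1, h2, h3, h4⟩ := R.exists_adapted_dual h𝒪 b T hx
    let ε := Fintype.equivFin {i // K i}
    let s : {i // K i} → Sec (ℛ.E b) T' := fun i ↦ ℛ.lift b T' (v i) (R.mem_fixed.2 (h1 i i.2))
    have hsj : ∀ i, (s i).map (ℛ.j b) = v i := fun i ↦ ℛ.map_lift _ _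
    have hs : IsFrame s := ℛ.isFrame hv h1 h2
    let ϑ := 𝒪.res T'.hom.le (D.root i)
    obtain ⟨t', ht'⟩ : ∃ t', t' * 𝒪.res T'.hom.le (𝒞.trace R.p) = 1 :=
      (R.isUnit_trace.map (𝒪.res T'.hom.le)).exists_left_inv
    have hϑ : t' * ϑ = 1 := by rw [← ht', ← hroot]
    -- `v k w j` lies in `p Γ_aa p = 𝒪 p` and is found from its trace; hence the liftings
    -- `m ↦ θ_a(p) w j m` are inverse to the action on the frame `s`
    have hcomp : ∀ (c : 𝒞.Obj) (m : Sec (ℛ.E c) T') (j k : {i // K i}),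
        𝒞.comp (v k) (𝒞.comp (w j) (m.map (ℛ.j c))) =
          if k = j then t' • m.map (ℛ.j c) else 0 := by
      intro c m j k
      rw [← 𝒞.assoc, R.coeff_mul_trace _ _ (h1 k k.2) (h3 j j.2) ht', hvw, 𝒞.smul_comp,
        R.mem_fixed.1 (ℛ.map_mem c T' m)]
      simp only [← Subtype.ext_iff]
      split_ifs <;> simp
    refine ⟨T', f, hxT, _, s ∘ ε.symm, hs.reindex ε.symm, fun c j m ↦
      ϑ • 𝒞.comp (w (ε.symm j)) (m.map (ℛ.j c)), ?_, ?_, ?_, ?_⟩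
    · intro c j k m
      refine ℛ.injective c T' ?_
      rw [ℛ.map_act, Sec.res_id, 𝒞.comp_smul, Function.comp_apply, hsj, hcomp]
      simp only [EmbeddingLike.apply_eq_iff_eq]
      split_ifs
      · rw [smul_smul, mul_comm, hϑ, one_smul]
      · rw [smul_zero, Sec.map_zero]
    · intro c d j m τ
      dsimp only
      rw [ℛ.map_act, Sec.res_id, 𝒞.smul_comp, 𝒞.assoc]
    · obtain ⟨t, ht⟩ := ((D.frame.isUnit_trace η i).map (𝒪.res T'.hom.le)).exists_left_inv
      have h5 := R.sum_comp_eq D.frame K hv hvw h3 h4 ht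
      have h6 : ∑ j, ϑ • 𝒞.comp (w (ε.symm j)) (((s ∘ ε.symm) j).map (ℛ.j b)) =
          ϑ • ∑ j : {i // K i}, 𝒞.comp (w j) (v j) := by
        rw [← Finset.smul_sum, ← ε.symm.sum_comp (fun j : {i // K i} ↦ 𝒞.comp (w j) (v j))]
        exact congrArg _ (Finset.sum_congr rfl fun j _ ↦ by rw [Function.comp_apply, hsj])
      rw [h6]
      rw [← Finset.sum_filter, Finset.sum_subtype (p := K) _ (by simp)] at h5
      rw [h5, ← hroot, smul_smul]
      have h7 : ϑ * (t * ϑ) = 1 := by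
        rw [← ht, ← D.root_sq, map_mul]; ring
      exact (congrArg (· • _) h7).trans (one_smul _ _)
    · intro j m
      dsimp only
      rw [𝒞.trace_smul]
      refine congrArg (ϑ * ·) ?_
      have h8 := congrArg (Sec.map (ℛ.j b)) ((hs.reindex ε.symm).sum_repr (𝟙 T') m)
      rw [Sec.map_sum] at h8
      rw [← h8, 𝒞.comp_sum, 𝒞.trace_sum, Finset.sum_eq_single j]
      · rw [Sec.map_smul, Sec.map_res, Function.comp_apply, hsj, Sec.res_id, 𝒞.comp_smul,
          𝒞.trace_smul, hvw, if_pos rfl, mul_one]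
      · intro k _ hk
        rw [Sec.map_smul, Sec.map_res, Function.comp_apply, hsj, Sec.res_id, 𝒞.comp_smul,
          𝒞.trace_smul, hvw, if_neg, mul_zero]
        rwa [← Subtype.ext_iff, EmbeddingLike.apply_eq_iff_eq]
      · simp

end RankOneIdempotent

/-! ### The fibre functor of a sheet without labels -/

/-- The zero sheaf. -/
def zeroSheaf (𝒪 : FunctionSheaf M) (U : Opens M) : SheafOfModules.{u} (𝒪.sheaf.over U) :=
  SectionSystem.sheaf (A := fun _ ↦ PUnit)
    { res := fun _ ↦ 0
      res_id := fun _ _ ↦ rfl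
      res_comp := fun _ _ _ ↦ rfl
      res_smul := fun _ _ _ ↦ rfl
      sep := fun _ _ _ ↦ rfl
      glue := fun _ _ _ _ _ ↦ ⟨PUnit.unit, fun _ ↦ rfl⟩ }

instance (T : Over U) : Subsingleton (Sec (zeroSheaf 𝒪 U) T) :=
  inferInstanceAs (Subsingleton PUnit)

lemma zeroSheaf_isFrame (T : Over U) : IsFrame fun i : Fin 0 ↦ (i.elim0 : Sec (zeroSheaf 𝒪 U) T) :=
  fun _ _ _ ↦ ⟨fun i ↦ i.elim0, Subsingleton.elim _ _, fun _ _ ↦ funext fun i ↦ i.elim0⟩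

variable (𝒪 U) in
/-- The zero sheaf as a locally free module. -/
def zeroLF : LF 𝒪 U :=
  ⟨zeroSheaf 𝒪 U, fun x hx ↦ ⟨Over.mk (𝟙 U), hx, 0, _, zeroSheaf_isFrame _⟩⟩

instance (T : Over U) : Subsingleton (Sec (zeroLF 𝒪 U).obj T) :=
  inferInstanceAs (Subsingleton PUnit)

/-- The zero fibre functor, at a sheet whose idempotent acts as zero on all labels. -/
def zeroFibreFunctor {D : RootedFrame η n U} {𝒞 : CYCategory 𝒪 U} {h : CardyStructure η 𝒞}
    {i : Fin n} (h0 : ∀ b, h.ι b (T := Over.mk (𝟙 U)) (D.e i) = 0) : FibreFunctor D h i where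
  E _ := zeroLF 𝒪 U
  act := 0
  act_res _ _ := rfl
  act_id _ _ := LocHom.ext_app fun _ _ _ ↦ Subsingleton.elim _ _
  act_comp _ _ := LocHom.ext_app fun _ _ _ ↦ Subsingleton.elim _ _
  act_ι _ _ _ := LocHom.ext_app fun _ _ _ ↦ Subsingleton.elim _ _
  exists_lift b T x hx := by
    refine ⟨T, 𝟙 T, hx, 0, _, zeroSheaf_isFrame _, fun _ j ↦ j.elim0, ?_, ?_, ?_, ?_⟩
    · exact fun _ _ _ _ ↦ Subsingleton.elim _ _
    · exact fun _ _ j ↦ j.elim0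
    · have h1 := congrArg (Sec.res (toTop T)) (h0 b)
      rw [h.ι_res, Sec.res_zero] at h1
      simpa using h1.symm
    · exact fun j ↦ j.elim0

end RankOne

end

end BraneFibration

namespace BraneFibration

noncomputable section

/-! ### Idempotents of rank one in semisimple algebras -/

section FibreAlgebra

/-- In a semisimple algebra over an algebraically closed field there is below each nonzero central
idempotent an idempotent `p` with `p A p = F p`. -/
lemma exists_rank_one_of_isSemisimpleRing {F A : Type*} [Field F] [IsAlgClosed F] [Ring A]
    [Algebra F A] [FiniteDimensional F A] [IsSemisimpleRing A] {ε : A} (hε : ∀ a, ε * a = a * ε)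
    (hεε : ε * ε = ε) (h0 : ε ≠ 0) :
    ∃ p : A, p ≠ 0 ∧ p * p = p ∧ ε * p = p ∧ ∀ a, ∃ c : F, p * a * p = c • p := by
  obtain ⟨n, d, hd, ⟨Φ⟩⟩ := IsSemisimpleRing.exists_algEquiv_pi_matrix_of_isAlgClosed F A
  obtain ⟨k, hk⟩ : ∃ k, Φ ε k ≠ 0 := by
    by_contra! h
    exact h0 (Φ.injective (by rw [map_zero]; exact funext h))
  have hd := hd k
  -- a nonzero central idempotent of a matrix algebra is the unit matrix
  have h1 : Φ ε k = 1 := by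
    have hc : Φ ε k ∈ Set.center (Matrix (Fin (d k)) (Fin (d k)) F) := by
      rw [Semigroup.mem_center_iff]
      intro B
      have h2 := congrFun (congrArg Φ (hε (Φ.symm (Pi.single k B)))) k
      rw [map_mul, map_mul, AlgEquiv.apply_symm_apply] at h2
      simpa using h2.symm
    obtain ⟨c, hc⟩ : ∃ c : F, c • (1 : Matrix (Fin (d k)) (Fin (d k)) F) = Φ ε k := by
      rw [Matrix.center_eq_range] at hc
      obtain ⟨c, hc⟩ := hc
      exact ⟨c, by rw [← hc, Matrix.scalar_apply, Matrix.smul_one_eq_diagonal]⟩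
    have h3 : Φ ε k * Φ ε k = Φ ε k := by
      conv_rhs => rw [← hεε, map_mul]
      rfl
    rw [← hc, smul_mul_smul_comm, mul_one] at h3
    have h4 := congrFun (congrFun h3 0) 0
    simp only [Matrix.smul_apply, Matrix.one_apply_eq, smul_eq_mul, mul_one] at h4
    have h5 : c ≠ 0 := by
      rintro rfl
      exact hk (by rw [← hc, zero_smul])
    rw [← hc, mul_left_cancel₀ h5 (h4.trans (mul_one c).symm), one_smul]
  -- the idempotent is an elementary matrix in a factor in which `ε` does not vanish
  let P : ∀ i, Matrix (Fin (d i)) (Fin (d i)) F := Pi.single k (Matrix.single 0 0 1)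
  have hP : ∀ B, P * B * P = (B k 0 0) • P := by
    intro B
    funext i
    by_cases hi : i = k
    · subst hi
      simp [P, Matrix.single_mul_mul_single]
    · simp [P, Pi.single_eq_of_ne hi]
  refine ⟨Φ.symm P, ?_, ?_, ?_, ?_⟩
  · rw [Ne, EmbeddingLike.map_eq_zero_iff]
    intro h
    have := congrFun (congrFun (congrFun h k) 0) 0
    simp [P] at this
  · rw [← map_mul]
    congr 1
    have := hP 1
    simpa using this
  · apply Φ.injective
    rw [map_mul, AlgEquiv.apply_symm_apply]
    funext i
    by_cases hi : i = k
    · subst hi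
      rw [Pi.mul_apply, h1, one_mul]
    · simp [P, Pi.single_eq_of_ne hi]
  · intro a
    refine ⟨Φ a k 0 0, Φ.injective ?_⟩
    rw [map_mul, map_mul, AlgEquiv.apply_symm_apply, hP, map_smul, AlgEquiv.apply_symm_apply]

open TensorProduct in
/-- Let `A` be an algebra, free of finite rank over a ring `R` of functions, with a trace `θ` with
perfect trace pairing and orthogonal central idempotents `ε k` such that the Cardy formula
`Tr (y ↦ σ y τ) = ∑ₖ θ(σ εₖ) θ(τ εₖ) tₖ` holds. Then the fibre of `A` at a point is semisimple: if
`σ` is in its Jacobson radical, then the left-hand side vanishes for `σ a εₖ` in the place of both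
`σ` and `τ`, hence `θ(σ a) = 0` for all `a`. In a fibre of `A` at which `ε i` does not vanish there
is therefore an idempotent of rank one below `ε i`. It is given by an element `z` of `A`, whose
coefficients at the point are those of the idempotent, and by the linear form `ℓ` with
`z y z = ℓ(y) z` in the fibre. -/
lemma exists_fibre_rank_one {R A ι κ : Type*} [CommRing R] [Algebra ℂ R] [Ring A] [Algebra R A]
    [Fintype ι] [Fintype κ] [DecidableEq κ] (ev : R →ₐ[ℂ] ℂ) (b : Module.Basis ι R A)
    (θ : A →ₗ[R] R) (ε : κ → A) (t : κ → R) (hθ : ∀ j, ∃ τ, ∀ σ, b.repr σ j = θ (σ * τ))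
    (hε : ∀ k a, ε k * a = a * ε k) (hεε : ∀ k l, ε k * ε l = if k = l then ε k else 0)
    (hsum : ∑ k, ε k = 1) (ht : ∀ k, ev (t k) ≠ 0)
    (htr : ∀ σ τ, LinearMap.trace R A (LinearMap.mulLeftRight R (σ, τ)) =
      ∑ k, θ (σ * ε k) * θ (τ * ε k) * t k) (i : κ) (hi : ∃ j, ev (b.repr (ε i) j) ≠ 0) :
    ∃ (z : A) (ℓ : ι → ℂ), (∀ j k, ev (b.repr (z * b k * z) j) = ev (b.repr z j) * ℓ k) ∧
      ∑ k, ℓ k * ev (b.repr z k) = 1 ∧ (∀ j, ev (b.repr (z * z) j) = ev (b.repr z j)) ∧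
      ∀ j, ev (b.repr (ε i * z) j) = ev (b.repr z j) := by
  let _ : Algebra R ℂ := ev.toRingHom.toAlgebra
  have : Module.Free R A := Module.Free.of_basis b
  have : Module.Finite R A := Module.Finite.of_basis b
  -- `q` is the surjection of `A` onto its fibre; a section is in the kernel iff its coefficients
  -- vanish at the point
  let q : A →ₐ[R] ℂ ⊗[R] A := Algebra.TensorProduct.includeRight
  let b₀ := Algebra.TensorProduct.basis ℂ b
  have hq : ∀ a j, b₀.repr (q a) j = ev (b.repr a j) := by
    intro a j
    change (Algebra.TensorProduct.basis ℂ b).repr (1 ⊗ₜ[R] a) j = _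
    rw [Algebra.TensorProduct.basis_repr_tmul, one_smul]
    rfl
  have hsurj : ∀ y, ∃ a, q a = y := by
    intro y
    refine ⟨∑ j, algebraMap ℂ R (b₀.repr y j) • b j, b₀.ext_elem fun j ↦ ?_⟩
    rw [hq, b.repr_sum_self, AlgHom.commutes]
    rfl
  have hθ0 : ∀ σ, (∀ τ, ev (θ (σ * τ)) = 0) → q σ = 0 := by
    intro σ h
    refine b₀.ext_elem fun j ↦ ?_
    obtain ⟨τ, hτ⟩ := hθ j
    rw [hq, hτ, h, map_zero]
    rfl
  have hfd : FiniteDimensional ℂ (ℂ ⊗[R] A) := Module.Finite.of_basis b₀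
  have hart : IsArtinianRing (ℂ ⊗[R] A) := IsArtinianRing.of_finite ℂ _
  -- elements of the Jacobson radical have trace zero with everything, hence vanish
  have hss : IsSemisimpleRing (ℂ ⊗[R] A) := by
    rw [IsArtinianRing.isSemisimpleRing_iff_jacobson, eq_bot_iff]
    intro y hy
    obtain ⟨σ, rfl⟩ := hsurj y
    refine (Submodule.mem_bot _).2 (hθ0 σ fun τ ↦ ?_)
    have hnil : ∀ k, IsNilpotent (q (σ * τ * ε k)) := by
      intro k
      obtain ⟨N, hN⟩ := IsSemiprimaryRing.isNilpotent (R := ℂ ⊗[R] A)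
      have h1 : q (σ * τ * ε k) ∈ Ring.jacobson (ℂ ⊗[R] A) := by
        rw [mul_assoc, map_mul]
        exact Ideal.mul_mem_right _ _ hy
      exact ⟨N, by simpa [hN] using Ideal.pow_mem_pow h1 N⟩
    have h2 : ∀ k, ev (θ (σ * τ * ε k)) = 0 := by
      intro k
      -- `y ↦ s y s` is nilpotent on the fibre for `s = σ τ εₖ`, and by the Cardy formula its trace is
      -- `θ(s)² tₖ`
      have h3 : LinearMap.baseChange ℂ
          (LinearMap.mulLeftRight R (σ * τ * ε k, σ * τ * ε k)) =
          LinearMap.mulLeft ℂ (q (σ * τ * ε k)) ∘ₗ LinearMap.mulRight ℂ (q (σ * τ * ε k)) := by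
        refine b₀.ext fun j ↦ ?_
        rw [Algebra.TensorProduct.basis_apply, LinearMap.baseChange_tmul, LinearMap.comp_apply,
          LinearMap.mulRight_apply, LinearMap.mulLeft_apply, LinearMap.mulLeftRight_apply]
        change q _ = q _ * (q _ * q _)
        rw [← map_mul, ← map_mul, mul_assoc]
      have h4 := LinearMap.trace_baseChange
        (LinearMap.mulLeftRight R (σ * τ * ε k, σ * τ * ε k)) ℂ
      rw [htr, h3, Finset.sum_eq_single k, mul_assoc _ (ε k), hεε, if_pos rfl] at h4
      · have h5 : IsNilpotent (LinearMap.mulLeft ℂ (q (σ * τ * ε k)) ∘ₗ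
            LinearMap.mulRight ℂ (q (σ * τ * ε k))) := by
          refine Commute.isNilpotent_mul_right (LinearMap.commute_mulLeft_right _ _) ?_
          rw [LinearMap.isNilpotent_mulLeft_iff]
          exact hnil k
        rw [(LinearMap.isNilpotent_trace_of_isNilpotent h5).eq_zero] at h4
        change 0 = ev _ at h4
        rw [map_mul, map_mul] at h4
        simpa [ht k] using h4.symm
      · intro l _ hl
        rw [mul_assoc _ (ε k), hεε, if_neg hl.symm, mul_zero, map_zero, zero_mul, zero_mul]
      · simp
    rw [← mul_one (σ * τ), ← hsum, Finset.mul_sum, map_sum, map_sum]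
    exact Finset.sum_eq_zero fun k _ ↦ h2 k
  obtain ⟨p, hp0, hpp, hεp, hpa⟩ := exists_rank_one_of_isSemisimpleRing (F := ℂ) (ε := q (ε i))
    (fun y ↦ by
      obtain ⟨a, rfl⟩ := hsurj y
      rw [← map_mul, ← map_mul, hε])
    (by rw [← map_mul, hεε, if_pos rfl])
    (by
      obtain ⟨j, hj⟩ := hi
      intro h
      refine hj ?_
      rw [← hq, h, map_zero]
      rfl)
  obtain ⟨z, rfl⟩ := hsurj p
  choose ℓ hℓ using fun k ↦ hpa (q (b k))
  have hz : q z = ∑ k, ev (b.repr z k) • q (b k) := by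
    refine b₀.ext_elem fun j ↦ ?_
    have : ∑ k, ev (b.repr z k) • q (b k) = ∑ k, ev (b.repr z k) • b₀ k :=
      Finset.sum_congr rfl fun k _ ↦ by rw [Algebra.TensorProduct.basis_apply]; rfl
    rw [this, b₀.repr_sum_self, hq]
  refine ⟨z, ℓ, fun j k ↦ ?_, ?_, fun j ↦ ?_, fun j ↦ ?_⟩
  · rw [← hq, map_mul q, map_mul q, hℓ, map_smul, Finsupp.smul_apply, hq, smul_eq_mul, mul_comm]
  · have h1 : (∑ k, ℓ k * ev (b.repr z k)) • q z = (1 : ℂ) • q z := by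
      have h2 : q z = q z * q z * q z := by rw [hpp, hpp]
      conv_rhs => rw [one_smul, h2]
      conv_rhs => arg 1; arg 2; rw [hz]
      rw [Finset.mul_sum, Finset.sum_mul, Finset.sum_smul]
      refine Finset.sum_congr rfl fun k _ ↦ ?_
      rw [mul_smul_comm, smul_mul_assoc, hℓ, smul_smul, mul_comm]
    exact smul_left_injective ℂ hp0 h1
  · rw [← hq, map_mul q, hpp, hq]
  · rw [← hq, map_mul q, hεp, hq]

end FibreAlgebra

end

end BraneFibration

namespace BraneFibration

noncomputable section

/-! ### Implicit functions on manifolds -/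

section Implicit

open Topology

/-- The implicit function theorem, with an implicit function of the same class in a neighbourhood
of the point. -/
lemma exists_implicit {𝕜 : Type*} [RCLike 𝕜] {P H : Type*} [NormedAddCommGroup P]
    [NormedSpace 𝕜 P] [CompleteSpace P] [NormedAddCommGroup H] [NormedSpace 𝕜 H] [CompleteSpace H]
    {k : WithTop ℕ∞} (hk : 1 ≤ k) {G : P × H → H} (hG : ContDiff 𝕜 k G) {p₀ : P} {h₀ : H}
    (h0 : G (p₀, h₀) = 0) (L : H ≃L[𝕜] H)
    (hL : HasFDerivAt (fun h ↦ G (p₀, h)) (L : H →L[𝕜] H) h₀) :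
    ∃ (ψ : P → H) (W : Set P), IsOpen W ∧ p₀ ∈ W ∧ ψ p₀ = h₀ ∧ ContDiffOn 𝕜 k ψ W ∧
      ∀ p ∈ W, G (p, ψ p) = 0 := by
  -- the inverse function theorem is applied to `(p, h) ↦ (p, G (p, h))`
  let Ψ : P × H → P × H := fun u ↦ (u.1, G u)
  have hk0 : k ≠ 0 := by
    rintro rfl
    simp at hk
  have hΨ : ContDiff 𝕜 k Ψ := contDiff_fst.prodMk hG
  have hd : Differentiable 𝕜 G := hG.differentiable hk0
  let D := fderiv 𝕜 G (p₀, h₀)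
  have hD : HasFDerivAt G D (p₀, h₀) := (hd _).hasFDerivAt
  have hD2 : ∀ w, D (0, w) = L w := by
    intro w
    have h1 : HasFDerivAt (fun h ↦ G (p₀, h)) (D.comp (ContinuousLinearMap.inr 𝕜 P H)) h₀ :=
      hD.comp h₀ (hasFDerivAt_prodMk_right p₀ h₀)
    exact congrArg (fun f : H →L[𝕜] H ↦ f w) (h1.unique hL)
  have hDadd : ∀ v w, D (v, w) = D (v, 0) + L w := by
    intro v w
    rw [← hD2, ← map_add]
    simp
  let A : (P × H) ≃L[𝕜] (P × H) := ContinuousLinearEquiv.equivOfInverse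
    ((ContinuousLinearMap.fst 𝕜 P H).prod D)
    ((ContinuousLinearMap.fst 𝕜 P H).prod ((L.symm : H →L[𝕜] H).comp
      (ContinuousLinearMap.snd 𝕜 P H - D.comp ((ContinuousLinearMap.inl 𝕜 P H).comp
        (ContinuousLinearMap.fst 𝕜 P H)))))
    (fun u ↦ by
      refine Prod.ext rfl ?_
      change L.symm (D (u.1, u.2) - D (u.1, 0)) = u.2
      rw [hDadd, add_sub_cancel_left, L.symm_apply_apply])
    (fun u ↦ by
      refine Prod.ext rfl ?_
      change D (u.1, L.symm (u.2 - D (u.1, 0))) = u.2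
      rw [hDadd, L.apply_symm_apply, add_sub_cancel])
  have hA : HasFDerivAt Ψ (A : (P × H) →L[𝕜] (P × H)) (p₀, h₀) := hasFDerivAt_fst.prodMk hD
  let e := hΨ.contDiffAt.toOpenPartialHomeomorph Ψ hA hk0
  have he : ∀ u, e u = Ψ u := fun _ ↦ rfl
  -- the local inverse is of class `k` at each point at which the derivative of `Ψ` is invertible, and
  -- `S` is the open set of these points
  let S : Set (P × H) := fderiv 𝕜 Ψ ⁻¹'
    Set.range fun A : (P × H) ≃L[𝕜] (P × H) ↦ (A : (P × H) →L[𝕜] (P × H))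
  have hS : IsOpen S := ContinuousLinearEquiv.isOpen.preimage (hΨ.continuous_fderiv hk0)
  have hmem : (p₀, h₀) ∈ e.source := hΨ.contDiffAt.mem_toOpenPartialHomeomorph_source hA hk0
  have hp₀ : Ψ (p₀, h₀) = (p₀, 0) := Prod.ext rfl h0
  have hsymm : e.symm (p₀, 0) = (p₀, h₀) := by
    rw [← hp₀, ← he, e.left_inv hmem]
  refine ⟨fun p ↦ (e.symm (p, 0)).2, (fun p : P ↦ (p, (0 : H))) ⁻¹' (e.target ∩ e.symm ⁻¹' S),
    (e.symm.isOpen_inter_preimage hS).preimage (by fun_prop), ⟨?_, ?_⟩, ?_, ?_, ?_⟩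
  · change (p₀, 0) ∈ e.target
    rw [← hp₀]
    exact e.map_source hmem
  · change e.symm (p₀, 0) ∈ S
    rw [hsymm]
    exact ⟨A, hA.fderiv.symm⟩
  · dsimp only
    rw [hsymm]
  · rintro p ⟨hp, A', hA'⟩
    have h1 : HasFDerivAt e (A' : (P × H) →L[𝕜] (P × H)) (e.symm (p, 0)) := by
      have h0 : (A' : (P × H) →L[𝕜] (P × H)) = fderiv 𝕜 Ψ (e.symm (p, 0)) := hA'
      rw [h0]
      exact ((hΨ.differentiable hk0) _).hasFDerivAt
    have h2 : ContDiffAt 𝕜 k e.symm (p, (0 : H)) := e.contDiffAt_symm hp h1 hΨ.contDiffAt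
    have h3 : ContDiffAt 𝕜 k (fun p : P ↦ (p, (0 : H))) p := by fun_prop
    exact (h2.comp p h3).snd.contDiffWithinAt
  · rintro p ⟨hp, -⟩
    have h1 : Ψ (e.symm (p, 0)) = (p, 0) := e.right_inv hp
    have h2 : (e.symm (p, 0)).1 = p := congrArg Prod.fst h1
    have h3 : G (e.symm (p, 0)) = 0 := congrArg Prod.snd h1
    refine Eq.trans ?_ h3
    exact congrArg G (Prod.ext h2.symm rfl)

variable {𝕜 : Type*} [RCLike 𝕜] {E : Type*} [NormedAddCommGroup E] [NormedSpace 𝕜 E]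
  {k : WithTop ℕ∞} {M : Type u} [TopologicalSpace M] [ChartedSpace E M]

/-- Implicit functions of functions on a manifold. -/
lemma exists_implicit_contMDiff {P H : Type*} [NormedAddCommGroup P]
    [NormedSpace 𝕜 P] [CompleteSpace P] [NormedAddCommGroup H] [NormedSpace 𝕜 H] [CompleteSpace H]
    (hk : 1 ≤ k) {G : P × H → H} (hG : ContDiff 𝕜 k G) {U : Opens M} {f : U → P}
    (hf : ContMDiff 𝓘(𝕜, E) 𝓘(𝕜, P) k f) (x : U) {h₀ : H} (h0 : G (f x, h₀) = 0) (L : H ≃L[𝕜] H)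
    (hL : HasFDerivAt (fun h ↦ G (f x, h)) (L : H →L[𝕜] H) h₀) :
    ∃ (V : Opens M) (h : V ≤ U) (hx : (x : M) ∈ V) (g : V → H), g ⟨x, hx⟩ = h₀ ∧
      ContMDiff 𝓘(𝕜, E) 𝓘(𝕜, H) k g ∧ ∀ y : V, G (f ⟨y, h y.2⟩, g y) = 0 := by
  obtain ⟨ψ, W, hW, hxW, hψ, hψW, hGψ⟩ := exists_implicit hk hG h0 L hL
  let V : Opens M :=
    ⟨Subtype.val '' (f ⁻¹' W), U.2.isOpenMap_subtype_val _ (hW.preimage hf.continuous)⟩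
  have hV : V ≤ U := by
    rintro _ ⟨y, -, rfl⟩
    exact y.2
  have hVW : ∀ y : V, f ⟨y, hV y.2⟩ ∈ W := by
    rintro ⟨_, y, hy, rfl⟩
    exact hy
  have hfV : ContMDiff 𝓘(𝕜, E) 𝓘(𝕜, P) k fun y : V ↦ f ⟨y, hV y.2⟩ :=
    hf.comp (contMDiff_inclusion hV)
  refine ⟨V, hV, ⟨x, hxW, rfl⟩, fun y ↦ ψ (f ⟨y, hV y.2⟩), hψ, fun y ↦ ?_, fun y ↦ hGψ _ (hVW y)⟩
  exact ((hψW.contDiffAt (hW.mem_nhds (hVW y))).contMDiffAt).comp y (hfV y)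

end Implicit

namespace FunctionSheaf

variable {M : Type u} [TopologicalSpace M] (𝒪 : FunctionSheaf M)

/-- Functions which do not vanish at a point have square roots around it. -/
def HasLocalRoots : Prop :=
  ∀ (U : Opens M) (f : 𝒪.sec U) (x : U), f.1 x ≠ 0 →
    ∃ (V : Opens M) (h : V ≤ U), (x : M) ∈ V ∧ ∃ g : 𝒪.sec V, g * g = 𝒪.res h f

/-- A matrix of functions which is at a point a projector `v₀ ⊗ ℓ` of rank one has around this
point an eigenvector `v` with value `v₀`, with eigenvalue `ℓ(v)`. -/
def HasLocalEigenvectors : Prop :=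
  ∀ (U : Opens M) (r : ℕ) (Z : Matrix (Fin r) (Fin r) (𝒪.sec U)) (x : U) (v₀ ℓ : Fin r → ℂ),
    (∀ i j, (Z i j).1 x = v₀ i * ℓ j) → ∑ j, ℓ j * v₀ j = 1 →
    ∃ (V : Opens M) (h : V ≤ U) (hx : (x : M) ∈ V) (v : Fin r → 𝒪.sec V),
      (∀ i, (v i).1 ⟨x, hx⟩ = v₀ i) ∧
      ∀ i, ∑ j, 𝒪.res h (Z i j) * v j = (∑ j, algebraMap ℂ _ (ℓ j) * v j) * v i

/-- The functions are continuous. -/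
def IsContinuous : Prop := ∀ (U : Opens M) (f : 𝒪.sec U), Continuous f.1

end FunctionSheaf

/-! ### Implicit functions in the structure sheaf -/

section StructureSheaf

variable {𝕜 : Type*} [RCLike 𝕜] [NormedAlgebra 𝕜 ℂ] {E : Type*} [NormedAddCommGroup E]
  [NormedSpace 𝕜 E] {k : WithTop ℕ∞} {M : Type u} [TopologicalSpace M] [ChartedSpace E M]

lemma structureSheaf_isContinuous : (structureSheaf 𝕜 E k M).IsContinuous :=
  fun _ f ↦ ContMDiff.continuous (I := 𝓘(𝕜, E)) (I' := 𝓘(𝕜, ℂ)) f.2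

variable (𝕜) in
/-- Multiplication by a nonzero complex number. -/
def mulEquiv (c : ℂ) (hc : c ≠ 0) : ℂ ≃L[𝕜] ℂ :=
  ContinuousLinearEquiv.equivOfInverse (ContinuousLinearMap.mul 𝕜 ℂ c)
    (ContinuousLinearMap.mul 𝕜 ℂ c⁻¹) (fun w ↦ by simp [hc]) (fun w ↦ by simp [hc])

lemma structureSheaf_hasLocalInverses (hk : 1 ≤ k) :
    (structureSheaf 𝕜 E k M).HasLocalInverses := by
  intro U f x hx
  obtain ⟨V, h, hxV, g, -, hg, hfg⟩ := exists_implicit_contMDiff (𝕜 := 𝕜) (E := E) hk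
    (G := fun u : ℂ × ℂ ↦ u.1 * u.2 - 1) (h₀ := (f.1 x)⁻¹) (by fun_prop) f.2 x
    (by simp [hx]) (mulEquiv 𝕜 (f.1 x) hx) (by
      exact ((ContinuousLinearMap.mul 𝕜 ℂ (f.1 x)).hasFDerivAt).sub_const 1)
  refine ⟨V, h, hxV, IsUnit.of_mul_eq_one ⟨g, hg⟩ (Subtype.ext (funext fun y ↦ ?_))⟩
  exact sub_eq_zero.1 (hfg y)

lemma structureSheaf_hasLocalRoots (hk : 1 ≤ k) : (structureSheaf 𝕜 E k M).HasLocalRoots := by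
  intro U f x hx
  obtain ⟨s, hs⟩ := IsSquare.exists_sq (f.1 x) (IsAlgClosed.exists_eq_mul_self (f.1 x))
  have hs0 : 2 * s ≠ 0 := by
    intro h
    rw [hs] at hx
    simp_all
  obtain ⟨V, h, hxV, g, -, hg, hfg⟩ := exists_implicit_contMDiff (𝕜 := 𝕜) (E := E) hk
    (G := fun u : ℂ × ℂ ↦ u.2 * u.2 - u.1) (h₀ := s) (by fun_prop) f.2 x
    (by dsimp only; rw [hs]; ring) (mulEquiv 𝕜 (2 * s) hs0) (by
      have h1 := (((hasFDerivAt_id (𝕜 := 𝕜) s).mul (hasFDerivAt_id s)).sub_const (f.1 x))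
      convert! h1 using 1
      ext w
      change 2 * s * w = s * w + s * w
      ring)
  refine ⟨V, h, hxV, ⟨g, hg⟩, Subtype.ext (funext fun y ↦ ?_)⟩
  exact sub_eq_zero.1 (hfg y)

lemma structureSheaf_hasLocalEigenvectors (hk : 1 ≤ k) :
    (structureSheaf 𝕜 E k M).HasLocalEigenvectors := by
  intro U r Z x v₀ ℓ hZ hℓ
  have hZij : ∀ i j, ContMDiff 𝓘(𝕜, E) 𝓘(𝕜, ℂ) k (Z i j).1 := fun i j ↦ (Z i j).2
  have hZi : ∀ i, ContMDiff 𝓘(𝕜, E) 𝓘(𝕜, Fin r → ℂ) k fun y j ↦ (Z i j).1 y := fun i ↦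
    contMDiff_pi_space.2 (hZij i)
  have hZ' : ContMDiff 𝓘(𝕜, E) 𝓘(𝕜, Fin r → Fin r → ℂ) k fun y i j ↦ (Z i j).1 y :=
    contMDiff_pi_space.2 hZi
  obtain ⟨V, h, hxV, g, hgx, hg, hfg⟩ := exists_implicit_contMDiff (𝕜 := 𝕜) (E := E) hk
    (P := Fin r → Fin r → ℂ) (H := Fin r → ℂ)
    -- the equation `Z v = ℓ(v) v` is solved for `v`, with the matrix `Z` as the parameter
    (G := fun u i ↦ ∑ j, u.1 i j * u.2 j - (∑ j, ℓ j * u.2 j) * u.2 i) (U := U) (h₀ := v₀)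
    (f := fun y i j ↦ (Z i j).1 y) (by
      refine contDiff_pi.2 fun i ↦ ?_
      fun_prop)
    hZ' x
    (by
      funext i
      dsimp only
      simp only [hZ, mul_assoc, ← Finset.mul_sum, hℓ]
      simp)
    (ContinuousLinearEquiv.neg 𝕜) (by
      -- the derivative is `w ↦ ℓ(w) v₀ - ℓ(w) v₀ - ℓ(v₀) w = -w`
      refine hasFDerivAt_pi'.2 fun i ↦ ?_
      let Λ : (Fin r → ℂ) →L[𝕜] ℂ :=
        ∑ j, (ContinuousLinearMap.mul 𝕜 ℂ (ℓ j)).comp (ContinuousLinearMap.proj j)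
      have hΛ : ∀ w, Λ w = ∑ j, ℓ j * w j := fun w ↦ by simp [Λ]
      have h1 := (Λ.hasFDerivAt (x := v₀)).mul ((ContinuousLinearMap.proj (R := 𝕜)
        (φ := fun _ : Fin r ↦ ℂ) i).hasFDerivAt (x := v₀) |>.const_sub (v₀ i))
      convert! h1 using 1
      · funext v
        simp only [hZ, mul_assoc, ← Finset.mul_sum, Pi.mul_apply, hΛ]
        change _ = (∑ j, ℓ j * v j) * (v₀ i - v i)
        ring
      · ext w
        change - w i = Λ v₀ * (- w i) + (v₀ i - v₀ i) * Λ w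
        rw [hΛ, hℓ]
        ring)
  have hgi : ∀ i, ContMDiff 𝓘(𝕜, E) 𝓘(𝕜, ℂ) k fun y ↦ g y i :=
    (contMDiff_pi_space (𝕜 := 𝕜) (I := 𝓘(𝕜, E)) (φ := g)).1 hg
  refine ⟨V, h, hxV, fun i ↦ ⟨fun y ↦ g y i, hgi i⟩,
    fun i ↦ congrFun hgx i, fun i ↦ Subtype.ext (funext fun y ↦ ?_)⟩
  have h1 := sub_eq_zero.1 (congrFun (hfg y) i)
  have hsum : ∀ (φ : Fin r → (structureSheaf 𝕜 E k M).sec V),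
      (∑ j, φ j).1 y = ∑ j, (φ j).1 y := fun φ ↦
    map_sum (FunctionSheaf.eval (𝒪 := structureSheaf 𝕜 E k M) y) φ _
  change (∑ j, _ : (structureSheaf 𝕜 E k M).sec V).1 y =
    (∑ j, _ : (structureSheaf 𝕜 E k M).sec V).1 y * g y i
  rw [hsum, hsum]
  exact h1

end StructureSheaf

end

end BraneFibration

namespace BraneFibration

noncomputable section

/-! ### Values at a point and the algebra of endomorphisms -/

section Values

variable {M : Type u} [TopologicalSpace M] {𝒪 : FunctionSheaf M} {U : Opens M}
  {N N' : SheafOfModules.{u} (𝒪.sheaf.over U)} {T T' : Over U} {ι ι' : Type*} [Fintype ι]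
  [Fintype ι'] {s : ι → Sec N T} {s' : ι' → Sec N' T}

/-- The values at a point of the coefficients of a section with respect to a frame. -/
def IsFrame.value (hs : IsFrame s) (x : T.left) (m : Sec N T) (j : ι) : ℂ :=
  FunctionSheaf.eval x ((hs.basis (𝟙 T)).repr m j)

namespace IsFrame

lemma value_add (hs : IsFrame s) (x : T.left) (m m' : Sec N T) (j : ι) :
    hs.value x (m + m') j = hs.value x m j + hs.value x m' j := by
  simp only [value, map_add, Finsupp.add_apply]

lemma value_sub (hs : IsFrame s) (x : T.left) (m m' : Sec N T) (j : ι) :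
    hs.value x (m - m') j = hs.value x m j - hs.value x m' j := by
  simp only [value, map_sub, Finsupp.sub_apply]

lemma value_smul (hs : IsFrame s) (x : T.left) (c : 𝒪.sec T.left) (m : Sec N T) (j : ι) :
    hs.value x (c • m) j = c.1 x * hs.value x m j := by
  simp only [value, map_smul, Finsupp.smul_apply, smul_eq_mul, map_mul, FunctionSheaf.eval_apply]

lemma value_self [DecidableEq ι] (hs : IsFrame s) (x : T.left) (i j : ι) :
    hs.value x (s i) j = if j = i then 1 else 0 := by
  have h1 : s i = (hs.basis (𝟙 T)) i := by rw [hs.basis_apply, Sec.res_id]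
  rw [value, h1, Module.Basis.repr_self, Finsupp.single_apply]
  simp only [eq_comm]
  split_ifs <;> simp

/-- Linear maps take sections which vanish at a point to sections which vanish at this point. -/
lemma value_map_eq_zero (hs : IsFrame s) (hs' : IsFrame s') (x : T.left)
    (φ : Sec N T →ₗ[𝒪.sec T.left] Sec N' T) {m : Sec N T} (hm : ∀ j, hs.value x m j = 0) (j : ι') :
    hs'.value x (φ m) j = 0 := by
  rw [← hs.sum_repr (𝟙 T) m]
  simp only [value, map_sum, map_smul, Finsupp.finsetSum_apply, Finsupp.smul_apply, smul_eq_mul,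
    map_mul]
  exact Finset.sum_eq_zero fun i _ ↦ by
    have := hm i
    rw [value] at this
    rw [this, zero_mul]

lemma value_res (hs : IsFrame s) (f : T' ⟶ T) (x : T'.left) (m : Sec N T) (j : ι) :
    (hs.restrict f).value x (m.res f) j = hs.value ⟨x, f.left.le x.2⟩ m j := by
  have h1 : ⇑(((hs.restrict f).basis (𝟙 T')).repr (m.res f)) =
      fun j ↦ 𝒪.res f.left.le ((hs.basis (𝟙 T)).repr m j) := by
    refine (hs.restrict f).repr_eq (𝟙 T') ?_
    conv_lhs => rw [← hs.sum_repr (𝟙 T) m]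
    simp only [Sec.res_sum, Sec.res_smul, Sec.res_id]
  rw [value, h1]
  rfl

/-- A local endomorphism which is the identity at a point is injective around it. -/
lemma exists_injective (h𝒪 : 𝒪.HasLocalInverses) [DecidableEq ι] (hs : IsFrame s)
    (φ : LocHom N N T) (x : T.left)
    (h : ∀ i j, hs.value x (φ.app (𝟙 T) (s j)) i = if i = j then 1 else 0) :
    ∃ (T' : Over U) (f : T' ⟶ T), (x : M) ∈ T'.left ∧ ∀ (T'' : Over U) (g : T'' ⟶ T'),
      Function.Injective (φ.app (g ≫ f)) := by
  obtain ⟨T', f, hx, hv⟩ := hs.exists_isFrame_res h𝒪 (fun j ↦ φ.app (𝟙 T) (s j)) x (by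
    have : ((hs.basis (𝟙 T)).toMatrix fun j ↦ φ.app (𝟙 T) (s j)).map
        (FunctionSheaf.eval x) = 1 := by
      ext i j
      rw [Matrix.map_apply, Module.Basis.toMatrix_apply, Matrix.one_apply]
      exact h i j
    rw [this, Matrix.det_one]
    exact one_ne_zero)
  refine ⟨T', f, hx, fun T'' g ↦ (injective_iff_map_eq_zero _).2 fun m hm ↦ ?_⟩
  rw [← hs.sum_repr (g ≫ f) m] at hm ⊢
  rw [map_sum] at hm
  have h1 := (hv T'' g 0).unique (y₁ := fun j ↦ (hs.basis (g ≫ f)).repr m j) (y₂ := 0) (by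
    dsimp only
    rw [← hm]
    refine Finset.sum_congr rfl fun j _ ↦ ?_
    rw [map_smul, φ.app_res' (𝟙 T), Sec.res_res]) (by simp)
  refine Finset.sum_eq_zero fun j _ ↦ ?_
  rw [show (hs.basis (g ≫ f)).repr m j = 0 from congrFun h1 j, zero_smul]

end IsFrame

end Values

section EndSec

variable {M : Type u} [TopologicalSpace M] {𝒪 : FunctionSheaf M} {U : Opens M}

/-- The sections of `Γ_aa` over `T`, as an algebra. The product is composition in diagrammatic
order. -/
def EndSec (𝒞 : CYCategory 𝒪 U) (a : 𝒞.Obj) (T : Over U) : Type u := Sec (𝒞.Hom a a) T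

variable {𝒞 : CYCategory 𝒪 U} {a : 𝒞.Obj} {T T' T'' : Over U}

instance : Ring (EndSec 𝒞 a T) where
  __ := (inferInstance : AddCommGroup (Sec (𝒞.Hom a a) T))
  mul := 𝒞.comp
  one := 𝒞.id a T
  left_distrib := 𝒞.comp_add
  right_distrib := 𝒞.add_comp
  zero_mul := 𝒞.zero_comp
  mul_zero := 𝒞.comp_zero
  mul_assoc := 𝒞.assoc
  one_mul := 𝒞.id_comp
  mul_one := 𝒞.comp_id

instance : Algebra (𝒪.sec T.left) (EndSec 𝒞 a T) :=
  let _ : Module (𝒪.sec T.left) (EndSec 𝒞 a T) :=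
    inferInstanceAs (Module (𝒪.sec T.left) (Sec (𝒞.Hom a a) T))
  Algebra.ofModule 𝒞.smul_comp fun r σ τ ↦ 𝒞.comp_smul r σ τ

namespace CYCategory

/-- An idempotent endomorphism which vanishes at a point vanishes around it. -/
lemma exists_res_eq_zero (h𝒪 : 𝒪.HasLocalInverses) {ι : Type*} [Fintype ι]
    {s : ι → Sec (𝒞.Hom a a) T} (hs : IsFrame s) (x : T.left) {p : Sec (𝒞.Hom a a) T}
    (hp : 𝒞.comp p p = p) (h0 : ∀ j, hs.value x p j = 0) :
    ∃ (T' : Over U) (f : T' ⟶ T), (x : M) ∈ T'.left ∧ p.res f = 0 := by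
  classical
  let φ : LocHom (𝒞.Hom a a) (𝒞.Hom a a) T :=
    { app := fun {T'} f ↦ LinearMap.id - 𝒞.compₗ a a a T' (p.res f)
      app_res := fun f g m ↦ by
        change m.res g - 𝒞.comp (p.res (g ≫ f)) (m.res g) = (m - 𝒞.comp (p.res f) m).res g
        rw [Sec.res_sub, 𝒞.comp_res, Sec.res_res] }
  have hφ : ∀ {T' : Over U} (f : T' ⟶ T) m, φ.app f m = m - 𝒞.comp (p.res f) m := fun _ _ ↦ rfl
  obtain ⟨T', f, hx, hinj⟩ := hs.exists_injective h𝒪 φ x (fun i j ↦ by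
    rw [hφ, Sec.res_id, hs.value_sub, hs.value_self]
    exact (congrArg _ (hs.value_map_eq_zero hs x ((𝒞.compₗ a a a T).flip (s j)) h0 i)).trans
      (sub_zero _))
  refine ⟨T', f, hx, hinj T' (𝟙 T') ?_⟩
  rw [map_zero, hφ, Category.id_comp, ← 𝒞.comp_res, hp, sub_self]

end CYCategory

/-- Let `w` be an eigenvector of `m ↦ z m z` with one-dimensional eigenspace. Then `w A w` is
contained in this eigenspace, since `z w` and `w z` are multiples of `w`. -/
lemma exists_mul_mul_eq_smul {R A : Type*} [CommRing R] [Ring A] [Algebra R A] {z w : A} {c : R}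
    (h : z * w * z = c • w) (hw : ∀ m, z * m * z = c • m → ∃ d : R, m = d • w) (σ : A) :
    ∃ d : R, w * σ * w = d • w := by
  obtain ⟨α, hα⟩ := hw (z * w) (by rw [mul_assoc z (z * w), h, mul_smul_comm])
  obtain ⟨β, hβ⟩ := hw (w * z) (by rw [← mul_assoc, h, smul_mul_assoc])
  refine hw _ ?_
  calc z * (w * σ * w) * z = (z * w) * σ * (w * z) := by simp only [mul_assoc]
    _ = (α • β • w) * σ * w := by
      rw [hα, hβ, mul_smul_comm, smul_mul_assoc, smul_mul_assoc, smul_mul_assoc, smul_mul_assoc,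
        smul_mul_assoc, smul_mul_assoc, smul_comm]
    _ = c • (w * σ * w) := by
      have : α • β • w = c • w := by
        rw [← h, mul_assoc, hβ, mul_smul_comm, hα, smul_comm]
      rw [this, smul_mul_assoc, smul_mul_assoc]

end EndSec

section LocalRankOne

variable {M : Type u} [TopologicalSpace M] {𝒪 : FunctionSheaf M} {𝒯 : TangentMultiplication 𝒪}
  {η : InvariantMetric 𝒯} {U : Opens M} {n : ℕ} {𝒞 : CYCategory 𝒪 U} {h : CardyStructure η 𝒞}
  {a : 𝒞.Obj} {T : Over U} {e : Fin n → 𝒯.Sec U} (he : 𝒯.IsIdempotentFrame e)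

include he in
lemma InvariantMetric.trace_mul (T : Over U) (X Y : 𝒯.Sec T.left) : η.trace (X * Y) =
    ∑ k, he.coeff T.hom.le X k * he.coeff T.hom.le Y k * 𝒪.res T.hom.le (η.trace (e k)) := by
  conv_lhs => rw [← he.sum_coeff T.hom.le Y]
  rw [Finset.mul_sum, η.trace_sum]
  refine Finset.sum_congr rfl fun k _ ↦ ?_
  rw [mul_smul_comm, η.trace_smul, η.trace_mul_idempotent he]
  ring

include he in
/-- The Cardy condition computes the trace of `y ↦ σ y τ`. -/
lemma CardyStructure.trace_comp_comp {r : ℕ} {s t : Fin r → Sec (𝒞.Hom a a) T} (hs : IsFrame s)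
    (hst : ∀ i j, 𝒞.trace (𝒞.comp (t j) (s i)) = if i = j then 1 else 0)
    {u : Fin n → 𝒪.sec T.left} (hu : ∀ k, u k * 𝒪.res T.hom.le (η.trace (e k)) = 1)
    (σ τ : Sec (𝒞.Hom a a) T) :
    ∑ j, 𝒞.trace (𝒞.comp (t j) (𝒞.comp (𝒞.comp σ (s j)) τ)) =
      ∑ k, 𝒞.trace (𝒞.comp σ (h.ι a (𝒯.res T.hom.le (e k)))) *
        𝒞.trace (𝒞.comp τ (h.ι a (𝒯.res T.hom.le (e k)))) * u k := by
  have h1 : ∑ j, 𝒞.trace (𝒞.comp (t j) (𝒞.comp (𝒞.comp σ (s j)) τ)) =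
      η.trace (h.ι' a τ * h.ι' a σ) := by
    rw [h.adjoint, ← h.cardy s t hs hst σ, 𝒞.sum_comp, 𝒞.trace_sum]
    simp only [𝒞.assoc]
  rw [h1, InvariantMetric.trace_mul he]
  refine Finset.sum_congr rfl fun k _ ↦ ?_
  have h2 : ∀ σ, 𝒞.trace (𝒞.comp σ (h.ι a (𝒯.res T.hom.le (e k)))) =
      he.coeff T.hom.le (h.ι' a σ) k * 𝒪.res T.hom.le (η.trace (e k)) := fun σ ↦ by
    rw [← h.central, ← h.adjoint, η.trace_mul_idempotent he]
  rw [h2, h2]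
  linear_combination (-he.coeff T.hom.le (h.ι' a σ) k * he.coeff T.hom.le (h.ι' a τ) k *
    𝒪.res T.hom.le (η.trace (e k))) * hu k

end LocalRankOne

end

end BraneFibration

namespace BraneFibration

noncomputable section

/-! ### Lifting rank one idempotents from a fibre -/

section LocalRankOne

variable {M : Type u} [TopologicalSpace M] {𝒪 : FunctionSheaf M} {𝒯 : TangentMultiplication 𝒪}
  {η : InvariantMetric 𝒯} {U : Opens M} {n : ℕ} {𝒞 : CYCategory 𝒪 U} {h : CardyStructure η 𝒞}
  {a : 𝒞.Obj} {T : Over U} {e : Fin n → 𝒯.Sec U} (he : 𝒯.IsIdempotentFrame e)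

include he in
/-- An endomorphism whose value at a point is an idempotent of rank one, below the value of `eᵢ`. -/
lemma CardyStructure.exists_rank_one_value {r : ℕ} {s t : Fin r → Sec (𝒞.Hom a a) T}
    (hs : IsFrame s) (hst : ∀ i j, 𝒞.trace (𝒞.comp (t j) (s i)) = if i = j then 1 else 0)
    (x : T.left) (i : Fin n) (hi : ∃ j, hs.value x (h.ι a (𝒯.res T.hom.le (e i))) j ≠ 0) :
    ∃ (z : Sec (𝒞.Hom a a) T) (ℓ : Fin r → ℂ),
      (∀ j k, hs.value x (𝒞.comp (𝒞.comp z (s k)) z) j = hs.value x z j * ℓ k) ∧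
      ∑ k, ℓ k * hs.value x z k = 1 ∧ (∀ j, hs.value x (𝒞.comp z z) j = hs.value x z j) ∧
      ∀ j, hs.value x (𝒞.comp (h.ι a (𝒯.res T.hom.le (e i))) z) j = hs.value x z j := by
  have hu0 := fun k ↦ ((he.isUnit_trace η k).map (𝒪.res T.hom.le)).exists_left_inv
  choose u hu using hu0
  let b : Module.Basis (Fin r) (𝒪.sec T.left) (EndSec 𝒞 a T) := hs.basis (𝟙 T)
  have hb : ∀ k, b k = s k := fun k ↦ (hs.basis_apply (𝟙 T) k).trans (Sec.res_id _)
  have hrepr : ∀ (σ : Sec (𝒞.Hom a a) T) j, b.repr σ j = 𝒞.trace (𝒞.comp (t j) σ) := by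
    intro σ j
    have h1 : 𝒞.trace (𝒞.comp (t j) (∑ k, (hs.basis (𝟙 T)).repr σ k • (s k).res (𝟙 T))) =
        𝒞.trace (𝒞.comp (t j) σ) :=
      congrArg (fun m ↦ 𝒞.trace (𝒞.comp (t j) m)) (hs.sum_repr (𝟙 T) σ)
    rw [← h1, 𝒞.comp_sum, 𝒞.trace_sum, Finset.sum_eq_single j]
    · rw [Sec.res_id, 𝒞.comp_smul, 𝒞.trace_smul, hst, if_pos rfl, mul_one]
      rfl
    · intro k _ hk
      rw [Sec.res_id, 𝒞.comp_smul, 𝒞.trace_smul, hst, if_neg hk, mul_zero]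
    · simp
  obtain ⟨z, ℓ, h1, h2, h3, h4⟩ := exists_fibre_rank_one (FunctionSheaf.eval x) b (𝒞.traceₗ a T)
    (fun k ↦ (h.ι a (𝒯.res T.hom.le (e k)) : EndSec 𝒞 a T)) u
    (fun j ↦ ⟨t j, fun σ ↦ (hrepr σ j).trans (𝒞.trace_comm _ _)⟩)
    (fun k σ ↦ h.central _ _)
    (fun k l ↦ by
      refine (h.ι_mul a _ _).symm.trans ?_
      by_cases hkl : k = l
      · subst hkl
        rw [he.mul_self]
        exact (if_pos rfl).symm
      · rw [he.mul_of_ne _ (Ne.symm hkl)]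
        have := h.ι_smul a (T := T) 0 0
        rw [zero_smul, zero_smul] at this
        exact this.trans (if_neg hkl).symm)
    (by
      refine Eq.trans (h.ι_sum a _ _).symm ?_
      rw [he.sum_eq_one, h.ι_one]
      rfl)
    (fun k h0 ↦ by
      have := congrArg (FunctionSheaf.eval x) (hu k)
      rw [map_mul, h0, zero_mul, map_one] at this
      exact zero_ne_one this)
    (fun σ τ ↦ by
      rw [LinearMap.trace_eq_matrix_trace _ b, Matrix.trace]
      refine Eq.trans ?_ (h.trace_comp_comp he hs hst hu σ τ)
      refine Finset.sum_congr rfl fun j _ ↦ ?_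
      rw [Matrix.diag_apply, LinearMap.toMatrix_apply, hb]
      exact hrepr _ j) i hi
  refine ⟨z, ℓ, fun j k ↦ ?_, h2, h3, h4⟩
  rw [← hb]
  exact h1 j k

/-- A frame of `Γ_aa` with a dual one. -/
lemma CYCategory.exists_frame_dual (a : 𝒞.Obj) (T : Over U) {x : M} (hx : x ∈ T.left) :
    ∃ (T' : Over U) (_ : T' ⟶ T), x ∈ T'.left ∧ ∃ (r : ℕ) (s t : Fin r → Sec (𝒞.Hom a a) T'),
      IsFrame s ∧ ∀ i j, 𝒞.trace (𝒞.comp (t j) (s i)) = if i = j then 1 else 0 := by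
  obtain ⟨T₁, f₁, hx₁, r, s, hs⟩ := (𝒞.locallyFree a a).exists_frame T hx
  obtain ⟨T₂, f₂, hx₂, t, ht⟩ := 𝒞.exists_dual hs hx₁
  exact ⟨T₂, f₂ ≫ f₁, hx₂, r, _, t, hs.restrict f₂, ht⟩

/-- The endomorphism `m ↦ z m z`. -/
def CYCategory.sandwich (z : Sec (𝒞.Hom a a) T) : LocHom (𝒞.Hom a a) (𝒞.Hom a a) T where
  app {T'} f := (𝒞.compₗ a a a T').flip (z.res f) ∘ₗ 𝒞.compₗ a a a T' (z.res f)
  app_res f g m := by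
    change 𝒞.comp (𝒞.comp (z.res (g ≫ f)) (m.res g)) (z.res (g ≫ f)) =
      (𝒞.comp (𝒞.comp (z.res f) m) (z.res f)).res g
    rw [𝒞.comp_res, 𝒞.comp_res, Sec.res_res]

lemma CYCategory.sandwich_app (z : Sec (𝒞.Hom a a) T) {T' : Over U} (f : T' ⟶ T)
    (m : Sec (𝒞.Hom a a) T') : (𝒞.sandwich z).app f m = 𝒞.comp (𝒞.comp (z.res f) m) (z.res f) := rfl

/-- Let `z` be an endomorphism for which `m ↦ z m z` is at `x` a projector of rank one. Around `x`
there is then an eigenvector `w` of `m ↦ z m z`, with the same value at `x` and one-dimensional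
eigenspace: with the eigenvalue `c = ℓ(w)`, the endomorphism
`m ↦ c m - z m z + ℓ(m) w` is the identity at `x`, hence injective around `x`, and if `z m z = c m`
then it takes `c m - ℓ(m) w` to zero. -/
lemma CYCategory.exists_eigenvector (h𝒪 : 𝒪.HasLocalInverses) (hev : 𝒪.HasLocalEigenvectors)
    {r : ℕ} {s : Fin r → Sec (𝒞.Hom a a) T} (hs : IsFrame s) (x : T.left)
    (z : Sec (𝒞.Hom a a) T) (ℓ : Fin r → ℂ)
    (h1 : ∀ j k, hs.value x (𝒞.comp (𝒞.comp z (s k)) z) j = hs.value x z j * ℓ k)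
    (h2 : ∑ k, ℓ k * hs.value x z k = 1) :
    ∃ (T' : Over U) (f : T' ⟶ T) (hx : (x : M) ∈ T'.left) (w : Sec (𝒞.Hom a a) T')
      (c : 𝒪.sec T'.left),
      (∀ j, (hs.restrict f).value ⟨x, hx⟩ w j = hs.value x z j) ∧
      𝒞.comp (𝒞.comp (z.res f) w) (z.res f) = c • w ∧
      ∀ (T'' : Over U) (g : T'' ⟶ T'), (∀ d d' : 𝒪.sec T''.left,
          d • w.res g = d' • w.res g → d = d') ∧
        ∀ m, 𝒞.comp (𝒞.comp ((z.res f).res g) m) ((z.res f).res g) = 𝒪.res g.left.le c • m →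
          ∃ d : 𝒪.sec T''.left, m = d • w.res g := by
  -- the matrix of `m ↦ z m z`, which at `x` is `z ⊗ ℓ`
  let Z : Matrix (Fin r) (Fin r) (𝒪.sec T.left) := fun i j ↦
    (hs.basis (𝟙 T)).repr (𝒞.comp (𝒞.comp z (s j)) z) i
  obtain ⟨T₁, f₁, hxV, v, hv, hZv⟩ : ∃ (T₁ : Over U) (f₁ : T₁ ⟶ T) (hx : (x : M) ∈ T₁.left)
      (v : Fin r → 𝒪.sec T₁.left), (∀ i, (v i).1 ⟨x, hx⟩ = hs.value x z i) ∧
      ∀ i, ∑ j, 𝒪.res f₁.left.le (Z i j) * v j = (∑ j, algebraMap ℂ _ (ℓ j) * v j) * v i := by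
    obtain ⟨V, hV, hxV, v, hv, hZv⟩ := hev T.left r Z x (hs.value x z) ℓ (fun i j ↦ h1 i j) h2
    exact ⟨overMk T V hV, overHom hV, hxV, v, hv, hZv⟩
  let ℓ₁ : Fin r → 𝒪.sec T₁.left := fun j ↦ algebraMap ℂ _ (ℓ j)
  obtain ⟨c, hc⟩ : ∃ c : 𝒪.sec T₁.left, c = ∑ j, ℓ₁ j * v j := ⟨_, rfl⟩
  obtain ⟨w, hw⟩ : ∃ w : Sec (𝒞.Hom a a) T₁, w = ∑ j, v j • (s j).res f₁ := ⟨_, rfl⟩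
  have hs₁ : IsFrame fun j ↦ (s j).res f₁ := hs.restrict f₁
  have hreprw : ⇑((hs₁.basis (𝟙 T₁)).repr w) = v := hs₁.repr_eq (𝟙 T₁) (by
    simp only [Sec.res_id]
    exact hw)
  have hvalw : ∀ j, hs₁.value ⟨x, hxV⟩ w j = hs.value x z j := fun j ↦ by
    rw [← hv j, IsFrame.value, hreprw]
    rfl
  have hvals : ∀ m j, hs₁.value ⟨x, hxV⟩ (m.res f₁) j = hs.value x m j := fun m j ↦
    hs.value_res f₁ ⟨x, hxV⟩ m j
  have hc1 : c.1 ⟨x, hxV⟩ = 1 := by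
    rw [← h2, hc]
    have := map_sum (FunctionSheaf.eval (𝒪 := 𝒪) (⟨x, hxV⟩ : T₁.left)) (fun j ↦ ℓ₁ j * v j)
      Finset.univ
    refine this.trans (Finset.sum_congr rfl fun j _ ↦ ?_)
    rw [map_mul, AlgHom.commutes, ← hv j]
    rfl
  have hsz : ∀ j, 𝒞.comp (𝒞.comp (z.res f₁) ((s j).res f₁)) (z.res f₁) =
      ∑ i, 𝒪.res f₁.left.le (Z i j) • (s i).res f₁ := fun j ↦ by
    rw [← 𝒞.comp_res, ← 𝒞.comp_res, ← hs.sum_repr (𝟙 T) (𝒞.comp (𝒞.comp z (s j)) z), Sec.res_sum]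
    refine Finset.sum_congr rfl fun i _ ↦ ?_
    rw [Sec.res_smul, Sec.res_id]
  have hzw : 𝒞.comp (𝒞.comp (z.res f₁) w) (z.res f₁) = c • w := by
    have h3 : (𝒞.sandwich (z.res f₁)).app (𝟙 T₁) w = c • w := by
      have h4 : ∀ j, (𝒞.sandwich (z.res f₁)).app (𝟙 T₁) (v j • (s j).res f₁) =
          ∑ i, (v j * 𝒪.res f₁.left.le (Z i j)) • (s i).res f₁ := fun j ↦ by
        rw [map_smul, 𝒞.sandwich_app, Sec.res_id, hsz, Finset.smul_sum]
        simp only [smul_smul]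
      rw [hw, map_sum, Finset.smul_sum, Finset.sum_congr rfl fun j _ ↦ h4 j, Finset.sum_comm]
      refine Finset.sum_congr rfl fun i _ ↦ ?_
      have h5 : ∑ j, v j * 𝒪.res f₁.left.le (Z i j) = c * v i := by
        rw [hc, ← hZv i]
        exact Finset.sum_congr rfl fun j _ ↦ mul_comm _ _
      rw [← Finset.sum_smul, h5, smul_smul]
    rwa [𝒞.sandwich_app, Sec.res_id] at h3
  -- `m ↦ c m - z m z + ℓ(m) w`
  let φ : LocHom (𝒞.Hom a a) (𝒞.Hom a a) T₁ :=
    c • LocHom.id _ T₁ + -𝒞.sandwich (z.res f₁) + LocHom.ofFrame hs₁ (fun j ↦ ℓ₁ j • w)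
  have hφ : ∀ {T' : Over U} (f : T' ⟶ T₁) m, φ.app f m = 𝒪.res f.left.le c • m -
      𝒞.comp (𝒞.comp ((z.res f₁).res f) m) ((z.res f₁).res f) +
      (∑ j, (hs₁.basis f).repr m j * 𝒪.res f.left.le (ℓ₁ j)) • w.res f := fun {T'} f m ↦ by
    have h4 : φ.app f m = 𝒪.res f.left.le c • m + -(𝒞.sandwich (z.res f₁)).app f m +
      (LocHom.ofFrame hs₁ (fun j ↦ ℓ₁ j • w)).app f m := rfl
    rw [h4, LocHom.ofFrame_app, 𝒞.sandwich_app, ← sub_eq_add_neg, Finset.sum_smul]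
    simp only [Sec.res_smul, smul_smul]
  obtain ⟨T₂, f₂, hx₂, hinj⟩ := hs₁.exists_injective h𝒪 φ ⟨x, hxV⟩ (fun i j ↦ by
    have h5 : hs₁.value ⟨x, hxV⟩ (𝒞.comp (𝒞.comp ((z.res f₁).res (𝟙 T₁)) ((s j).res f₁))
        ((z.res f₁).res (𝟙 T₁))) i = hs.value x z i * ℓ j := by
      rw [Sec.res_id, ← 𝒞.comp_res, ← 𝒞.comp_res, hvals, h1]
    have h6 : ∑ k, (hs₁.basis (𝟙 T₁)).repr ((s j).res f₁) k *
        𝒪.res (𝟙 T₁ : T₁ ⟶ T₁).left.le (ℓ₁ k) =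
        ℓ₁ j := by
      have : (s j).res f₁ = hs₁.basis (𝟙 T₁) j := by rw [hs₁.basis_apply, Sec.res_id]
      rw [this, Module.Basis.repr_self, Finset.sum_eq_single j]
      · rw [Finsupp.single_eq_same, one_mul]
        rfl
      · intro k _ hk
        rw [Finsupp.single_eq_of_ne hk, zero_mul]
      · simp
    rw [hφ, h6, hs₁.value_add, hs₁.value_sub, hs₁.value_smul, hs₁.value_smul, h5, hs₁.value_self,
      Sec.res_id, hvalw]
    have h7 : (ℓ₁ j).1 ⟨x, hxV⟩ = ℓ j := rfl
    have h8 : (𝒪.res (𝟙 T₁ : T₁ ⟶ T₁).left.le c).1 ⟨x, hxV⟩ = 1 := hc1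
    rw [h7, h8]
    ring)
  obtain ⟨V, hV, hxV', hc'⟩ := h𝒪 T₂.left (𝒪.res f₂.left.le c) ⟨x, hx₂⟩ (by
    have : (𝒪.res f₂.left.le c).1 ⟨x, hx₂⟩ = c.1 ⟨x, hxV⟩ := rfl
    rw [this, hc1]
    exact one_ne_zero)
  have hℓ : ∀ {T' : Over U} (f : T' ⟶ T₁) (d : 𝒪.sec T'.left),
      ∑ j, (hs₁.basis f).repr (d • w.res f) j * 𝒪.res f.left.le (ℓ₁ j) =
        d * 𝒪.res f.left.le c := fun f d ↦ by
    have h9 : ⇑((hs₁.basis f).repr (w.res f)) = fun j ↦ 𝒪.res f.left.le (v j) :=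
      hs₁.repr_eq f (by rw [hw, Sec.res_sum]; simp only [Sec.res_smul])
    rw [hc, map_sum, Finset.mul_sum]
    refine Finset.sum_congr rfl fun j _ ↦ ?_
    rw [map_smul, Finsupp.smul_apply, h9, map_mul, smul_eq_mul]
    ring
  obtain ⟨T₃, f₂', hx₃, hu₃⟩ : ∃ (T₃ : Over U) (f : T₃ ⟶ T₂), (x : M) ∈ T₃.left ∧
      IsUnit (𝒪.res f.left.le (𝒪.res f₂.left.le c)) := ⟨overMk T₂ V hV, overHom hV, hxV', hc'⟩
  obtain ⟨f₃, hf₃⟩ : ∃ f₃ : T₃ ⟶ T₁, f₃ = f₂' ≫ f₂ := ⟨_, rfl⟩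
  refine ⟨T₃, f₃ ≫ f₁, hx₃, w.res f₃, 𝒪.res f₃.left.le c, fun j ↦ ?_, ?_,
    fun T'' g ↦ ⟨fun d d' hd ↦ ?_, fun m hm ↦ ?_⟩⟩
  · have h11 : ⇑(((hs.restrict (f₃ ≫ f₁)).basis (𝟙 T₃)).repr (w.res f₃)) =
        fun j ↦ 𝒪.res f₃.left.le (v j) := (hs.restrict (f₃ ≫ f₁)).repr_eq (𝟙 T₃) (by
      rw [hw, Sec.res_sum]
      simp only [Sec.res_smul, Sec.res_res, Category.id_comp])
    rw [← hv j, IsFrame.value, h11]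
    rfl
  · rw [← Sec.res_res, ← 𝒞.comp_res, ← 𝒞.comp_res, hzw, Sec.res_smul]
  all_goals
    have hu : IsUnit (𝒪.res (g ≫ f₃).left.le c) := by
      exact hu₃.map (𝒪.res g.left.le)
  · rw [Sec.res_res] at hd
    have h10 := hℓ (g ≫ f₃) d
    rw [hd, hℓ] at h10
    exact (hu.mul_right_cancel h10).symm
  · obtain ⟨c', hcc'⟩ := hu.exists_left_inv
    have hinj' : Function.Injective (φ.app (g ≫ f₃)) := by
      rw [hf₃, ← Category.assoc]
      exact hinj T'' (g ≫ f₂')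
    have hzw' : 𝒞.comp (𝒞.comp ((z.res f₁).res (g ≫ f₃)) (w.res (g ≫ f₃)))
        ((z.res f₁).res (g ≫ f₃)) = 𝒪.res (g ≫ f₃).left.le c • w.res (g ≫ f₃) := by
      rw [← 𝒞.comp_res, ← 𝒞.comp_res, hzw, Sec.res_smul]
    have hm' : 𝒞.comp (𝒞.comp ((z.res f₁).res (g ≫ f₃)) m) ((z.res f₁).res (g ≫ f₃)) =
        𝒪.res (g ≫ f₃).left.le c • m := by
      rw [show z.res (f₃ ≫ f₁) = (z.res f₁).res f₃ from (Sec.res_res _ _ _).symm] at hm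
      rw [← Sec.res_res]
      exact hm
    -- `φ` takes the same value at both sides, and is injective
    have h12 : 𝒪.res (g ≫ f₃).left.le c • m =
        (∑ j, (hs₁.basis (g ≫ f₃)).repr m j * 𝒪.res (g ≫ f₃).left.le (ℓ₁ j)) •
          w.res (g ≫ f₃) := by
      apply hinj'
      have h13 := hℓ (g ≫ f₃) 1
      rw [one_smul, one_mul] at h13
      rw [map_smul, map_smul, hφ, hφ, hm', hzw', sub_self, sub_self, zero_add, zero_add, h13,
        smul_smul, smul_smul, mul_comm]
    refine ⟨c' * ∑ j, (hs₁.basis (g ≫ f₃)).repr m j * 𝒪.res (g ≫ f₃).left.le (ℓ₁ j), ?_⟩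
    rw [Sec.res_res, mul_smul, ← h12, smul_smul, hcc', one_smul]

include he in
/-- If `ι_a(eᵢ)` does not vanish around `x`, then around `x` there is an idempotent of rank one below
`ι_a(eᵢ)`. A representative `z` of such an idempotent in the fibre at `x` is replaced by the
eigenvector `w` of `m ↦ z m z`; then `w Γ_aa w` consists of multiples of `w`, and in particular
`w w = γ w` with `γ` invertible around `x`, so that `γ⁻¹ w` is an idempotent. -/
lemma CardyStructure.exists_rank_one (h𝒪 : 𝒪.HasLocalInverses) (hev : 𝒪.HasLocalEigenvectors)
    (T : Over U) {x : M} (hx : x ∈ T.left) (i : Fin n)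
    (hi : ∀ (T' : Over U), (T' ⟶ T) → x ∈ T'.left → h.ι a (𝒯.res T'.hom.le (e i)) ≠ 0) :
    ∃ (T' : Over U) (_ : T' ⟶ T), x ∈ T'.left ∧ ∃ p : Sec (𝒞.Hom a a) T', 𝒞.comp p p = p ∧
      𝒞.comp (h.ι a (𝒯.res T'.hom.le (e i))) p = p ∧
      ∀ (T'' : Over U) (g : T'' ⟶ T') (σ : Sec (𝒞.Hom a a) T''), ∃! c : 𝒪.sec T''.left,
        𝒞.comp (𝒞.comp (p.res g) σ) (p.res g) = c • p.res g := by
  obtain ⟨T₀, f₀, hx₀, r, s, t, hs, hst⟩ := 𝒞.exists_frame_dual a T hx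
  have hιι : ∀ T' : Over U, 𝒞.comp (h.ι a (𝒯.res T'.hom.le (e i))) (h.ι a (𝒯.res T'.hom.le (e i))) =
      h.ι a (𝒯.res T'.hom.le (e i)) := fun T' ↦ by
    rw [← h.ι_mul, he.mul_self]
  have hιres : ∀ {T' T'' : Over U} (f : T'' ⟶ T'), (h.ι a (𝒯.res T'.hom.le (e i))).res f =
      h.ι a (𝒯.res T''.hom.le (e i)) := fun f ↦ h.ι_res a f _
  have hne : ∃ j, hs.value ⟨x, hx₀⟩ (h.ι a (𝒯.res T₀.hom.le (e i))) j ≠ 0 := by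
    by_contra! h0
    obtain ⟨T₁, f₁, hx₁, h1⟩ := 𝒞.exists_res_eq_zero h𝒪 hs ⟨x, hx₀⟩ (hιι T₀) h0
    rw [hιres] at h1
    exact hi T₁ (f₁ ≫ f₀) hx₁ h1
  obtain ⟨z, ℓ, hz1, hz2, hz3, hz4⟩ := h.exists_rank_one_value he hs hst ⟨x, hx₀⟩ i hne
  obtain ⟨T₁, f₁, hx₁, w, c, hw1, hw2, hw3⟩ := 𝒞.exists_eigenvector h𝒪 hev hs ⟨x, hx₀⟩ z ℓ hz1 hz2
  have hs₁ := hs.restrict f₁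
  set y : T₁.left := ⟨x, hx₁⟩ with hy
  have hwz : ∀ j, hs₁.value y (w - z.res f₁) j = 0 := fun j ↦ by
    rw [hs₁.value_sub, hw1, hs.value_res f₁ y]
    exact sub_self _
  obtain ⟨j₀, hj₀⟩ : ∃ j, hs₁.value y w j ≠ 0 := by
    by_contra! h0
    simp only [hw1] at h0
    simp [h0] at hz2
  have hwσw : ∀ (T'' : Over U) (g : T'' ⟶ T₁) (σ : Sec (𝒞.Hom a a) T''), ∃ d : 𝒪.sec T''.left,
      𝒞.comp (𝒞.comp (w.res g) σ) (w.res g) = d • w.res g := fun T'' g σ ↦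
    exists_mul_mul_eq_smul (A := EndSec 𝒞 a T'') (z := (z.res f₁).res g) (w := w.res g)
      (c := 𝒪.res g.left.le c)
      (by
        have := congrArg (Sec.res g) hw2
        rwa [𝒞.comp_res, 𝒞.comp_res, Sec.res_smul] at this)
          (by intro m hm; exact (hw3 T'' g).2 m hm) σ
  obtain ⟨γ, hγ⟩ : ∃ γ : 𝒪.sec T₁.left, 𝒞.comp w w = γ • w := by
    have := hwσw T₁ (𝟙 T₁) (𝒞.id a T₁)
    rwa [Sec.res_id, 𝒞.comp_id] at this
  obtain ⟨δ, hδ⟩ : ∃ δ : 𝒪.sec T₁.left, 𝒞.comp (h.ι a (𝒯.res T₁.hom.le (e i))) w = δ • w := by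
    have := (hw3 T₁ (𝟙 T₁)).2 (𝒞.comp (h.ι a (𝒯.res T₁.hom.le (e i))) w) (by
      rw [Sec.res_id, h.central, ← 𝒞.assoc, 𝒞.assoc, h.central, ← 𝒞.assoc, hw2, 𝒞.smul_comp]
      rfl)
    rwa [Sec.res_id] at this
  -- `w` and `z` agree at `x`, where `z` is an idempotent fixed by `ι_a(eᵢ)`
  have hγ1 : γ.1 y = 1 := by
    have h1 : hs₁.value y (𝒞.comp w w) j₀ = hs₁.value y w j₀ := by
      have h2 : 𝒞.comp w w = 𝒞.compₗ a a a T₁ w (w - z.res f₁) +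
          ((𝒞.compₗ a a a T₁).flip (z.res f₁) (w - z.res f₁) +
          (𝒞.comp z z).res f₁) := by
        rw [map_sub, map_sub, 𝒞.comp_res]
        change _ = 𝒞.comp w w - 𝒞.comp w (z.res f₁) + (𝒞.comp w (z.res f₁) -
          𝒞.comp (z.res f₁) (z.res f₁) + 𝒞.comp (z.res f₁) (z.res f₁))
        abel
      rw [h2, hs₁.value_add, hs₁.value_add, hs₁.value_map_eq_zero hs₁ y _ hwz,
        hs₁.value_map_eq_zero hs₁ y _ hwz, zero_add, zero_add, hw1, hs.value_res f₁ y]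
      exact hz3 j₀
    rw [hγ, hs₁.value_smul] at h1
    exact mul_right_cancel₀ hj₀ (h1.trans (one_mul _).symm)
  have hδ1 : δ.1 y = 1 := by
    have h1 : hs₁.value y (𝒞.comp (h.ι a (𝒯.res T₁.hom.le (e i))) w) j₀ = hs₁.value y w j₀ := by
      have h2 : 𝒞.comp (h.ι a (𝒯.res T₁.hom.le (e i))) w =
          𝒞.compₗ a a a T₁ (h.ι a (𝒯.res T₁.hom.le (e i))) (w - z.res f₁) +
          (𝒞.comp (h.ι a (𝒯.res T₀.hom.le (e i))) z).res f₁ := by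
        rw [map_sub, 𝒞.comp_res, hιres]
        exact (sub_add_cancel _ _).symm
      rw [h2, hs₁.value_add, hs₁.value_map_eq_zero hs₁ y _ hwz, zero_add, hw1,
        hs.value_res f₁ y]
      exact hz4 j₀
    rw [hδ, hs₁.value_smul] at h1
    exact mul_right_cancel₀ hj₀ (h1.trans (one_mul _).symm)
  obtain ⟨T₂, f₂, hx₂, hu⟩ : ∃ (T₂ : Over U) (f : T₂ ⟶ T₁), x ∈ T₂.left ∧
      IsUnit (𝒪.res f.left.le (γ * δ)) := by
    obtain ⟨V, hV, hxV, hu⟩ := h𝒪 T₁.left (γ * δ) y (by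
      change γ.1 y * δ.1 y ≠ 0
      rw [hγ1, hδ1, one_mul]
      exact one_ne_zero)
    exact ⟨overMk T₁ V hV, overHom hV, hxV, hu⟩
  rw [map_mul, IsUnit.mul_iff] at hu
  obtain ⟨u, huγ⟩ := hu.1.exists_left_inv
  have hδ2 : 𝒞.comp (h.ι a (𝒯.res T₂.hom.le (e i))) (w.res f₂) = w.res f₂ := by
    have h1 := congrArg (Sec.res f₂) hδ
    rw [𝒞.comp_res, hιres, Sec.res_smul] at h1
    -- `δ` is idempotent and invertible, hence one
    have h2 : 𝒪.res f₂.left.le δ * 𝒪.res f₂.left.le δ = 𝒪.res f₂.left.le δ := by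
      refine (hw3 T₂ f₂).1 _ _ ?_
      conv_rhs => rw [← h1, ← hιι, 𝒞.assoc, h1, 𝒞.comp_smul, h1, smul_smul]
    rw [h1, (hu.2.mul_eq_left).1 h2, one_smul]
  have hγ2 : 𝒞.comp (w.res f₂) (w.res f₂) = 𝒪.res f₂.left.le γ • w.res f₂ := by
    rw [← 𝒞.comp_res, hγ, Sec.res_smul]
  refine ⟨T₂, f₂ ≫ f₁ ≫ f₀, hx₂, u • w.res f₂, ?_, ?_, fun T'' g σ ↦ ?_⟩
  · rw [𝒞.smul_comp, 𝒞.comp_smul, hγ2, smul_smul u (𝒪.res _ _), huγ, one_smul]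
  · rw [𝒞.comp_smul, hδ2]
  · obtain ⟨d, hd⟩ := hwσw T'' (g ≫ f₂) σ
    have huγ' : 𝒪.res g.left.le u * 𝒪.res g.left.le (𝒪.res f₂.left.le γ) = 1 := by
      rw [← map_mul, huγ, map_one]
    rw [Sec.res_smul, Sec.res_res]
    refine ⟨𝒪.res g.left.le u * d, ?_, fun d' hd' ↦ ?_⟩
    · dsimp only
      rw [𝒞.smul_comp, 𝒞.comp_smul, 𝒞.smul_comp, hd, smul_smul, smul_smul, smul_smul]
      ring_nf
    · dsimp only at hd'
      rw [𝒞.smul_comp, 𝒞.comp_smul, 𝒞.smul_comp, hd, smul_smul, smul_smul, smul_smul] at hd'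
      have h1 := (hw3 T'' (g ≫ f₂)).1 _ _ hd'
      linear_combination (-𝒪.res g.left.le (𝒪.res f₂.left.le γ)) * h1 +
        (𝒪.res g.left.le u * d - d') * huγ'

end LocalRankOne

end

end BraneFibration

namespace BraneFibration

noncomputable section

/-! ### Idempotents over connected sets -/

section Connected

variable {M : Type u} [TopologicalSpace M] {𝒪 : FunctionSheaf M} {𝒯 : TangentMultiplication 𝒪}
  {η : InvariantMetric 𝒯} {U : Opens M} {n : ℕ} {𝒞 : CYCategory 𝒪 U} {h : CardyStructure η 𝒞}

/-- Over a connected set, an idempotent which vanishes around some point is zero: where its values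
do not vanish, they do not vanish in a neighbourhood. -/
lemma CYCategory.eq_zero_of_isPreconnected (h𝒪 : 𝒪.HasLocalInverses) (hcont : 𝒪.IsContinuous)
    (hU : IsPreconnected (U : Set M)) {a : 𝒞.Obj} {p : Sec (𝒞.Hom a a) (Over.mk (𝟙 U))}
    (hp : 𝒞.comp p p = p) {T : Over U} {x : M} (hx : x ∈ T.left) (h0 : p.res (toTop T) = 0) :
    p = 0 := by
  -- the set around whose points `p` vanishes, and the set of the points at which the value of `p` does
  -- not vanish; both are open and they cover `U`
  let Z : Set M := {y | ∃ T : Over U, y ∈ T.left ∧ p.res (toTop T) = 0}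
  let Z' : Set M := {y | ∃ (T : Over U) (hy : y ∈ T.left) (r : ℕ) (s : Fin r → Sec (𝒞.Hom a a) T)
    (hs : IsFrame s) (j : Fin r), hs.value ⟨y, hy⟩ (p.res (toTop T)) j ≠ 0}
  have hZ : IsOpen Z := isOpen_iff_forall_mem_open.2 fun y ⟨T, hy, hT⟩ ↦
    ⟨T.left, fun y' hy' ↦ ⟨T, hy', hT⟩, T.left.isOpen, hy⟩
  have hZ' : IsOpen Z' := isOpen_iff_forall_mem_open.2 fun y ⟨T, hy, r, s, hs, j, hT⟩ ↦ by
    refine ⟨Subtype.val '' {z : T.left | hs.value z (p.res (toTop T)) j ≠ 0}, ?_,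
      T.left.isOpen.isOpenMap_subtype_val _ ?_, ⟨⟨y, hy⟩, hT, rfl⟩⟩
    · rintro _ ⟨z, hz, rfl⟩
      exact ⟨T, z.2, r, s, hs, j, hz⟩
    · exact isOpen_ne_fun (hcont _ ((hs.basis (𝟙 T)).repr (p.res (toTop T)) j)) continuous_const
  have hcover : (U : Set M) ⊆ Z ∪ Z' := fun y hy ↦ by
    obtain ⟨T, f, hyT, r, s, hs⟩ := (𝒞.locallyFree a a).exists_frame (Over.mk (𝟙 U)) hy
    by_cases hv : ∀ j, hs.value ⟨y, hyT⟩ (p.res (toTop T)) j = 0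
    · obtain ⟨T', f', hy', h1⟩ := 𝒞.exists_res_eq_zero h𝒪 hs ⟨y, hyT⟩
        (by rw [← 𝒞.comp_res, hp]) hv
      exact Or.inl ⟨T', hy', by rw [Sec.res_res] at h1; exact h1⟩
    · push Not at hv
      obtain ⟨j, hj⟩ := hv
      exact Or.inr ⟨T, hyT, r, s, hs, j, hj⟩
  refine Sec.ext_locally fun y hy ↦ ?_
  by_contra hne
  have hyZ : y ∉ Z := fun ⟨T, hyT, hT⟩ ↦ hne ⟨T, toTop T, hyT, by rw [hT, Sec.res_zero]⟩
  -- by connectedness the two sets would meet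
  obtain ⟨z, -, ⟨T₁, hz₁, h1⟩, T₂, hz₂, r, s, hs, j, h2⟩ := hU Z Z' hZ hZ' hcover
    ⟨x, T.hom.le hx, T, hx, h0⟩ ⟨y, hy, (hcover hy).resolve_left hyZ⟩
  apply h2
  have h3 := hs.value_res (overInfRight T₁ T₂) ⟨z, hz₁, hz₂⟩ (p.res (toTop T₂)) j
  rw [Sec.res_res, show overInfRight T₁ T₂ ≫ toTop T₂ = overInfLeft T₁ T₂ ≫ toTop T₁ from
    Subsingleton.elim _ _, ← Sec.res_res, h1, Sec.res_zero] at h3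
  rw [← h3, IsFrame.value, map_zero]
  exact map_zero _

end Connected

/-! ### Restriction of labels and of their endomorphisms -/

section Restriction

open Pseudofunctor.LocallyDiscreteOpToCat Bicategory

variable {M : Type u} [TopologicalSpace M] {𝒪 : FunctionSheaf M}

namespace LinearStack

variable {B : LinearStack 𝒪} {U V : Opens M}

/-- The identification of the sections of `Γ_ab` over an open subset of `V` with those of the
sheaf of morphisms between the restrictions of `a` and `b` to `V`. -/
def restrHom (h : V ⟶ U) (a b : B.Label U) (T : Over V) :
    HomOver a b ((Over.map h).obj T) ≃ HomOver ((B.restr h).obj a) ((B.restr h).obj b) T :=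
  ((B.fib.overMapCompPresheafHomIso a b h).app (op T)).toEquiv

/-- The comparison between the two restrictions of a label. -/
def restrIso (h : V ⟶ U) (a : B.Label U) (T : Over V) :
    (B.restr ((Over.map h).obj T).hom).obj a ≅ (B.restr T.hom).obj ((B.restr h).obj a) :=
  (Cat.Hom.toNatIso (B.fib.mapComp' h.op.toLoc T.hom.op.toLoc
    ((Over.map h).obj T).hom.op.toLoc)).app a

lemma restrHom_apply (h : V ⟶ U) {a b : B.Label U} {T : Over V}
    (σ : HomOver a b ((Over.map h).obj T)) :
    restrHom h a b T σ = ((restrIso h a T).inv ≫ σ) ≫ (restrIso h b T).hom := rfl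

lemma restrHom_comp (h : V ⟶ U) {a b c : B.Label U} {T : Over V}
    (σ : HomOver a b ((Over.map h).obj T)) (τ : HomOver b c ((Over.map h).obj T)) :
    restrHom h a c T (σ ≫ τ) = restrHom h a b T σ ≫ restrHom h b c T τ := by
  simp only [restrHom_apply, Category.assoc, Iso.hom_inv_id_assoc]

lemma restrHom_smul (h : V ⟶ U) {a b : B.Label U} {T : Over V} (c : 𝒪.sec T.left)
    (σ : HomOver a b ((Over.map h).obj T)) :
    restrHom h a b T ((show 𝒪.sec ((Over.map h).obj T).left from c) • σ) =
      c • restrHom h a b T σ := by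
  rw [restrHom_apply, restrHom_apply]
  refine (congrArg (· ≫ (restrIso h b T).hom)
    (Linear.comp_smul (R := 𝒪.sec ((Over.map h).obj T).left) _ _ _
      (restrIso h a T).inv c σ)).trans ?_
  exact Linear.smul_comp (R := 𝒪.sec ((Over.map h).obj T).left) _ _ _ c _ _

lemma restrHom_res (h : V ⟶ U) {a b : B.Label U} {T T' : Over V} (f : T' ⟶ T)
    (σ : HomOver a b ((Over.map h).obj T)) :
    restrHom h a b T' (HomOver.res ((Over.map h).map f) σ) = HomOver.res f (restrHom h a b T σ) :=
  ConcreteCategory.congr_hom ((B.fib.overMapCompPresheafHomIso a b h).hom.naturality f.op) σ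

end LinearStack

namespace CardyFibration

open LinearStack

variable {𝒯 : TangentMultiplication 𝒪} {η : InvariantMetric 𝒯} {n : ℕ} {B : CardyFibration η n}
  {U V : Opens M} (hU : U ∈ B.cover) (hV : V ∈ B.cover) (h : V ⟶ U) {a : B.Label U}

/-- An idempotent of rank one over `T` gives one over each `V ⊆ T`. -/
def rankOneIdempotent {X : 𝒯.Sec U} {T : Over U} {p : HomOver a a T} (hVT : V ≤ T.left)
    (hp : p ≫ p = p) (hι : (B.cyCategory U).comp ((B.cardy U hU).ι a (𝒯.res T.hom.le X)) p = p)
    (huniq : ∀ (T' : Over U) (g : T' ⟶ T) (σ : HomOver a a T'), ∃! c : 𝒪.sec T'.left,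
      (HomOver.res g p ≫ σ) ≫ HomOver.res g p = c • HomOver.res g p) :
    RankOneIdempotent (B.cardy V hV) (𝒯.res h.le X) ((B.restr h).obj a) :=
  let g (T' : Over V) : (Over.map h).obj T' ⟶ T := overHom (T'.hom.le.trans hVT)
  have hres : ∀ T' : Over V,
      HomOver.res (toTop T') (restrHom h a a (Over.mk (𝟙 V)) (HomOver.res (g _) p)) =
        restrHom h a a T' (HomOver.res (g T') p) := fun T' ↦ by
    rw [← restrHom_res]
    exact congrArg _ (Sec.res_res (N := homSheaf a a) (g (Over.mk (𝟙 V)))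
      ((Over.map h).map (toTop T')) p)
  { p := restrHom h a a (Over.mk (𝟙 V)) (HomOver.res (g _) p)
    idem := by
      refine (restrHom_comp h _ _).symm.trans (congrArg _ ?_)
      rw [← HomOver.res_comp, hp]
    support := by
      rw [B.ι_restr hU hV h]
      refine (restrHom_comp h _ _).symm.trans (congrArg _ ?_)
      refine (congrArg ((B.cyCategory U).comp · _) ((B.cardy U hU).ι_res a (g (Over.mk (𝟙 V)))
        (𝒯.res T.hom.le X)).symm).trans ?_
      exact ((B.cyCategory U).comp_res (g (Over.mk (𝟙 V))) _ _).symm.trans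
        (congrArg (Sec.res (N := homSheaf a a) (g (Over.mk (𝟙 V)))) hι)
    existsUnique := fun T' σ ↦ by
      obtain ⟨σ₀, rfl⟩ := (restrHom h a a T').surjective σ
      have h1 := hres T'
      obtain ⟨c, hc, hc'⟩ := huniq _ (g T') σ₀
      have h2 : ∀ d : 𝒪.sec T'.left,
          (restrHom h a a T' (HomOver.res (g T') p) ≫ restrHom h a a T' σ₀) ≫
            restrHom h a a T' (HomOver.res (g T') p) =
            d • restrHom h a a T' (HomOver.res (g T') p) ↔
          (HomOver.res (g T') p ≫ σ₀) ≫ HomOver.res (g T') p =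
            (show 𝒪.sec ((Over.map h).obj T').left from d) • HomOver.res (g T') p := fun d ↦ by
        rw [← restrHom_comp, ← restrHom_comp, ← restrHom_smul, (restrHom h a a T').injective.eq_iff]
      rw [← h1] at h2
      exact ⟨c, (h2 c).2 hc, fun d hd ↦ hc' d ((h2 d).1 hd)⟩ }

end CardyFibration

end Restriction

end

end BraneFibration

namespace BraneFibration

noncomputable section

/-! ### Local existence of fibre functors -/

section LocalFibreFunctors

variable {M : Type u} [TopologicalSpace M] {𝒪 : FunctionSheaf M} {𝒯 : TangentMultiplication 𝒪}
  {η : InvariantMetric 𝒯} {n : ℕ} {B : CardyFibration η n}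

namespace CardyFibration

open LinearStack

/-- Around each point there is a fibre functor for each of the idempotents. Either some label over a
neighbourhood of `x` has a rank one idempotent below `eᵢ`, which gives a fibre functor, or `eᵢ` acts
as zero around `x` on all labels; on a connected neighbourhood it then acts as zero, and the zero
functor is a fibre functor. -/
lemma exists_fibreFunctors [LocallyConnectedSpace M] (h𝒪 : 𝒪.HasLocalInverses)
    (hev : 𝒪.HasLocalEigenvectors) (hroots : 𝒪.HasLocalRoots) (hcont : 𝒪.IsContinuous)
    (hT : B.IsTrivializable) (x : M) :
    ∃ (V : Opens M) (hV : V ∈ B.cover) (D : RootedFrame η n V), x ∈ V ∧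
      Nonempty (∀ i, FibreFunctor D (B.cardy V hV) i) := by
  obtain ⟨U, hU, hxU⟩ := B.covers x
  obtain ⟨e, he⟩ := B.semisimple U hU
  have hlocal : ∀ i, ∃ (W : Opens M) (hWU : W ≤ U), x ∈ W ∧
      (∃ g : 𝒪.sec W, g * g = 𝒪.res hWU (η.trace (e i))) ∧
      ((∃ (V : Opens M) (h : V ⟶ U) (hV : V ∈ B.cover) (a : B.Label V) (T : Over V)
        (p : HomOver a a T), W ≤ T.left ∧ p ≫ p = p ∧
        (B.cyCategory V).comp ((B.cardy V hV).ι a (𝒯.res T.hom.le (𝒯.res h.le (e i)))) p = p ∧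
        ∀ (T' : Over V) (g : T' ⟶ T) (σ : HomOver a a T'), ∃! c : 𝒪.sec T'.left,
          (HomOver.res g p ≫ σ) ≫ HomOver.res g p = c • HomOver.res g p) ∨
      ∀ (V : Opens M) (h : V ⟶ U) (hV : V ∈ B.cover) (a : B.Label V), x ∈ V → ∃ T : Over V,
        x ∈ T.left ∧ (B.cardy V hV).ι a (𝒯.res T.hom.le (𝒯.res h.le (e i))) = 0) := fun i ↦ by
    obtain ⟨W₀, hW₀, hxW₀, g, hg⟩ := hroots U (η.trace (e i)) ⟨x, hxU⟩ (fun h0 ↦ by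
      obtain ⟨t, ht⟩ := (he.isUnit_trace η i).exists_left_inv
      have := congrArg (FunctionSheaf.eval (⟨x, hxU⟩ : U)) ht
      rw [map_mul, FunctionSheaf.eval_apply _ (η.trace (e i)), h0, mul_zero, map_one] at this
      exact zero_ne_one this)
    -- in both cases a root of `θ(eᵢ)` is provided, since one is needed at a sheet without labels
    by_cases hdead : ∀ (V : Opens M) (h : V ⟶ U) (hV : V ∈ B.cover) (a : B.Label V), x ∈ V →
        ∃ T : Over V, x ∈ T.left ∧ (B.cardy V hV).ι a (𝒯.res T.hom.le (𝒯.res h.le (e i))) = 0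
    · exact ⟨W₀, hW₀, hxW₀, ⟨g, hg⟩, Or.inr hdead⟩
    · push Not at hdead
      obtain ⟨V, h, hV, a, hxV, hne⟩ := hdead
      obtain ⟨T, f, hxT, p, hp1, hp2, hp3⟩ := (B.cardy V hV).exists_rank_one (he.restrict h.le) h𝒪
        hev (a := a) (Over.mk (𝟙 V)) hxV i fun T' _ hx' ↦ hne T' hx'
      exact ⟨W₀ ⊓ T.left, inf_le_left.trans hW₀, ⟨hxW₀, hxT⟩, ⟨𝒪.res inf_le_left g, by
        rw [← map_mul, hg]; rfl⟩, Or.inl ⟨V, h, hV, a, T, p, inf_le_right, hp1, hp2, hp3⟩⟩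
  choose W hWU hxW hg hcases using hlocal
  -- a connected neighbourhood which is good for all the idempotents; it belongs to the cover by
  -- trivializability
  obtain ⟨S, ⟨hSo, hxS, hSc⟩, hSW⟩ := (LocallyConnectedSpace.open_connected_basis x).mem_iff.1
    (Filter.inter_mem (U.isOpen.mem_nhds hxU)
      (Filter.iInter_mem.2 fun i ↦ (W i).isOpen.mem_nhds (hxW i)))
  let V : Opens M := ⟨S, hSo⟩
  have hVU : V ≤ U := fun y hy ↦ (hSW hy).1
  have hVW : ∀ i, V ≤ W i := fun i y hy ↦ Set.mem_iInter.1 (hSW hy).2 i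
  have hV : V ∈ B.cover := hT U hU V hVU
  have heV := he.restrict hVU
  have key : ∀ i, ∃ v : 𝒪.sec V, v * v = η.trace (𝒯.res hVU (e i)) ∧ ∀ D : RootedFrame η n V,
      D.e i = 𝒯.res hVU (e i) → D.root i = v →
      Nonempty (FibreFunctor D (B.cardy V hV) i) := fun i ↦ by
    rcases hcases i with ⟨V', h, hV', a, T, p, hWT, hp1, hp2, hp3⟩ | hdead
    -- the root is `θ_a(p)`, whose square is `θ(eᵢ)` by the Cardy condition
    · let R := rankOneIdempotent hV' hV (homOfLE ((hVW i).trans (hWT.trans T.hom.le)))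
        ((hVW i).trans hWT) hp1 hp2 hp3
      refine ⟨(B.cyCategory V).trace R.p, RankOneIdempotent.trace_sq heV R h𝒪, fun D hDe hv ↦ ?_⟩
      let R' : RankOneIdempotent (B.cardy V hV) (D.e i)
          ((B.restr (homOfLE ((hVW i).trans (hWT.trans T.hom.le)))).obj a) :=
        { p := R.p
          idem := R.idem
          support := by rw [hDe]; exact R.support
          existsUnique := R.existsUnique }
      exact ⟨R'.fixedRealization.fibreFunctor h𝒪 hv⟩
    · obtain ⟨g, hg⟩ := hg i
      refine ⟨𝒪.res (hVW i) g, by rw [← map_mul, hg]; exact (η.trace_res _ _).symm, fun D hDe hv ↦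
        ⟨zeroFibreFunctor fun b ↦ ?_⟩⟩
      rw [hDe]
      obtain ⟨T, hxT, h0⟩ := hdead V (homOfLE hVU) hV b hxS
      refine (B.cyCategory V).eq_zero_of_isPreconnected h𝒪 hcont hSc.isPreconnected ?_ hxT
        (a := b) ?_
      · rw [← (B.cardy V hV).ι_mul, heV.mul_eq, if_pos rfl]
      · rw [(B.cardy V hV).ι_res]
        exact h0
  choose v hv hv' using key
  have hu : ∀ i, IsUnit (v i) := fun i ↦
    isUnit_of_mul_isUnit_left (y := v i) (by rw [hv]; exact heV.isUnit_trace η i)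
  choose u hu using fun i ↦ (hu i).exists_right_inv
  let D : RootedFrame η n V := ⟨_, heV, v, u, hu, hv⟩
  exact ⟨V, hV, D, hxS, ⟨fun i ↦ (hv' i D rfl rfl).some⟩⟩

end CardyFibration

end LocalFibreFunctors

/-! ### Labels corresponding to the structure sheaf -/

section Simple

variable {M : Type u} [TopologicalSpace M] {𝒪 : FunctionSheaf M} {𝒯 : TangentMultiplication 𝒪}
  {η : InvariantMetric 𝒯} {U : Opens M} {n : ℕ} {𝒞 : CYCategory 𝒪 U} {h : CardyStructure η 𝒞}

variable (𝒪 U) in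
/-- The sections of the structure sheaf, as functions. -/
def unitSecEquiv (T : Over U) :
    Sec (SheafOfModules.unit (𝒪.sheaf.over U)) T ≃ₗ[𝒪.sec T.left] 𝒪.sec T.left where
  toFun c := c
  invFun c := c
  map_add' _ _ := rfl
  map_smul' _ _ := rfl

lemma unit_isFrame (T : Over U) :
    IsFrame (N := SheafOfModules.unit (𝒪.sheaf.over U)) fun _ : Fin 1 ↦
      (unitSecEquiv 𝒪 U T).symm 1 := fun T' f m ↦ by
  have h1 : ((unitSecEquiv 𝒪 U T).symm 1).res f = (unitSecEquiv 𝒪 U T').symm 1 := rfl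
  refine ⟨fun _ ↦ unitSecEquiv 𝒪 U T' m, ?_, fun c hc ↦ funext fun j ↦ ?_⟩
  · dsimp only
    rw [h1, Fin.sum_univ_one, ← map_smul, smul_eq_mul, mul_one, LinearEquiv.symm_apply_apply]
  · dsimp only at hc
    rw [hc, h1, Fin.sum_univ_one, ← map_smul, smul_eq_mul, mul_one, LinearEquiv.apply_symm_apply,
      Subsingleton.elim j 0]

variable (𝒪 U) in
/-- The structure sheaf as a locally free module. -/
def unitLF : LF 𝒪 U :=
  ⟨SheafOfModules.unit (𝒪.sheaf.over U), fun x hx ↦ ⟨Over.mk (𝟙 U), hx, 1, _, unit_isFrame _⟩⟩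

/-- The sheaf of endomorphisms of a label whose identity is a rank one idempotent. -/
def RankOneIdempotent.unitIso {X : 𝒯.Sec U} {a : 𝒞.Obj} (R : RankOneIdempotent h X a)
    (hp : R.p = 𝒞.id a _) : SheafOfModules.unit (𝒪.sheaf.over U) ≅ 𝒞.Hom a a :=
  have hid : ∀ T, R.pOver T = 𝒞.id a T := fun T ↦ by rw [RankOneIdempotent.pOver, hp, 𝒞.id_res]
  isoOfBijective
    (mkHom (fun T ↦ (LinearMap.toSpanSingleton _ _ (𝒞.id a T)).comp
        (unitSecEquiv 𝒪 U T).toLinearMap)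
      (fun {T T'} f c ↦ by
        refine Eq.trans ?_ (Sec.res_smul f (unitSecEquiv 𝒪 U T c) (𝒞.id a T)).symm
        rw [𝒞.id_res]
        rfl))
    (fun T ↦ by
      constructor
      · intro c c' hc
        refine R.smul_injective (T := T) ?_
        rw [hid]
        exact hc
      · intro (σ : Sec (𝒞.Hom a a) T)
        obtain ⟨c, hc, -⟩ := R.existsUnique T σ
        refine ⟨c, ?_⟩
        have h1 := hid T
        rw [RankOneIdempotent.pOver] at h1
        rw [h1, 𝒞.id_comp, 𝒞.comp_id] at hc
        exact hc.symm)

namespace FibreFunctor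

variable {D : RootedFrame η n U} (Φ : ∀ i, FibreFunctor D h i)

include Φ in
/-- A label which corresponds to the structure sheaf in the `i`-th place. -/
lemma exists_simple (hmax : h.IsMaximal) (i : Fin n) :
    ∃ (a : 𝒞.Obj) (R : RankOneIdempotent h (D.e i) a), R.p = 𝒞.id a _ ∧
      h.ι a (T := Over.mk (𝟙 U)) (D.e i) = 𝒞.id a _ := by
  obtain ⟨a, ha⟩ := exists_label Φ hmax (Function.update (fun _ ↦ zeroLF 𝒪 U) i (unitLF 𝒪 U))
  have hzero : ∀ k, k ≠ i → ∀ T, Subsingleton (Sec ((Φ k).E a).obj T) := fun k hk T ↦ by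
    obtain ⟨f⟩ := ha k
    rw [Function.update_of_ne hk] at f
    have : Function.Injective (Sec.mapₗ f.inv T) := Sec.map_injective f.symm
    exact this.subsingleton
  obtain ⟨f⟩ := ha i
  rw [Function.update_self] at f
  let s (T : Over U) : Sec ((Φ i).E a).obj T := ((unitSecEquiv 𝒪 U T).symm 1).map f.hom
  have hs : ∀ T, IsFrame fun _ : Fin 1 ↦ s T := fun T ↦ (unit_isFrame T).map_iso f
  -- all other fibres vanish, so an endomorphism is determined by its value at the generator `s`
  have hext : ∀ {T : Over U} {σ σ' : Sec (𝒞.Hom a a) T}, ((Φ i).act σ).app (𝟙 T) (s T) =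
      ((Φ i).act σ').app (𝟙 T) (s T) → σ = σ' := fun {T σ σ'} e ↦ eq_of_act_eq Φ fun k ↦ by
    by_cases hk : k = i
    · subst hk
      exact LocHom.ext_frame (hs T) fun _ ↦ e
    · have := hzero k hk
      exact LocHom.ext_app fun _ _ _ ↦ Subsingleton.elim _ _
  have hid : ∀ T, ((Φ i).act (𝒞.id a T)).app (𝟙 T) (s T) = s T := fun T ↦ by
    rw [(Φ i).act_id]
    rfl
  have hι : ∀ T : Over U, h.ι a (T := T) (𝒯.res T.hom.le (D.e i)) = 𝒞.id a T := fun T ↦ hext (by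
    rw [(Φ i).act_ι, if_pos rfl, (Φ i).act_id])
  refine ⟨a, ⟨𝒞.id a _, 𝒞.id_comp _, 𝒞.comp_id _ |>.trans (hι _), fun T σ ↦ ?_⟩, rfl, hι _⟩
  rw [𝒞.id_res, 𝒞.id_comp, 𝒞.comp_id]
  obtain ⟨c, hc, hc'⟩ := hs T T (𝟙 T) (((Φ i).act σ).app (𝟙 T) (s T))
  have hsm : ∀ d : 𝒪.sec T.left, ((Φ i).act (d • 𝒞.id a T)).app (𝟙 T) (s T) = d • s T := fun d ↦ by
    rw [map_smul, LocHom.smul_app, LinearMap.smul_apply, hid]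
    rfl
  refine ⟨c 0, hext ?_, fun d hd ↦ ?_⟩
  · rw [hsm, hc, Fin.sum_univ_one, Sec.res_id]
  · refine congrFun (hc' (fun _ ↦ d) ?_) 0
    dsimp only
    rw [hd, hsm, Fin.sum_univ_one, Sec.res_id]

end FibreFunctor

end Simple

end

end BraneFibration

namespace BraneFibration

noncomputable section

/-! ### Complete families of labels -/

section Assembly

variable {M : Type u} [TopologicalSpace M] {𝒪 : FunctionSheaf M}

open LinearStack

namespace LinearStack

variable {B : LinearStack 𝒪} {U V : Opens M}

instance (h : V ⟶ U) : (B.restr h).Additive := ⟨fun {_ _ _ _} ↦ B.map_add h _ _⟩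

/-- The global sections of `Γ_ab` are the morphisms `a → b`. -/
lemma bijective_restr_id (a b : B.Label U) :
    Function.Bijective fun σ : a ⟶ b ↦ ((B.restr (𝟙 U)).map σ : HomOver a b (Over.mk (𝟙 U))) := by
  let ν : B.restr (𝟙 U) ≅ 𝟭 _ := Cat.Hom.toNatIso (B.fib.mapId (.mk (op U)))
  have h1 : ∀ σ : a ⟶ b, (B.restr (𝟙 U)).map σ = ν.hom.app a ≫ σ ≫ ν.inv.app b := fun σ ↦ by
    have := ν.hom.naturality σ
    rw [Functor.id_map] at this
    rw [← Category.assoc, ← this, Category.assoc, Iso.hom_inv_id_app, Category.comp_id]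
  refine ⟨fun σ σ' e ↦ ?_, fun τ ↦ ⟨ν.inv.app a ≫ τ ≫ ν.hom.app b, ?_⟩⟩
  · dsimp only at e
    rw [h1, h1] at e
    exact (cancel_mono (ν.inv.app b)).1 ((cancel_epi (ν.hom.app a)).1 e)
  · dsimp only
    rw [h1]
    simp

lemma homSheafMap_id (a b : B.Label U) : homSheafMap a (𝟙 b) = 𝟙 (homSheaf a b) :=
  Sec.hom_ext fun T τ ↦ by
    refine (congrArg (τ ≫ ·) ((B.restr T.hom).map_id b)).trans ((Category.comp_id _).trans ?_)
    exact (Sec.map_id _).symm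

lemma homSheafMap_comp (a : B.Label U) {b c d : B.Label U} (σ : b ⟶ c) (τ : c ⟶ d) :
    homSheafMap a (σ ≫ τ) = homSheafMap a σ ≫ homSheafMap a τ :=
  Sec.hom_ext fun T ρ ↦ by
    rw [Sec.map_comp]
    refine (congrArg (ρ ≫ ·) ((B.restr T.hom).map_comp σ τ)).trans (Category.assoc _ _ _).symm

end LinearStack

namespace CYFibration

variable {B : CYFibration 𝒪} {U : Opens M} {n : ℕ}

/-- The labels `ξᵢ` induce an equivalence `a ↦ (Γ_{ξᵢ a})ᵢ` onto families of locally free sheaves: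
it is fully faithful on sheaves of morphisms and essentially surjective. -/
structure IsComplete (ξ : Fin n → B.Label U) : Prop where
  existsUnique {b c : B.Label U} {T : Over U}
    (φ : ∀ i, LocHom (homSheaf (ξ i) b) (homSheaf (ξ i) c) T) : ∃! σ : HomOver b c T,
      ∀ i (T' : Over U) (f : T' ⟶ T) (m : HomOver (ξ i) b T'),
        (φ i).app f m = (m ≫ HomOver.res f σ : HomOver (ξ i) c T')
  exists_label (N : Fin n → LF 𝒪 U) : ∃ b, ∀ i, Nonempty ((N i).obj ≅ homSheaf (ξ i) b)

namespace IsComplete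

variable {ξ : Fin n → B.Label U} (hξ : IsComplete ξ)

include hξ

lemma existsUnique_hom {b c : B.Label U} (φ : ∀ i, homSheaf (ξ i) b ⟶ homSheaf (ξ i) c) :
    ∃! σ : b ⟶ c, ∀ i, homSheafMap (ξ i) σ = φ i := by
  have h1 : ∀ σ : b ⟶ c, (∀ i, homSheafMap (ξ i) σ = φ i) ↔
      ∀ i (T' : Over U) (f : T' ⟶ Over.mk (𝟙 U)) (m : HomOver (ξ i) b T'),
        (LocHom.ofHom (φ i) (Over.mk (𝟙 U))).app f m =
          (m ≫ HomOver.res f ((B.restr (𝟙 U)).map σ) : HomOver (ξ i) c T') := fun σ ↦ by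
    have h2 : ∀ (T' : Over U) (f : T' ⟶ Over.mk (𝟙 U)),
        HomOver.res (a := b) (b := c) f ((B.restr (𝟙 U)).map σ) = (B.restr T'.hom).map σ :=
      fun T' f ↦ HomOver.res_map f σ
    constructor
    · intro e i T' f m
      rw [h2, ← map_homSheafMap, e]
      rfl
    · intro e i
      refine Sec.hom_ext fun T' m ↦ ?_
      have := e i T' (toTop T') m
      rw [h2] at this
      exact this.symm
  obtain ⟨σ₀, hσ₀, huniq⟩ := hξ.existsUnique fun i ↦ LocHom.ofHom (φ i) (Over.mk (𝟙 U))
  obtain ⟨σ, rfl⟩ := (bijective_restr_id b c).2 σ₀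
  exact ⟨σ, (h1 σ).2 hσ₀, fun σ' hσ' ↦ (bijective_restr_id b c).1 (huniq _ ((h1 σ').1 hσ'))⟩

lemma hom_ext {b c : B.Label U} {σ σ' : b ⟶ c}
    (e : ∀ i, homSheafMap (ξ i) σ = homSheafMap (ξ i) σ') : σ = σ' :=
  (hξ.existsUnique_hom fun i ↦ homSheafMap (ξ i) σ').unique e fun _ ↦ rfl

lemma isEquivalence : (Functor.pi' fun i ↦ homFunctor (ξ i)).IsEquivalence where
  faithful := ⟨fun {_ _ _ _} e ↦ hξ.hom_ext fun i ↦
    congrArg (fun φ ↦ (φ i).hom) e⟩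
  full := ⟨fun {b c} φ ↦ by
    obtain ⟨σ, hσ, -⟩ := hξ.existsUnique_hom fun i ↦ (φ i).hom
    exact ⟨σ, funext fun i ↦ by ext1; exact hσ i⟩⟩
  essSurj := ⟨fun N ↦ by
    obtain ⟨b, hb⟩ := hξ.exists_label N
    exact ⟨b, ⟨(Pi.isoMk fun i ↦ ObjectProperty.isoMk _ (hb i).some).symm⟩⟩⟩

/-- The label with components zero except for `N` in the `i`-th place is `N ⊗ ξᵢ`: a morphism from it
is a morphism of the `i`-th components. -/
lemma exists_tensor (i : Fin n) (N : LF 𝒪 U) :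
    ∃ (s : B.Label U) (η : N.obj ≅ homSheaf (ξ i) s),
      (∀ k, k ≠ i → ∀ T, Subsingleton (HomOver (ξ k) s T)) ∧ IsTensor N.obj (ξ i) s η.hom := by
  obtain ⟨s, hs⟩ := hξ.exists_label (Function.update (fun _ ↦ zeroLF 𝒪 U) i N)
  have hzero : ∀ k, k ≠ i → ∀ T, Subsingleton (HomOver (ξ k) s T) := fun k hk T ↦ by
    obtain ⟨f⟩ := hs k
    rw [Function.update_of_ne hk] at f
    have : Function.Injective (Sec.mapₗ f.inv T) := Sec.map_injective f.symm
    exact this.subsingleton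
  obtain ⟨η⟩ := hs i
  rw [Function.update_self] at η
  refine ⟨s, η, hzero, fun b T φ hφ ↦ ?_⟩
  let ψ : LocHom N.obj (homSheaf (ξ i) b) T :=
    ⟨fun {T'} f ↦ φ T' f, fun {T' T''} f g m ↦ hφ T' T'' f g m⟩
  obtain ⟨τ, hτ, huniq⟩ := hξ.existsUnique (b := s) (c := b) (T := T)
    (Function.update 0 i ((LocHom.ofHom η.inv T).comp ψ))
  refine ⟨τ, fun T' f m ↦ ?_, fun τ' hτ' ↦ huniq τ' fun k T' f m ↦ ?_⟩
  · have h1 := hτ i T' f (m.map η.hom)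
    rw [Function.update_self] at h1
    rw [← h1]
    exact congrArg (φ T' f) (Sec.map_hom_inv η m).symm
  · by_cases hk : k = i
    · subst hk
      rw [Function.update_self]
      refine (hτ' T' f (Sec.map η.inv m)).trans ?_
      exact congrArg (fun x : HomOver (ξ k) s T' ↦ x ≫ HomOver.res f τ') (Sec.map_inv_hom η m)
    · have := hzero k hk T'
      rw [Subsingleton.elim m 0, Limits.zero_comp]
      exact map_zero _

/-- Each label is the sum of its components. Inclusions and projections of the summands are obtained
from those of the components by full faithfulness. -/
lemma isSumOfTensors (N : Fin n → LF 𝒪 U) (t : B.Label U)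
    (γ : ∀ i, (N i).obj ≅ homSheaf (ξ i) t) :
    IsSumOfTensors (fun i ↦ (N i).obj) ξ t fun i ↦ (γ i).hom := by
  choose s η hzero hη using fun i ↦ hξ.exists_tensor i (N i)
  have hinj : ∀ i, ∃ σ : s i ⟶ t, homSheafMap (ξ i) σ = (η i).inv ≫ (γ i).hom := fun i ↦ by
    obtain ⟨σ, hσ, -⟩ := hξ.existsUnique_hom (b := s i) (c := t)
      (Function.update 0 i ((η i).inv ≫ (γ i).hom))
    exact ⟨σ, by rw [hσ, Function.update_self]⟩
  have hproj : ∀ i, ∃ σ : t ⟶ s i, homSheafMap (ξ i) σ = (γ i).inv ≫ (η i).hom := fun i ↦ by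
    obtain ⟨σ, hσ, -⟩ := hξ.existsUnique_hom (b := t) (c := s i)
      (Function.update 0 i ((γ i).inv ≫ (η i).hom))
    exact ⟨σ, by rw [hσ, Function.update_self]⟩
  choose inj hinj using hinj
  choose proj hproj using hproj
  refine ⟨s, fun i ↦ (η i).hom, inj, proj, hη, fun i ↦ hξ.hom_ext fun k ↦ ?_,
    fun i j hij ↦ hξ.hom_ext fun k ↦ ?_, hξ.hom_ext fun k ↦ ?_, fun i ↦ ?_⟩
  · by_cases hk : k = i
    · subst hk
      rw [homSheafMap_comp, homSheafMap_id, hinj, hproj]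
      simp
    · exact Sec.hom_ext fun T m ↦ (hzero i k hk T).elim _ _
  · refine Sec.hom_ext fun T m ↦ ?_
    by_cases hk : k = i
    · exact (hzero j k (hk ▸ hij) T).elim _ _
    · have : m = 0 := (hzero i k hk T).elim _ _
      rw [this]
      exact (Sec.map_zero _).trans (Sec.map_zero _).symm
  · refine Sec.hom_ext fun T (m : HomOver (ξ k) t T) ↦ ?_
    refine Eq.trans ?_ ((congrArg (fun φ : homSheaf (ξ k) t ⟶ homSheaf (ξ k) t ↦
      Sec.map (T := T) φ m)
      (homSheafMap_id (ξ k) t)).trans (Sec.map_id _)).symm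
    change m ≫ (B.restr T.hom).map (∑ i, proj i ≫ inj i) = m
    rw [Functor.map_sum, Preadditive.comp_sum, Finset.sum_eq_single k]
    · refine (congrArg (fun φ : homSheaf (ξ k) t ⟶ homSheaf (ξ k) t ↦
        Sec.map (T := T) φ m) (homSheafMap_comp (ξ k) (proj k) (inj k))).trans ?_
      rw [hinj, hproj]
      simp only [Category.assoc, Iso.hom_inv_id_assoc, Iso.inv_hom_id]
      exact Sec.map_id (N := homSheaf (ξ k) t) m
    · intro i _ hi
      rw [Functor.map_comp, ← Category.assoc]
      have : m ≫ (B.restr T.hom).map (proj i) = 0 := (hzero i k hi.symm T).elim _ _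
      rw [this, Limits.zero_comp]
    · simp
  · rw [hinj, Iso.hom_inv_id_assoc]

end IsComplete

end CYFibration

namespace CardyFibration

variable {𝒯 : TangentMultiplication 𝒪} {η : InvariantMetric 𝒯} {n : ℕ} {B : CardyFibration η n}
  {V : Opens M} {hV : V ∈ B.cover}

/-- If there are fibre functors for all idempotents, then maximality provides labels `ξᵢ` which
correspond to the structure sheaf in the `i`-th place. By maximality again, now for the fibre
functors `Γ_{ξᵢ b}`, these labels are complete. -/
lemma exists_isComplete (h𝒪 : 𝒪.HasLocalInverses) (hB : (B.cardy V hV).IsMaximal)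
    {D : RootedFrame η n V} (Φ : ∀ i, FibreFunctor D (B.cardy V hV) i) :
    ∃ ξ : Fin n → B.Label V, CYFibration.IsComplete ξ ∧
      (∀ i, IsSupportedOn hV (ξ i) (D.e i)) ∧
      ∀ i, Nonempty (homSheaf (ξ i) (ξ i) ≅ SheafOfModules.unit (𝒪.sheaf.over V)) := by
  choose ξ R hR hξ using FibreFunctor.exists_simple Φ hB
  choose u hu using fun i ↦ (R i).isUnit_trace.exists_right_inv
  -- fibre functors require the traces of the new idempotents as roots, which may differ in sign from
  -- the given ones
  let D' : RootedFrame η n V := ⟨D.e, D.frame, fun i ↦ (B.cyCategory V).trace (R i).p, u, hu,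
    fun i ↦ RankOneIdempotent.trace_sq D.frame (R i) h𝒪⟩
  let R' : ∀ i, RankOneIdempotent (B.cardy V hV) (D'.e i) (ξ i) := R
  let ℛ := fun i ↦ (R' i).idRealization (hR i)
  let Φ' : ∀ i, FibreFunctor D' (B.cardy V hV) i := fun i ↦ (ℛ i).fibreFunctor h𝒪 rfl
  have hact : ∀ {b c : B.Label V} {T : Over V} (σ : HomOver b c T) i (T' : Over V) (f : T' ⟶ T)
      (m : HomOver (ξ i) b T'), ((Φ' i).act (b := b) (c := c) σ).app f m =
        (m ≫ HomOver.res f σ : HomOver (ξ i) c T') := fun σ i T' f m ↦ (ℛ i).map_act σ f m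
  refine ⟨ξ, ⟨fun {b c T} φ ↦ ?_, fun N ↦ ?_⟩, hξ, fun i ↦ ⟨((R i).unitIso (hR i)).symm⟩⟩
  · obtain ⟨σ, hσ⟩ := FibreFunctor.exists_act_eq Φ' (b := b) (c := c) φ
    refine ⟨σ, fun i T' f m ↦ ?_, fun σ' hσ' ↦ ?_⟩
    · refine Eq.trans ?_ (hact σ i T' f m)
      rw [hσ]
      rfl
    · refine FibreFunctor.eq_of_act_eq Φ' (b := b) (c := c) fun i ↦ LocHom.ext_app fun T' f m ↦ ?_
      rw [hσ]
      exact (hact σ' i T' f m).trans (hσ' i T' f m).symm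
  · exact FibreFunctor.exists_label Φ' hB N

end CardyFibration

end Assembly

end

end BraneFibration

namespace BraneFibration

noncomputable section

/-! ### Modules over the spectral cover -/

section Spectral

variable {M : Type u} [TopologicalSpace M] {𝒪 : FunctionSheaf M} {𝒯 : TangentMultiplication 𝒪}
  {U V : Opens M} {n : ℕ} {e : Fin n → 𝒯.Sec U} (he : 𝒯.IsIdempotentFrame e)

namespace TSec

variable {N N' : SheafOfModules.{u} (𝒯.sheaf.over U)} {T T' T'' : Over U}

lemma res_add (f : T' ⟶ T) (s t : TSec N T) : (s + t).res f = s.res f + t.res f :=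
  (N.val.map f.op).hom.map_add s t

lemma res_smul (f : T' ⟶ T) (X : 𝒯.Sec T.left) (s : TSec N T) :
    TSec.res f (X • s) = 𝒯.res f.left.le X • s.res f :=
  (N.val.map f.op).hom.map_smul X s

lemma res_sum (f : T' ⟶ T) {ι : Type*} (I : Finset ι) (s : ι → TSec N T) :
    TSec.res f (∑ i ∈ I, s i) = ∑ i ∈ I, (s i).res f :=
  map_sum (AddMonoidHom.mk' (TSec.res (N := N) f) (res_add f)) s I

lemma res_id (s : TSec N T) : s.res (𝟙 T) = s :=
  congrArg (fun φ : N.val.obj (op T) ⟶ _ ↦ φ.hom s) (N.val.map_id (op T))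

lemma res_res (f : T' ⟶ T) (g : T'' ⟶ T') (s : TSec N T) : (s.res f).res g = s.res (g ≫ f) := by
  have := N.val.map_comp f.op g.op
  exact (ConcreteCategory.congr_hom this s).symm

/-- The map on sections over `T` given by a morphism of modules. -/
def mapₗ (ψ : N ⟶ N') (T : Over U) : TSec N T →ₗ[𝒯.Sec T.left] TSec N' T where
  toFun m := ψ.val.app (op T) m
  map_add' := (ψ.val.app (op T)).hom.map_add
  map_smul' := (ψ.val.app (op T)).hom.map_smul

lemma mapₗ_res (ψ : N ⟶ N') (f : T' ⟶ T) (m : TSec N T) :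
    mapₗ ψ T' (m.res f) = (mapₗ ψ T m).res f :=
  PresheafOfModules.naturality_apply ψ.val f.op m

end TSec

namespace TangentMultiplication.IsIdempotentFrame

/-- The `k`-th coefficient of a vector field, as a homomorphism of rings. -/
def coeffHom (h : V ≤ U) (k : Fin n) : 𝒯.Sec V →+* 𝒪.sec V where
  toFun X := he.coeff h X k
  map_zero' := by simpa using congrFun (he.coeff_smul h 0 0) k
  map_one' := he.coeff_one h k
  map_add' X Y := congrFun (he.coeff_add h X Y) k
  map_mul' X Y := he.coeff_mul h X Y k

/-- The sections of `N`, regarded as a module on the `k`-th sheet of the spectral cover: vector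
fields act through their `k`-th coefficient. -/
def SheetSec (_ : 𝒯.IsIdempotentFrame e) (_ : Fin n) (N : SheafOfModules.{u} (𝒪.sheaf.over U))
    (T : Over U) : Type u := BraneFibration.Sec N T

variable (k : Fin n) (N : SheafOfModules.{u} (𝒪.sheaf.over U))

instance (T : Over U) : AddCommGroup (he.SheetSec k N T) :=
  inferInstanceAs (AddCommGroup (BraneFibration.Sec N T))

instance (T : Over U) : Module ((𝒯.sheaf.over U).obj.obj (op T)) (he.SheetSec k N T) :=
  show Module (𝒯.Sec T.left) (BraneFibration.Sec N T) from
    Module.compHom (R := 𝒪.sec T.left) _ (he.coeffHom T.hom.le k)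

/-- The restriction maps of a module on the `k`-th sheet. -/
def sheetSystem : SectionSystem (𝒯.sheaf.over U) (he.SheetSec k N) where
  res f := AddMonoidHom.mk' (fun s : BraneFibration.Sec N _ ↦ s.res f) (Sec.res_add f)
  res_id _ s := Sec.res_id (N := N) s
  res_comp f g s := (Sec.res_res (N := N) f g s).symm
  res_smul {T T'} f X s := (Sec.res_smul (N := N) f (he.coeff T.hom.le X k) s).trans
    (congrArg (fun c : 𝒪.sec T'.left ↦ c • Sec.res (N := N) f s)
      (he.coeff_res T.hom.le f.left.le X k).symm)
  sep s s' h := Sec.ext_locally (N := N) h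
  glue T' f hT s hs := Sec.exists_glue (N := N) T' f hT s hs

/-- The `𝒯`-module `⨁ₖ Nₖ`, with `Nₖ` on the `k`-th sheet. -/
def sheetSum (N : Fin n → LF 𝒪 U) : SheafOfModules.{u} (𝒯.sheaf.over U) :=
  (SectionSystem.pi fun k ↦ he.sheetSystem k (N k).obj).sheaf

variable {N N' : Fin n → LF 𝒪 U} {T T' : Over U}

/-- The `k`-th component of a section of the sum. -/
def proj (k : Fin n) : TSec (he.sheetSum N) T →+ BraneFibration.Sec (N k).obj T :=
  Pi.evalAddMonoidHom (fun k ↦ he.SheetSec k (N k).obj T) k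

/-- The section of the sum with given components. -/
def ofComponents (m : ∀ k, BraneFibration.Sec (N k).obj T) : TSec (he.sheetSum N) T := m

lemma ext_proj {m m' : TSec (he.sheetSum N) T} (h : ∀ k, he.proj k m = he.proj k m') : m = m' :=
  funext h

lemma proj_smul (X : 𝒯.Sec T.left) (m : TSec (he.sheetSum N) T) (k : Fin n) :
    he.proj k (X • m) = he.coeff T.hom.le X k • he.proj k m := rfl

lemma proj_res (f : T' ⟶ T) (m : TSec (he.sheetSum N) T) (k : Fin n) :
    he.proj k (m.res f) = (he.proj k m).res f := rfl

/-- A section of `Nₖ` as a section of the sum. -/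
def single (k : Fin n) (m : BraneFibration.Sec (N k).obj T) : TSec (he.sheetSum N) T :=
  he.ofComponents (Pi.single k m)

lemma proj_single (k : Fin n) (m : BraneFibration.Sec (N k).obj T) :
    he.proj k (he.single k m) = m :=
  Pi.single_eq_same (M := fun k ↦ BraneFibration.Sec (N k).obj T) k m

lemma proj_single_of_ne {k l : Fin n} (hl : l ≠ k) (m : BraneFibration.Sec (N k).obj T) :
    he.proj l (he.single k m) = 0 :=
  Pi.single_eq_of_ne (M := fun k ↦ BraneFibration.Sec (N k).obj T) hl m

lemma coeff_smul_self (c : 𝒪.sec T.left) (k : Fin n) :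
    he.coeff T.hom.le (c • 𝒯.res T.hom.le (e k)) k = c := by
  rw [he.coeff_smul, Pi.smul_apply, he.coeff_self, if_pos rfl, smul_eq_mul, mul_one]

lemma idempotent_smul (m : TSec (he.sheetSum N) T) (k : Fin n) :
    𝒯.res T.hom.le (e k) • m = he.single k (he.proj k m) := he.ext_proj fun l ↦ by
  rw [proj_smul, he.coeff_self]
  by_cases hl : l = k
  · subst hl
    rw [if_pos rfl, one_smul, proj_single]
  · rw [if_neg (Ne.symm hl), zero_smul, he.proj_single_of_ne hl]

lemma isLocallyFree_sheetSum (N : Fin n → LF 𝒪 U) :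
    IsLocallyFreeOverSpectralCover 𝒯 n (he.sheetSum N) := fun x hx ↦ by
  obtain ⟨T, f, hxT, d, s, hs⟩ := exists_frames N (Over.mk (𝟙 U)) hx
  refine ⟨T, hxT, _, he.restrict T.hom.le, d, fun i j ↦ he.single i (s i j), fun i j ↦ ?_,
    fun T' g m ↦ ?_⟩
  · rw [idempotent_smul, proj_single]
  have hsum : ∀ c : ∀ i, Fin (d i) → 𝒪.sec T'.left, ∀ k,
      he.proj k (∑ i, ∑ j, (c i j • 𝒯.res g.left.le (𝒯.res T.hom.le (e i))) •
        TSec.res g (he.single i (s i j))) = ∑ j, c k j • (s k j).res g := fun c k ↦ by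
    rw [map_sum, Finset.sum_eq_single k]
    · rw [map_sum]
      refine Finset.sum_congr rfl fun j _ ↦ ?_
      rw [proj_smul, proj_res, proj_single]
      exact congrArg (· • _) (he.coeff_smul_self (c k j) k)
    · intro i _ hi
      rw [map_sum]
      refine Finset.sum_eq_zero fun j _ ↦ ?_
      rw [proj_smul, proj_res, he.proj_single_of_ne hi.symm, Sec.res_zero, smul_zero]
    · simp
  choose c hc hc' using fun k ↦ hs k T' g (he.proj k m)
  refine ⟨c, he.ext_proj fun k ↦ (hc k).trans (hsum c k).symm, fun c' h' ↦ funext fun k ↦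
    hc' k _ ?_⟩
  exact (congrArg (he.proj k) h').trans (hsum c' k)

/-- The morphism of sums with given components. -/
def sheetMap (φ : ∀ k, (N k).obj ⟶ (N' k).obj) : he.sheetSum N ⟶ he.sheetSum N' :=
  mkModuleHom (N := he.sheetSum N) (N' := he.sheetSum N')
    (fun T ↦ AddMonoidHom.mk'
      (fun m : TSec (he.sheetSum N) T ↦ he.ofComponents fun k ↦ (he.proj k m).map (φ k))
      fun m m' ↦ he.ext_proj fun k ↦ Sec.map_add (φ k) _ _)
    (fun T X m ↦ he.ext_proj fun k ↦ Sec.map_smul (φ k) (he.coeff T.hom.le X k) (he.proj k m))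
    fun f m ↦ he.ext_proj fun k ↦ Sec.map_res (φ k) f (he.proj k m)

lemma proj_mapₗ_sheetMap (φ : ∀ k, (N k).obj ⟶ (N' k).obj) (m : TSec (he.sheetSum N) T)
    (k : Fin n) : he.proj k (TSec.mapₗ (he.sheetMap φ) T m) = (he.proj k m).map (φ k) := rfl

lemma sheetMap_injective {φ φ' : ∀ k, (N k).obj ⟶ (N' k).obj}
    (h : he.sheetMap φ = he.sheetMap φ') (k : Fin n) : φ k = φ' k :=
  Sec.hom_ext fun T m ↦ by
    have h1 := congrArg (fun χ ↦ he.proj k (TSec.mapₗ χ T (he.single k m))) h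
    rwa [proj_mapₗ_sheetMap, proj_mapₗ_sheetMap, proj_single] at h1

/-- A homomorphism commutes with the idempotents, hence preserves the components. -/
lemma exists_sheetMap_eq (ψ : he.sheetSum N ⟶ he.sheetSum N') :
    ∃ φ : ∀ k, (N k).obj ⟶ (N' k).obj, he.sheetMap φ = ψ := by
  refine ⟨fun k ↦ mkHom (fun T ↦
    { toFun := fun m ↦ he.proj k (TSec.mapₗ ψ T (he.single k m))
      map_add' := fun m m' ↦ ?_
      map_smul' := fun c m ↦ ?_ }) fun {T T'} f m ↦ ?_, ?_⟩
  · have : he.single k (m + m') = he.single k m + he.single k m' :=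
      congrArg he.ofComponents (Pi.single_add (f := fun k ↦ BraneFibration.Sec (N k).obj T) k m m')
    rw [this, map_add, map_add]
  · have h1 : he.single k (c • m) = (c • 𝒯.res T.hom.le (e k)) • he.single k m :=
      he.ext_proj fun l ↦ by
        rw [proj_smul]
        by_cases hl : l = k
        · subst hl
          rw [coeff_smul_self, proj_single, proj_single]
        · rw [he.proj_single_of_ne hl, he.proj_single_of_ne hl, smul_zero]
    rw [h1, map_smul, proj_smul, coeff_smul_self]
    rfl
  · have h1 : he.single k (m.res f) = (he.single k m).res f := he.ext_proj fun l ↦ by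
      rw [proj_res]
      by_cases hl : l = k
      · subst hl
        rw [proj_single, proj_single]
      · rw [he.proj_single_of_ne hl, he.proj_single_of_ne hl, Sec.res_zero]
    change he.proj k (TSec.mapₗ ψ T' (he.single k (m.res f))) = _
    rw [h1, TSec.mapₗ_res, proj_res]
    rfl
  · refine moduleHom_ext fun T (m : TSec (he.sheetSum N) T) ↦ he.ext_proj fun k ↦ ?_
    change he.proj k (TSec.mapₗ ψ T (he.single k (he.proj k m))) = he.proj k (TSec.mapₗ ψ T m)
    rw [← idempotent_smul, map_smul, idempotent_smul, proj_single]

/-- The functor from families of locally free modules to modules over the spectral cover. -/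
def sheetFunctor : (Fin n → LF 𝒪 U) ⥤ TangentLF U 𝒯 n where
  obj N := ⟨he.sheetSum N, he.isLocallyFree_sheetSum N⟩
  map φ := ObjectProperty.homMk (he.sheetMap fun k ↦ (φ k).hom)
  map_id N := rfl
  map_comp φ ψ := rfl

lemma faithful_sheetFunctor : he.sheetFunctor.Faithful := ⟨fun {N N' φ ψ} h ↦ funext fun k ↦ by
  ext1
  exact he.sheetMap_injective (congrArg (·.hom) h) k⟩

lemma full_sheetFunctor : he.sheetFunctor.Full := ⟨fun {N N'} ψ ↦ by
  obtain ⟨φ, hφ⟩ := he.exists_sheetMap_eq ψ.hom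
  refine ⟨fun k ↦ ObjectProperty.homMk (φ k), ?_⟩
  ext1
  exact hφ⟩

end TangentMultiplication.IsIdempotentFrame

end Spectral

end

end BraneFibration

namespace BraneFibration

noncomputable section

/-! ### Parts of a module on the sheets of the spectral cover -/

section SheetParts

variable {M : Type u} [TopologicalSpace M] {𝒪 : FunctionSheaf M} {𝒯 : TangentMultiplication 𝒪}
  {U V : Opens M} {n : ℕ} {e : Fin n → 𝒯.Sec U} (he : 𝒯.IsIdempotentFrame e)

/-- The functions on `V` as multiples of the unit vector field. -/
def TangentMultiplication.scalar (𝒯 : TangentMultiplication 𝒪) (V : Opens M) :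
    𝒪.sec V →+* 𝒯.Sec V where
  toFun c := c • (1 : 𝒯.Sec V)
  map_zero' := zero_smul _ _
  map_one' := one_smul _ _
  map_add' _ _ := add_smul _ _ _
  map_mul' c d := by rw [smul_mul_assoc, one_mul, smul_smul]

/-- A module over the tangent sheaf, as a module over the functions. -/
instance (N : SheafOfModules.{u} (𝒯.sheaf.over U)) (T : Over U) :
    Module (𝒪.sec T.left) (TSec N T) :=
  Module.compHom _ (𝒯.scalar T.left)

namespace TSec

variable {N : SheafOfModules.{u} (𝒯.sheaf.over U)} {T T' T'' : Over U}

lemma smul_eq (c : 𝒪.sec T.left) (m : TSec N T) : c • m = 𝒯.scalar T.left c • m := rfl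

lemma smul_smul_eq (c : 𝒪.sec T.left) (X : 𝒯.Sec T.left) (m : TSec N T) :
    (c • X) • m = c • X • m := by
  rw [smul_eq, ← mul_smul]
  congr 1
  change _ = (c • (1 : 𝒯.Sec T.left)) * X
  rw [smul_mul_assoc, one_mul]

lemma smul_smul_comm (c : 𝒪.sec T.left) (X : 𝒯.Sec T.left) (m : TSec N T) :
    X • c • m = c • X • m := by
  rw [smul_eq, ← mul_smul, ← smul_smul_eq]
  congr 1
  change X * (c • (1 : 𝒯.Sec T.left)) = _
  rw [mul_smul_comm, mul_one]

lemma res_smul' (f : T' ⟶ T) (c : 𝒪.sec T.left) (m : TSec N T) :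
    TSec.res f (c • m) = 𝒪.res f.left.le c • m.res f := by
  rw [smul_eq, res_smul, smul_eq]
  congr 1
  change 𝒯.res f.left.le (c • 1) = _
  rw [𝒯.res_smul, map_one]
  rfl

end TSec

/-- Around each point, an idempotent function is zero or one. -/
lemma FunctionSheaf.exists_res_idempotent (h𝒪 : 𝒪.HasLocalInverses) {κ : Type*} [Fintype κ]
    (g : κ → 𝒪.sec V) (hg : ∀ j, g j * g j = g j) (x : V) :
    ∃ (W : Opens M) (h : W ≤ V), (x : M) ∈ W ∧ ∀ j, 𝒪.res h (g j) = 0 ∨ 𝒪.res h (g j) = 1 := by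
  classical
  -- `g` or `1 - g` does not vanish at `x`, hence is invertible, and an invertible idempotent is one
  let v : κ → 𝒪.sec V := fun j ↦ if (g j).1 x = 0 then 1 - g j else g j
  have hv : ∀ j, v j * v j = v j := fun j ↦ by
    dsimp only [v]
    split_ifs
    · linear_combination hg j
    · exact hg j
  obtain ⟨W, h, hx, hu⟩ := h𝒪 V (∏ j, v j) x (by
    change FunctionSheaf.eval x (∏ j, v j) ≠ 0
    rw [map_prod]
    refine Finset.prod_ne_zero_iff.2 fun j _ ↦ ?_
    dsimp only [v]
    split_ifs with h0
    · rw [map_sub, map_one, FunctionSheaf.eval_apply, h0, sub_zero]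
      exact one_ne_zero
    · exact h0)
  refine ⟨W, h, hx, fun j ↦ ?_⟩
  rw [map_prod] at hu
  have huj : IsUnit (𝒪.res h (v j)) := (IsUnit.prod_univ_iff.1 hu) j
  have h1 : 𝒪.res h (v j) = 1 := huj.mul_eq_left.1 (by rw [← map_mul, hv])
  dsimp only [v] at h1
  split_ifs at h1
  · left
    rw [map_sub, map_one] at h1
    linear_combination -h1
  · exact Or.inr h1

namespace TSec

variable (X : 𝒯.Sec U) (N : SheafOfModules.{u} (𝒯.sheaf.over U)) {T T' : Over U}

/-- The sections of `X N`. -/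
def part (T : Over U) : Submodule (𝒪.sec T.left) (TSec N T) where
  carrier := {m | 𝒯.res T.hom.le X • m = m}
  add_mem' {m m'} hm hm' := by
    change _ • (m + m') = m + m'
    rw [smul_add, show _ • m = m from hm, show _ • m' = m' from hm']
  zero_mem' := smul_zero _
  smul_mem' c m hm := by
    change _ • c • m = c • m
    rw [smul_smul_comm, show _ • m = m from hm]

variable {X N} in
lemma mem_part {m : TSec N T} : m ∈ part X N T ↔ 𝒯.res T.hom.le X • m = m := Iff.rfl

instance (T : Over U) : Module ((𝒪.sheaf.over U).obj.obj (op T)) (part X N T) :=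
  inferInstanceAs (Module (𝒪.sec T.left) (part X N T))

/-- The sections of `X N` and their restrictions. -/
def partSystem : SectionSystem (𝒪.sheaf.over U) fun T ↦ part X N T where
  res f := AddMonoidHom.mk' (fun m ↦ ⟨m.1.res f, by
    rw [mem_part]
    exact (res_smul f (𝒯.res _ X) m.1).symm.trans (congrArg (res f) m.2)⟩) fun m m' ↦
      Subtype.ext (res_add f m.1 m'.1)
  res_id T m := Subtype.ext (res_id m.1)
  res_comp f g m := Subtype.ext (res_res f g m.1).symm
  res_smul f r m := Subtype.ext (res_smul' f r m.1)
  sep m m' h := Subtype.ext (section_ext_locally N fun x hx ↦ by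
    obtain ⟨T', f, hx', e'⟩ := h x hx
    exact ⟨T', f, hx', congrArg Subtype.val e'⟩)
  glue {T _} T' f hT m hm := by
    obtain ⟨t, ht⟩ := section_exists_glue N T' f hT (fun i ↦ (m i).1)
      fun i j W g g' ↦ congrArg Subtype.val (hm i j W g g')
    refine ⟨⟨t, ?_⟩, fun i ↦ Subtype.ext (ht i)⟩
    refine section_ext_locally N fun x hx ↦ ?_
    obtain ⟨i, hi⟩ := hT x hx
    refine ⟨T' i, f i, hi, (res_smul (N := N) (f i) _ t).trans ?_⟩
    rw [show res (N := N) (f i) t = (m i).1 from ht i]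
    exact (m i).2.trans (ht i).symm

/-- The sheaf of `𝒪`-modules `X N`. -/
def partSheaf : SheafOfModules.{u} (𝒪.sheaf.over U) := (partSystem X N).sheaf

variable {X N}

/-- The inclusion of `X N` into `N`. -/
def incl (T : Over U) : Sec (partSheaf X N) T →ₗ[𝒪.sec T.left] TSec N T :=
  (part X N T).subtype

lemma incl_injective : Function.Injective (incl (X := X) (N := N) T) := Subtype.val_injective

lemma smul_incl (m : Sec (partSheaf X N) T) :
    𝒯.res T.hom.le X • incl T m = incl T m := Subtype.prop (p := (· ∈ part X N T)) m

lemma incl_res (f : T' ⟶ T) (m : Sec (partSheaf X N) T) :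
    incl T' (m.res f) = (incl T m).res f := rfl

lemma exists_incl_eq {m : TSec N T} (hm : 𝒯.res T.hom.le X • m = m) :
    ∃ m' : Sec (partSheaf X N) T, incl T m' = m := ⟨⟨m, hm⟩, rfl⟩

end TSec

namespace TangentMultiplication.IsIdempotentFrame

open TSec

variable {k : Fin n} {N : SheafOfModules.{u} (𝒯.sheaf.over U)} {T T' : Over U}

/-- Around each point `eₖ = ∑ⱼ gⱼ e'ⱼ` with `gⱼ` zero or one, where `e'ⱼ` are the idempotents for
which `N` has a basis. The members of the basis with `gⱼ = 1` form a basis of `eₖ N`. -/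
lemma isLocallyFree_partSheaf (he : 𝒯.IsIdempotentFrame e) (h𝒪 : 𝒪.HasLocalInverses)
    (hN : IsLocallyFreeOverSpectralCover 𝒯 n N) : IsLocallyFree (partSheaf (e k) N) := by
  classical
  refine isLocallyFree_of_frames fun x hx ↦ ?_
  obtain ⟨T, hxT, e', he', d, s, hs, huniq⟩ := hN x hx
  let g : Fin n → 𝒪.sec T.left := he'.coeff le_rfl (𝒯.res T.hom.le (e k))
  have hg : ∀ j, g j * g j = g j := fun j ↦ by
    rw [← he'.coeff_mul, he.mul_self]
  obtain ⟨W, hW, hxW, h01⟩ := FunctionSheaf.exists_res_idempotent h𝒪 g hg ⟨x, hxT⟩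
  -- `eₖ` acts on the members of the basis through its coefficients with respect to `e'`
  have hes : ∀ j i, 𝒯.res T.hom.le (e k) • s j i = g j • s j i := fun j i ↦ by
    have h1 := he'.mul_eq_smul le_rfl (𝒯.res T.hom.le (e k)) j
    have h2 : 𝒯.res (le_refl T.left) (e' j) = e' j := rfl
    rw [h2] at h1
    refine Eq.trans (congrArg (_ • ·) (hs j i).symm) ?_
    refine (SemigroupAction.mul_smul (𝒯.res T.hom.le (e k)) (e' j) (s j i)).symm.trans ?_
    refine (congrArg (· • s j i) h1).trans ?_
    change (g j • e' j) • s j i = _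
    rw [TSec.smul_smul_eq, hs]
  obtain ⟨T₁, f₁, hx₁, h01⟩ : ∃ (T₁ : Over U) (f : T₁ ⟶ T), x ∈ T₁.left ∧
      ∀ j, 𝒪.res f.left.le (g j) = 0 ∨ 𝒪.res f.left.le (g j) = 1 :=
    ⟨overMk T W hW, overHom hW, hxW, h01⟩
  have hes₁ : ∀ {T' : Over U} (f : T' ⟶ T₁) j i, 𝒯.res T'.hom.le (e k) • ((s j i).res f₁).res f =
      if 𝒪.res f₁.left.le (g j) = 1 then ((s j i).res f₁).res f else 0 := fun {T'} f j i ↦ by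
    have h1 := congrArg (fun m ↦ (TSec.res f₁ m).res f) (hes j i)
    rw [TSec.res_smul, TSec.res_smul, TSec.res_smul', TSec.res_smul'] at h1
    refine h1.trans ?_
    split_ifs with h0
    · rw [h0, map_one, one_smul]
    · rw [(h01 j).resolve_right h0, map_zero, zero_smul]
  -- the members of the basis in `eₖ N`
  let K := {p : Σ j, Fin (d j) // 𝒪.res f₁.left.le (g p.1) = 1}
  have hincl : ∀ p : K, ∃ m : BraneFibration.Sec (partSheaf (e k) N) T₁,
      incl T₁ m = (s p.1.1 p.1.2).res f₁ := fun p ↦ exists_incl_eq (by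
    have := hes₁ (𝟙 T₁) p.1.1 p.1.2
    rwa [if_pos p.2, TSec.res_id] at this)
  choose b hb using hincl
  refine ⟨T₁, hx₁, K, inferInstance, b, fun T' f m ↦ ?_⟩
  have hframe : ∃! c : (Σ j, Fin (d j)) → 𝒪.sec T'.left,
      incl T' m = ∑ p, c p • ((s p.1 p.2).res f₁).res f := by
    have hterm : ∀ j i (c : 𝒪.sec T'.left), (c • 𝒯.res (f ≫ f₁).left.le (e' j)) •
        (s j i).res (f ≫ f₁) = c • ((s j i).res f₁).res f := fun j i c ↦ by
      rw [TSec.smul_smul_eq, ← TSec.res_smul, hs, TSec.res_res]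
    obtain ⟨c, hc, hc'⟩ := huniq T' (f ≫ f₁) (incl T' m)
    simp only [hterm] at hc hc'
    refine ⟨fun p ↦ c p.1 p.2, ?_, fun c' h' ↦ ?_⟩
    · dsimp only
      rw [Fintype.sum_sigma]
      exact hc
    · dsimp only at h'
      rw [Fintype.sum_sigma] at h'
      have := hc' (fun j i ↦ c' ⟨j, i⟩) h'
      funext p
      exact congrFun (congrFun this p.1) p.2
  have hsum : ∀ c : K → 𝒪.sec T'.left, incl T' (∑ p, c p • (b p).res f) =
      ∑ p, (if h : 𝒪.res f₁.left.le (g p.1) = 1 then c ⟨p, h⟩ else 0) •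
        ((s p.1 p.2).res f₁).res f := fun c ↦ by
    rw [map_sum]
    simp only [map_smul, incl_res, hb]
    rw [← Finset.sum_subset (Finset.subset_univ (Finset.univ.filter
      fun p : Σ j, Fin (d j) ↦ 𝒪.res f₁.left.le (g p.1) = 1)) fun p _ hp ↦ by
        rw [dif_neg fun h ↦ hp (Finset.mem_filter.2 ⟨Finset.mem_univ p, h⟩), zero_smul]]
    rw [Finset.sum_subtype (p := fun p : Σ j, Fin (d j) ↦ 𝒪.res f₁.left.le (g p.1) = 1) _
      fun p ↦ by rw [Finset.mem_filter, and_iff_right (Finset.mem_univ p)]]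
    exact Finset.sum_congr rfl fun p _ ↦ by rw [dif_pos p.2]
  obtain ⟨c, hc, hc'⟩ := hframe
  refine ⟨fun p ↦ c p.1, incl_injective ?_, fun c' h' ↦ ?_⟩
  · rw [hsum, ← smul_incl m, hc, Finset.smul_sum]
    refine Finset.sum_congr rfl fun p _ ↦ ?_
    rw [TSec.smul_smul_comm, hes₁]
    split_ifs
    · rfl
    · rw [smul_zero, zero_smul]
  · dsimp only at h'
    have h1 := hc' _ ((congrArg (incl T') h').trans (hsum c'))
    funext p
    exact (dif_pos p.2).symm.trans (congrFun h1 p.1)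

/-- The parts of `N` on the sheets of the spectral cover. -/
def parts (he : 𝒯.IsIdempotentFrame e) (h𝒪 : 𝒪.HasLocalInverses)
    (hN : IsLocallyFreeOverSpectralCover 𝒯 n N) (k : Fin n) :
    LF 𝒪 U := ⟨partSheaf (e k) N, isLocallyFree_partSheaf he h𝒪 hN⟩

variable (h𝒪 : 𝒪.HasLocalInverses) (hN : IsLocallyFreeOverSpectralCover 𝒯 n N)

lemma smul_incl_coeff (X : 𝒯.Sec T.left) (m : BraneFibration.Sec (partSheaf (e k) N) T) :
    X • incl T m = he.coeff T.hom.le X k • incl T m := by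
  rw [← smul_incl m, ← SemigroupAction.mul_smul, he.mul_eq_smul, TSec.smul_smul_eq]

/-- The `k`-th component of a section, as a section of `N`. -/
def component (k : Fin n) (T : Over U) : TSec (he.sheetSum (he.parts h𝒪 hN)) T →+ TSec N T :=
  (incl (X := e k) (N := N) T).toAddMonoidHom.comp (he.proj k)

lemma component_smul (X : 𝒯.Sec T.left) (m : TSec (he.sheetSum (he.parts h𝒪 hN)) T) :
    he.component h𝒪 hN k T (X • m) = X • he.component h𝒪 hN k T m :=
  ((incl T).map_smul (he.coeff T.hom.le X k) (he.proj k m)).trans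
    (he.smul_incl_coeff X (he.proj k m)).symm

/-- The sum of the components of a section. -/
def sumIncl (T : Over U) : TSec (he.sheetSum (he.parts h𝒪 hN)) T →+ TSec N T :=
  ∑ k, he.component h𝒪 hN k T

lemma sumIncl_apply (m : TSec (he.sheetSum (he.parts h𝒪 hN)) T) :
    he.sumIncl h𝒪 hN T m = ∑ k, he.component h𝒪 hN k T m :=
  AddMonoidHom.finsetSum_apply _ _ _

lemma idempotent_smul_sumIncl (m : TSec (he.sheetSum (he.parts h𝒪 hN)) T) (k : Fin n) :
    𝒯.res T.hom.le (e k) • he.sumIncl h𝒪 hN T m = he.component h𝒪 hN k T m := by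
  rw [sumIncl_apply, Finset.smul_sum, Finset.sum_eq_single k]
  · exact smul_incl (he.proj k m)
  · intro l _ hl
    refine (he.smul_incl_coeff (k := l) _ (he.proj l m)).trans ?_
    rw [he.coeff_self, if_neg hl.symm, zero_smul]
  · simp

/-- A module over the spectral cover is the sum of its parts on the sheets. -/
def sheetSumPartsIso : he.sheetSum (he.parts h𝒪 hN) ≅ N :=
  isoOfBijective (mkModuleHom (N := he.sheetSum (he.parts h𝒪 hN)) (N' := N)
    (fun T ↦ he.sumIncl h𝒪 hN T)
    (fun T (X : 𝒯.Sec T.left) (m : TSec (he.sheetSum (he.parts h𝒪 hN)) T) ↦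
      show he.sumIncl h𝒪 hN T (X • m) = X • he.sumIncl h𝒪 hN T m by
        rw [sumIncl_apply, sumIncl_apply, Finset.smul_sum]
        exact Finset.sum_congr rfl fun k _ ↦ he.component_smul h𝒪 hN X m)
    fun {T T'} f (m : TSec (he.sheetSum (he.parts h𝒪 hN)) T) ↦
      show he.sumIncl h𝒪 hN T' (m.res f) = (he.sumIncl h𝒪 hN T m).res f by
        rw [sumIncl_apply, sumIncl_apply, TSec.res_sum]
        rfl)
    fun T ↦ by
      constructor
      · intro (m : TSec (he.sheetSum (he.parts h𝒪 hN)) T) m' h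
        refine he.ext_proj fun k ↦ incl_injective ?_
        exact (he.idempotent_smul_sumIncl h𝒪 hN m k).symm.trans <|
          (congrArg (fun t : TSec N T ↦ 𝒯.res T.hom.le (e k) • t) h).trans
            (he.idempotent_smul_sumIncl h𝒪 hN m' k)
      · intro (m : TSec N T)
        choose p hp using fun k ↦ exists_incl_eq (X := e k) (m := 𝒯.res T.hom.le (e k) • m)
          (by rw [← SemigroupAction.mul_smul, he.mul_self])
        refine ⟨he.ofComponents (N := he.parts h𝒪 hN) p, (sumIncl_apply ..).trans ?_⟩
        refine (Finset.sum_congr rfl fun k _ ↦ hp k).trans ?_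
        rw [← Finset.sum_smul, he.sum_eq_one, one_smul]

/-- Families of locally free modules are the same as modules over the spectral cover. -/
def sheetEquivalence : (Fin n → LF 𝒪 U) ≌ TangentLF U 𝒯 n :=
  haveI := he.faithful_sheetFunctor
  haveI := he.full_sheetFunctor
  haveI : he.sheetFunctor.EssSurj := ⟨fun N ↦ ⟨he.parts h𝒪 N.2,
    ⟨ObjectProperty.isoMk _ (he.sheetSumPartsIso h𝒪 N.2)⟩⟩⟩
  haveI : he.sheetFunctor.IsEquivalence := {}
  he.sheetFunctor.asEquivalence

end TangentMultiplication.IsIdempotentFrame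

end SheetParts

end

end BraneFibration

/-! ### The equivalence with families of locally free modules -/

theorem mainTheorem2 {𝕜 : Type*} [RCLike 𝕜] [NormedAlgebra 𝕜 ℂ] {E : Type*}
    [NormedAddCommGroup E] [NormedSpace 𝕜 E] [FiniteDimensional 𝕜 E] {k : WithTop ℕ∞}
    (hk : k = ∞ ∨ k = ω) {M : Type u} [TopologicalSpace M] [ChartedSpace E M]
    [IsManifold 𝓘(𝕜, E) k M] {𝒯 : TangentMultiplication (structureSheaf 𝕜 E k M)}
    (η : InvariantMetric 𝒯) (B : CardyFibration η (Module.finrank 𝕜 E))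
    (hT : B.IsTrivializable) (hB : B.IsMaximal) :
    ∃ 𝔘 : Set (Opens M), (∀ x : M, ∃ U ∈ 𝔘, x ∈ U) ∧
      ∀ U ∈ 𝔘, ∃ (hU : U ∈ B.cover) (e : Fin (Module.finrank 𝕜 E) → 𝒯.Sec U)
        (ξ : Fin (Module.finrank 𝕜 E) → B.Label U),
        𝒯.IsIdempotentFrame e ∧
        (∀ i, CardyFibration.IsSupportedOn hU (ξ i) (e i)) ∧
        (∀ i, Nonempty (LinearStack.homSheaf (ξ i) (ξ i) ≅
          SheafOfModules.unit ((structureSheaf 𝕜 E k M).sheaf.over U))) ∧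
        (∃ (G : (Fin (Module.finrank 𝕜 E) → LF (structureSheaf 𝕜 E k M) U) ⥤ B.Label U)
          (_ : 𝟭 (B.Label U) ≅ Functor.pi' (fun i ↦ CYFibration.homFunctor (ξ i)) ⋙ G)
          (γ : 𝟭 (Fin (Module.finrank 𝕜 E) → LF (structureSheaf 𝕜 E k M) U) ≅
            G ⋙ Functor.pi' (fun i ↦ CYFibration.homFunctor (ξ i))),
          ∀ N, CYFibration.IsSumOfTensors (fun i ↦ (N i).obj) ξ (G.obj N)
            (fun i ↦ (γ.hom.app N i).hom)) ∧
        Nonempty (B.Label U ≌ TangentLF U 𝒯 (Module.finrank 𝕜 E)) := by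
  have hk1 : 1 ≤ k := by rcases hk with rfl | rfl <;> simp
  have : LocallyConnectedSpace E := by
    let _ := NormedSpace.restrictScalars ℝ 𝕜 E
    infer_instance
  have : LocallyConnectedSpace M := ChartedSpace.locallyConnectedSpace E M
  have h𝒪 := structureSheaf_hasLocalInverses (𝕜 := 𝕜) (E := E) (k := k) (M := M) hk1
  -- a neighbourhood in the cover for each point, on which there are fibre functors for all sheets
  choose V hV D hx Φ using fun x : M ↦ B.exists_fibreFunctors h𝒪
    (structureSheaf_hasLocalEigenvectors hk1) (structureSheaf_hasLocalRoots hk1)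
    structureSheaf_isContinuous hT x
  refine ⟨Set.range V, fun x ↦ ⟨V x, ⟨x, rfl⟩, hx x⟩, ?_⟩
  rintro _ ⟨x, rfl⟩
  obtain ⟨Φ⟩ := Φ x
  obtain ⟨ξ, hξ, hsupp, hunit⟩ := CardyFibration.exists_isComplete h𝒪 (hB (V x) (hV x)) Φ
  have := hξ.isEquivalence
  let F := Functor.pi' fun i ↦ CYFibration.homFunctor (ξ i)
  -- the counit is inverted, as the canonical morphisms point into `F (G N)`
  let γ := F.asEquivalence.counitIso.symm
  refine ⟨hV x, (D x).e, ξ, (D x).frame, hsupp, hunit,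
    ⟨F.asEquivalence.inverse, F.asEquivalence.unitIso, γ, fun N ↦ ?_⟩,
    ⟨F.asEquivalence.trans ((D x).frame.sheetEquivalence h𝒪)⟩⟩
  exact hξ.isSumOfTensors N (F.asEquivalence.inverse.obj N) fun i ↦
    (ObjectProperty.ι _).mapIso (((Pi.eval _ i).mapIso (γ.app N)))
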